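/- **Setting.** Let $G=GL(n,\mathbb C)$, regarded as a real Lie group with Lie algebra $\mathfrak g=gl(n,\mathbb C)$, let $K=U(n)$, and let $B$ be the group of lower triangular matrices with positive diagonal entries. Their Lie algebras are $\mathfrak k$ (skew-Hermitian matrices) and $\mathfrak b$ (lower triangular matrices with real diagonal), and $\mathfrak g=\mathfrak k\oplus\mathfrak b$. Let $\Pi_{\mathfrak k},\Pi_{\mathfrak b}$ be the projections for this splitting, $J=\Pi_{\mathfrak k}-\Pi_{\mathfrak b}$, $[X,Y]_J=\frac12([JX,Y]+[X,JY])$, and let $\mathfrak g_J$ be $\mathfrak g$ with the bracket $[\cdot,\cdot]_J$. Put $(X,Y)=\operatorname{Im}\operatorname{tr}(XY)$; this pairing identifies $\mathfrak g$ with its real dual. For $\varphi\in C^\infty(G)$ (real valued) define $D\varphi(g),D'\varphi(g)\in\mathfrak g$ by $$(D\varphi(g),X)=\tfrac{d}{dt}\Big|_{t=0}\varphi(e^{tX}g),\qquad (D'\varphi(g),X)=\tfrac{d}{dt}\Big|_{t=0}\varphi(ge^{tX}),\qquad X\in\mathfrak g,$$ and the Sklyanin bracket $$\{\varphi,\psi\}_J(g)=\tfrac12\big(J(D'\varphi(g)),D'\psi(g)\big)-\tfrac12\big(J(D\varphi(g)),D\psi(g)\big).$$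 The Hamiltonian equation of motion generated by $\varphi$ is $\frac{d}{dt}\psi(g(t))=\{\varphi,\psi\}(g(t))$ for all smooth $\psi$. For a matrix $X$ let $X_{\rm u}$ be its strictly upper triangular part plus half of its diagonal part. **Proposition.** Let $n\ge 0$. (a) $J$ is skew-symmetric with respect to $(\cdot,\cdot)$. $(G,\{\cdot,\cdot\}_J)$ is a coboundary Poisson Lie group (its Poisson bivector is the difference of the left and right translates of an element of $\mathfrak g\wedge\mathfrak g$), with tangent Lie bialgebra $(\mathfrak g,\mathfrak g_J)$, where $\mathfrak g_J$ is identified with $\mathfrak g^*$ by the pairing. $K=U(n)$ is a Poisson Lie subgroup: a closed subgroup with a Poisson bracket on $C^\infty(K)$ that makes $K$ a Poisson Lie group and the inclusion $K\to G$ a Poisson map. (b) The Hamiltonian equation of motion generated by $\varphi\in C^\infty(G)$ is $$\dot g=g\,\Pi_{\mathfrak k}(D'\varphi(g))-\Pi_{\mathfrak k}(D\varphi(g))\,g .$$ In particular, for $k\ge1$ and $H_k(g)=\frac1k\operatorname{Re}\operatorname{tr}g^k$ it is $$\dot g=g\big(i(g^k)_{\rm u}+i((g^k)_{\rm u})^*\big)-\big(i(g^k)_{\rm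 u}+i((g^k)_{\rm u})^*\big)g. \tag{1}$$ (c) Every $g\in G$ can be written as $g=g_+g_-^{-1}$ with unique $g_+\in K$ and $g_-\in B$. The set $G$ with its usual manifold structure and the multiplication $$g*h=g_+hg_-^{-1}$$ is a Lie group with Lie algebra $\mathfrak g_J$, and it is the underlying group of a Poisson Lie group dual to $(G,\{\cdot,\cdot\}_J)$; that is, it carries a multiplicative Poisson bracket for which its tangent Lie bialgebra is $(\mathfrak g_J,\mathfrak g)$, where $\mathfrak g$ is identified with $(\mathfrak g_J)^*$ by the pairing. (d) Give $G\times G$ the product Poisson structure. For $k\ge1$ the Hamiltonian equations of motion generated by $\widetilde H_k(g_1,g_2)=\frac1k\operatorname{Re}\operatorname{tr}(g_1g_2)^k$ are $$\dot g_1=g_1\Pi_{\mathfrak k}(i(g_2g_1)^k)-\Pi_{\mathfrak k}(i(g_1g_2)^k)g_1,\qquad \dot g_2=g_2\Pi_{\mathfrak k}(i(g_1g_2)^k)-\Pi_{\mathfrak k}(i(g_2g_1)^k)g_2,$$ and along their solutions the monodromy matrix $g=g_1g_2$ satisfies (1). -/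

import Mathlib

open scoped Manifold ContDiff Matrix Matrix.Norms.L2Operator

noncomputable section

namespace PoissonLie

/-! ### Poisson brackets and Poisson Lie groups -/

section General

variable {M N : Type*}

/-- `b` is a Poisson bracket on the algebra of those functions on `M` which satisfy `S`
("the smooth functions"). Values of `b` on other functions are irrelevant. -/
structure IsPoissonBracket (S : (M → ℝ) → Prop) (b : (M → ℝ) → (M → ℝ) → M → ℝ) : Prop where
  smooth : ∀ φ ψ, S φ → S ψ → S (b φ ψ)
  add_left : ∀ φ₁ φ₂ ψ, S φ₁ → S φ₂ → S ψ → b (φ₁ + φ₂) ψ = b φ₁ ψ + b φ₂ ψ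
  smul_left : ∀ (c : ℝ) φ ψ, S φ → S ψ → b (c • φ) ψ = c • b φ ψ
  skew : ∀ φ ψ, S φ → S ψ → b φ ψ = - b ψ φ
  leibniz : ∀ φ ψ χ, S φ → S ψ → S χ → b φ (ψ * χ) = b φ ψ * χ + ψ * b φ χ
  jacobi : ∀ φ ψ χ, S φ → S ψ → S χ →
    b φ (b ψ χ) + b ψ (b χ φ) + b χ (b φ ψ) = 0

/-- The product Poisson structure on `M × N`:
`{φ, ψ}(x, y) = {φ(·, y), ψ(·, y)}(x) + {φ(x, ·), ψ(x, ·)}(y)`. -/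
def prodBracket (b : (M → ℝ) → (M → ℝ) → M → ℝ) (c : (N → ℝ) → (N → ℝ) → N → ℝ)
    (φ ψ : M × N → ℝ) (p : M × N) : ℝ :=
  b (fun x => φ (x, p.2)) (fun x => ψ (x, p.2)) p.1 +
    c (fun y => φ (p.1, y)) (fun y => ψ (p.1, y)) p.2

/-- `b` is multiplicative: the multiplication `G × G → G` is a Poisson map, where `G × G` carries
the product structure. -/
def IsMultiplicative {G : Type*} [Mul G] (S : (G → ℝ) → Prop)
    (b : (G → ℝ) → (G → ℝ) → G → ℝ) : Prop :=
  ∀ φ ψ, S φ → S ψ → ∀ p : G × G,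
    prodBracket b b (fun q => φ (q.1 * q.2)) (fun q => ψ (q.1 * q.2)) p = b φ ψ (p.1 * p.2)

/-- The curve `γ` satisfies at time `t` the Hamiltonian equation of motion generated by `H`,
that is `d/dt ψ(γ(t)) = {H, ψ}(γ(t))` for every smooth `ψ`. -/
def HamiltonEqAt (S : (M → ℝ) → Prop) (b : (M → ℝ) → (M → ℝ) → M → ℝ) (H : M → ℝ)
    (γ : ℝ → M) (t : ℝ) : Prop :=
  ∀ ψ, S ψ → HasDerivAt (fun s => ψ (γ s)) (b H ψ (γ t)) t

/-- A real Lie algebra structure on `V`, as a property of a binary operation. -/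
structure IsLieBracket {V : Type*} [AddCommGroup V] [Module ℝ V] (c : V → V → V) : Prop where
  add_left : ∀ x y z, c (x + y) z = c x z + c y z
  smul_left : ∀ (a : ℝ) x y, c (a • x) y = a • c x y
  skew : ∀ x y, c x y = - c y x
  jacobi : ∀ x y z, c x (c y z) + c y (c z x) + c z (c x y) = 0

end General

section LieGroups

variable {E H : Type*} [NormedAddCommGroup E] [NormedSpace ℝ E] [TopologicalSpace H]
  (I : ModelWithCorners ℝ E H) {G : Type*} [TopologicalSpace G] [ChartedSpace H G]

/-- `C^∞` real functions on a manifold. -/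
def Smooth (φ : G → ℝ) : Prop := ContMDiff I 𝓘(ℝ, ℝ) ∞ φ

variable [Group G]

/-- `G` with the bracket `b` is a Poisson Lie group. -/
structure IsPoissonLieGroup (b : (G → ℝ) → (G → ℝ) → G → ℝ) : Prop where
  lieGroup : LieGroup I ∞ G
  poisson : IsPoissonBracket (Smooth I) b
  multiplicative : IsMultiplicative (Smooth I) b

/-- The differential at the identity, an element of `𝔤*`. -/
def diffOne (φ : G → ℝ) : GroupLieAlgebra I G →L[ℝ] ℝ := mfderiv I 𝓘(ℝ, ℝ) φ 1

/-- A coboundary Poisson Lie group: the Poisson bivector is the difference of the left and right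
translates of some `r ∈ 𝔤 ∧ 𝔤`, here viewed as an alternating bilinear form on `𝔤*`.
The function `h ↦ φ (g * h)` has at `1` the differential of `φ` at `g` pulled back by
left translation, and `h ↦ φ (h * g)` the one pulled back by right translation. -/
structure IsCoboundaryPoissonLieGroup (b : (G → ℝ) → (G → ℝ) → G → ℝ) : Prop extends
    IsPoissonLieGroup I b where
  coboundary : ∃ r : (GroupLieAlgebra I G →L[ℝ] ℝ) →ₗ[ℝ] (GroupLieAlgebra I G →L[ℝ] ℝ) →ₗ[ℝ] ℝ,
    r.IsAlt ∧ ∀ φ ψ, Smooth I φ → Smooth I ψ → ∀ g : G,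
      b φ ψ g =
        r (diffOne I fun h => φ (g * h)) (diffOne I fun h => ψ (g * h)) -
          r (diffOne I fun h => φ (h * g)) (diffOne I fun h => ψ (h * g))

/-- Smooth functions on a closed subgroup `K` of `G` (an embedded submanifold): the restrictions
to `K` of the smooth functions on `G`. -/
def SmoothOn (K : Subgroup G) (f : K → ℝ) : Prop :=
  ∃ φ : G → ℝ, Smooth I φ ∧ ∀ k : K, f k = φ k

/-- The closed subgroup `K` is a Poisson Lie subgroup of `(G, b)`: it has a Poisson bracket
which makes it a Poisson Lie group and for which the inclusion `K → G` is a Poisson map. -/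
def IsPoissonLieSubgroup (b : (G → ℝ) → (G → ℝ) → G → ℝ) (K : Subgroup G) : Prop :=
  IsClosed (K : Set G) ∧ ∃ bK : (K → ℝ) → (K → ℝ) → K → ℝ,
    IsPoissonBracket (SmoothOn I K) bK ∧ IsMultiplicative (SmoothOn I K) bK ∧
    ∀ φ ψ : G → ℝ, Smooth I φ → Smooth I ψ → ∀ k : K,
      bK (fun x => φ x) (fun x => ψ x) k = b φ ψ k

variable {I} in
/-- `ξ'` is `ad*_X ξ`, where `𝔥` is identified with `𝔤*` through `P`:
`⟨Z, ad*_X ξ⟩ = - ⟨[X, Z], ξ⟩` for all `Z`. -/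
def IsCoad {𝔥 : Type*} [AddCommGroup 𝔥] [Module ℝ 𝔥] (P : GroupLieAlgebra I G →ₗ[ℝ] 𝔥 →ₗ[ℝ] ℝ)
    (X : GroupLieAlgebra I G) (ξ ξ' : 𝔥) : Prop :=
  ∀ Z : GroupLieAlgebra I G, P Z ξ' = - P ⁅X, Z⁆ ξ

/-- The tangent Lie bialgebra of `(G, b)` is `(𝔤, 𝔥)`, where `𝔥` has the bracket `d` and is
identified with `𝔤*` through the pairing `P`. -/
structure HasTangentLieBialgebra (b : (G → ℝ) → (G → ℝ) → G → ℝ)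
    {𝔥 : Type*} [AddCommGroup 𝔥] [Module ℝ 𝔥] (d : 𝔥 → 𝔥 → 𝔥)
    (P : GroupLieAlgebra I G →ₗ[ℝ] 𝔥 →ₗ[ℝ] ℝ) : Prop where
  /-- `𝔥` is the dual space of `𝔤` -/
  perfect : ∀ l : GroupLieAlgebra I G →L[ℝ] ℝ, ∃! ξ : 𝔥, ∀ X, P X ξ = l X
  /-- `d` is a Lie bracket -/
  lie : IsLieBracket d
  /-- the map `δ : 𝔤 → 𝔤 ⊗ 𝔤` dual to `d` is a cocycle: `δ[X, Y] = X • δ Y - Y • δ X` -/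
  cocycle : ∀ (X Y : GroupLieAlgebra I G) (ξ η Xξ Xη Yξ Yη : 𝔥),
    IsCoad P X ξ Xξ → IsCoad P X η Xη → IsCoad P Y ξ Yξ → IsCoad P Y η Yη →
    P ⁅X, Y⁆ (d ξ η) = - (P Y (d Xξ η) + P Y (d ξ Xη)) + (P X (d Yξ η) + P X (d ξ Yη))
  /-- `d` is the linearization of `b` at the identity: `[d₁φ, d₁ψ] = d₁{φ, ψ}` -/
  tangent : ∀ φ ψ, Smooth I φ → Smooth I ψ → ∀ ξ η : 𝔥,
    (∀ X, diffOne I φ X = P X ξ) → (∀ X, diffOne I ψ X = P X η) →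
    ∀ X, diffOne I (b φ ψ) X = P X (d ξ η)

/-- Two Poisson Lie groups are dual to each other with respect to a pairing `P` of their Lie
algebras: the tangent Lie bialgebra of the first is `(𝔤, 𝔤')`, and that of the second is
`(𝔤', 𝔤)`. -/
structure AreDualPoissonLieGroups {E' H' : Type*} [NormedAddCommGroup E'] [NormedSpace ℝ E']
    [TopologicalSpace H'] (I' : ModelWithCorners ℝ E' H')
    {G' : Type*} [TopologicalSpace G'] [ChartedSpace H' G'] [Group G']
    (b : (G → ℝ) → (G → ℝ) → G → ℝ) (b' : (G' → ℝ) → (G' → ℝ) → G' → ℝ)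
    (P : GroupLieAlgebra I G →ₗ[ℝ] GroupLieAlgebra I' G' →ₗ[ℝ] ℝ) : Prop where
  left : IsPoissonLieGroup I b
  right : IsPoissonLieGroup I' b'
  tangent_left : HasTangentLieBialgebra I b (fun X Y : GroupLieAlgebra I' G' => ⁅X, Y⁆) P
  tangent_right : HasTangentLieBialgebra I' b' (fun X Y : GroupLieAlgebra I G => ⁅X, Y⁆) P.flip

end LieGroups

/-! ### The group `GL(n, ℂ)` as a real Lie group, and the Iwasawa splitting -/

/-- `gl(n, ℂ)`. -/
abbrev Mat (n : ℕ) : Type := Matrix (Fin n) (Fin n) ℂ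

/-- `GL(n, ℂ)`. Mathlib's manifold structure on it has the inclusion in `Mat n` as its chart, so
that every tangent space is `Mat n`. -/
abbrev Gl (n : ℕ) : Type := GL (Fin n) ℂ

/-- The real model space of `GL(n, ℂ)`. -/
abbrev Imat (n : ℕ) : ModelWithCorners ℝ (Mat n) (Mat n) := 𝓘(ℝ, Mat n)

variable {n : ℕ}

/-- `K = U(n)`. -/
def K (n : ℕ) : Subgroup (Gl n) := (Matrix.unitaryGroup (Fin n) ℂ).units

/-- `B`: the lower triangular matrices with positive diagonal entries. -/
def B (n : ℕ) : Set (Gl n) :=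
  {g | (∀ i j, i < j → (g : Mat n) i j = 0) ∧
    ∀ i, 0 < ((g : Mat n) i i).re ∧ ((g : Mat n) i i).im = 0}

/-- `(p.1, p.2) = (g₊, g₋)`: the factors of `g = g₊ g₋⁻¹`. -/
def IsIwasawa (g : Gl n) (p : Gl n × Gl n) : Prop :=
  p.1 ∈ K n ∧ p.2 ∈ B n ∧ g = p.1 * p.2⁻¹

/-- The unique pair of factors `(g₊, g₋)` of `g`. -/
def iwasawa (g : Gl n) : Gl n × Gl n := Classical.epsilon (IsIwasawa g)

/-- `g ∗ h = g₊ h g₋⁻¹`. -/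
def starMul (g h : Gl n) : Gl n := (iwasawa g).1 * h * (iwasawa g).2⁻¹

/-- The Lie algebra of `K`: skew-Hermitian matrices. -/
def 𝔨 (n : ℕ) : Submodule ℝ (Mat n) where
  carrier := {X | Xᴴ = -X}
  add_mem' {X Y} hX hY := by
    simp only [Set.mem_ofPred_eq] at *
    rw [Matrix.conjTranspose_add, hX, hY]; abel
  zero_mem' := by simp
  smul_mem' c X hX := by
    simp only [Set.mem_ofPred_eq] at *
    rw [Matrix.conjTranspose_smul, hX]; simp

/-- The Lie algebra of `B`: lower triangular matrices with real diagonal entries. -/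
def 𝔟 (n : ℕ) : Submodule ℝ (Mat n) where
  carrier := {X | (∀ i j, i < j → X i j = 0) ∧ ∀ i, (X i i).im = 0}
  add_mem' {X Y} hX hY :=
    ⟨fun i j h => by simp [hX.1 i j h, hY.1 i j h], fun i => by simp [hX.2 i, hY.2 i]⟩
  zero_mem' := by simp
  smul_mem' c X hX := ⟨fun i j h => by simp [hX.1 i j h], fun i => by simp [hX.2 i]⟩

/-- The upper triangular part of `X` with half of its diagonal: the strictly upper triangular
entries of `X`, half of its diagonal entries, and zeros below the diagonal. -/
def upperPart (X : Mat n) : Mat n :=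
  Matrix.of fun i j => if i < j then X i j else if i = j then X i j / 2 else 0

theorem upperPart_sub_mem (X : Mat n) : upperPart X - (upperPart X)ᴴ ∈ 𝔨 n := by
  change (_ : Mat n)ᴴ = _
  simp [Matrix.conjTranspose_sub]

theorem sub_upperPart_mem (X : Mat n) : X - (upperPart X - (upperPart X)ᴴ) ∈ 𝔟 n := by
  refine ⟨fun i j h => ?_, fun i => ?_⟩
  · simp [upperPart, h, h.not_gt, h.ne']
  · simp [upperPart]
    ring

theorem isCompl_𝔨_𝔟 (n : ℕ) : IsCompl (𝔨 n) (𝔟 n) := by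
  constructor
  · rw [Submodule.disjoint_def]
    intro X hk hb
    have hk' : ∀ i j, star (X j i) = - X i j := fun i j => by
      have := congrFun (congrFun (show Xᴴ = -X from hk) i) j
      simpa using this
    ext i j
    rcases lt_trichotomy i j with h | h | h
    · simpa using hb.1 i j h
    · subst h
      have h1 := hk' i i
      have h2 := hb.2 i
      apply Complex.ext
      · have := congrArg Complex.re h1
        simp at this
        simp; linarith
      · simpa using h2
    · have := hk' i j
      rw [hb.1 j i h] at this
      simpa using this.symm
  · rw [codisjoint_iff, Submodule.eq_top_iff']
    intro X
    rw [Submodule.mem_sup]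
    exact ⟨_, upperPart_sub_mem X, _, sub_upperPart_mem X, by abel⟩

/-- The projection onto `𝔨` along `𝔟`. -/
def projK : Mat n →ₗ[ℝ] Mat n := (𝔨 n).projection (𝔟 n) (isCompl_𝔨_𝔟 n)

/-- The projection onto `𝔟` along `𝔨`. -/
def projB : Mat n →ₗ[ℝ] Mat n := (𝔟 n).projection (𝔨 n) (isCompl_𝔨_𝔟 n).symm

/-- `J = Π_𝔨 - Π_𝔟`. -/
def J : Mat n →ₗ[ℝ] Mat n := projK - projB

/-- The Lie bracket of `gl(n, ℂ)`. -/
def commBracket (X Y : Mat n) : Mat n := X * Y - Y * X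

/-- The `J`-bracket `[X, Y]_J = ([J X, Y] + [X, J Y]) / 2`. -/
def jBracket (X Y : Mat n) : Mat n := 
  (1 / 2 : ℝ) • (commBracket (J X) Y + commBracket X (J Y))

/-- The pairing `(X, Y) = Im tr (X Y)`. -/
def pairing (n : ℕ) : Mat n →ₗ[ℝ] Mat n →ₗ[ℝ] ℝ :=
  LinearMap.mk₂ ℝ (fun X Y => (X * Y).trace.im)
    (fun X Y Z => by simp [add_mul]) (fun c X Y => by simp)
    (fun X Y Z => by simp [mul_add]) (fun c X Y => by simp)

/-- The matrix exponential, with values in `GL(n, ℂ)`. -/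
def expGl (X : Mat n) : Gl n := (Matrix.isUnit_exp X).unit

/-- The right gradient: `(Dφ(g), X) = d/dt φ(e^{tX} g)` at `t = 0`, for all `X`. -/
def grad (φ : Gl n → ℝ) (g : Gl n) : Mat n :=
  Classical.epsilon fun Z => ∀ X : Mat n,
    HasDerivAt (fun t : ℝ => φ (expGl (t • X) * g)) (pairing n Z X) 0

/-- The left gradient: `(D'φ(g), X) = d/dt φ(g e^{tX})` at `t = 0`, for all `X`. -/
def grad' (φ : Gl n → ℝ) (g : Gl n) : Mat n :=
  Classical.epsilon fun Z => ∀ X : Mat n,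
    HasDerivAt (fun t : ℝ => φ (g * expGl (t • X))) (pairing n Z X) 0

/-- The pairing identifies `gl(n, ℂ)` with its real dual. -/
theorem existsUnique_pairing_eq (l : Mat n →ₗ[ℝ] ℝ) : ∃! Z, ∀ X, pairing n Z X = l X := by
  have hb : ∀ (Z : Mat n) (i j : Fin n) (c : ℂ),
      pairing n Z (Matrix.single j i c) = (Z i j * c).im := by
    intro Z i j c
    change (Z * Matrix.single j i c).trace.im = _
    rw [Matrix.trace_mul_single]; rfl
  refine ⟨Matrix.of fun i j =>
    ⟨l (Matrix.single j i Complex.I), l (Matrix.single j i 1)⟩, fun X => ?_, fun Z hZ => ?_⟩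
  · have : (pairing n (Matrix.of fun i j =>
        (⟨l (Matrix.single j i Complex.I), l (Matrix.single j i 1)⟩ : ℂ))) = l := by
      apply LinearMap.ext
      intro X
      rw [Matrix.matrix_eq_sum_single X]
      simp only [map_sum]
      refine Finset.sum_congr rfl fun i _ => Finset.sum_congr rfl fun j _ => ?_
      have hX : Matrix.single i j (X i j) = (X i j).re • Matrix.single i j (1 : ℂ) +
          (X i j).im • Matrix.single i j Complex.I := by
        rw [Matrix.smul_single, Matrix.smul_single, ← Matrix.single_add]
        congr 1
        simp
      rw [hX, map_add, map_add, map_smul, map_smul, map_smul, map_smul, hb, hb]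
      simp
    rw [this]
  · ext i j
    have h1 := hZ (Matrix.single j i 1)
    have h2 := hZ (Matrix.single j i Complex.I)
    rw [hb] at h1 h2
    apply Complex.ext
    · simpa using h2
    · simpa using h1

theorem hasDerivAt_smooth_comp {φ : Gl n → ℝ} (h : Smooth (Imat n) φ) (g : Gl n) {γ : ℝ → Gl n}
    (h0 : γ 0 = g) {V : Mat n} (hv : HasDerivAt (fun t => (γ t : Mat n)) V 0) :
    HasDerivAt (fun t => φ (γ t)) (fderiv ℝ (φ ∘ (chartAt (Mat n) g).symm) g V) 0 := by
  have hm : MDifferentiableAt (Imat n) 𝓘(ℝ,ℝ) φ g := h.mdifferentiable (by simp) g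
  have hd : DifferentiableAt ℝ (φ ∘ (chartAt (Mat n) g).symm) (g : Mat n) := by
    have := hm.differentiableWithinAt_writtenInExtChartAt
    simp only [writtenInExtChartAt, extChartAt, mfld_simps, differentiableWithinAt_univ] at this
    exact this
  have hf : HasFDerivAt (φ ∘ (chartAt (Mat n) g).symm)
      (fderiv ℝ (φ ∘ (chartAt (Mat n) g).symm) g) ((fun t => (γ t : Mat n)) 0) := by
    simp only [h0]
    exact hd.hasFDerivAt
  have := hf.comp_hasDerivAt (0 : ℝ) hv
  refine this.congr_of_eventuallyEq (Filter.Eventually.of_forall fun t => ?_)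
  exact congrArg φ ((chartAt (Mat n) g).left_inv (by
    rw [Units.chartAt_source]; trivial : γ t ∈ (chartAt (Mat n) g).source)).symm

theorem hasDerivAt_expGl (X : Mat n) : HasDerivAt (fun t : ℝ => (expGl (t • X) : Mat n)) X 0 := by
  have := hasDerivAt_exp_smul_const (𝕂 := ℝ) X (0 : ℝ)
  rw [zero_smul, NormedSpace.exp_zero, one_mul] at this
  exact this

theorem expGl_zero : expGl (0 : Mat n) = 1 := by
  ext1; simp [expGl]

/-- The right gradient of a smooth function exists. -/
theorem grad_spec {φ : Gl n → ℝ} (h : Smooth (Imat n) φ) (g : Gl n) (X : Mat n) :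
    HasDerivAt (fun t : ℝ => φ (expGl (t • X) * g)) (pairing n (grad φ g) X) 0 := by
  obtain ⟨Z, hZ, -⟩ := existsUnique_pairing_eq
    ((fderiv ℝ (φ ∘ (chartAt (Mat n) g).symm) g : Mat n →ₗ[ℝ] ℝ) ∘ₗ
      LinearMap.mulRight ℝ (g : Mat n))
  refine Classical.epsilon_spec (p := fun Z => ∀ X : Mat n,
    HasDerivAt (fun t : ℝ => φ (expGl (t • X) * g)) (pairing n Z X) 0) ⟨Z, fun X => ?_⟩ X
  rw [hZ]
  refine hasDerivAt_smooth_comp h g (by simp [expGl_zero]) ?_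
  exact (hasDerivAt_expGl X).mul_const (g : Mat n)

/-- The left gradient of a smooth function exists. -/
theorem grad'_spec {φ : Gl n → ℝ} (h : Smooth (Imat n) φ) (g : Gl n) (X : Mat n) :
    HasDerivAt (fun t : ℝ => φ (g * expGl (t • X))) (pairing n (grad' φ g) X) 0 := by
  obtain ⟨Z, hZ, -⟩ := existsUnique_pairing_eq
    ((fderiv ℝ (φ ∘ (chartAt (Mat n) g).symm) g : Mat n →ₗ[ℝ] ℝ) ∘ₗ
      LinearMap.mulLeft ℝ (g : Mat n))
  refine Classical.epsilon_spec (p := fun Z => ∀ X : Mat n,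
    HasDerivAt (fun t : ℝ => φ (g * expGl (t • X))) (pairing n Z X) 0) ⟨Z, fun X => ?_⟩ X
  rw [hZ]
  refine hasDerivAt_smooth_comp h g (by simp [expGl_zero]) ?_
  exact (hasDerivAt_expGl X).const_mul (g : Mat n)

/-- The Sklyanin bracket
`{φ, ψ}_J (g) = ((J (D'φ(g)), D'ψ(g)) - (J (Dφ(g)), Dψ(g))) / 2`. -/
def sklyanin (n : ℕ) (φ ψ : Gl n → ℝ) (g : Gl n) : ℝ :=
  (1 / 2) * (pairing n (J (grad' φ g)) (grad' ψ g) - pairing n (J (grad φ g)) (grad ψ g))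

/-- `H_k (g) = (1 / k) Re tr g^k`. -/
def ham (k : ℕ) (g : Gl n) : ℝ := (1 / k : ℝ) * ((g : Mat n) ^ k).trace.re

/-- The right-hand side of the explicit equation of motion generated by `H_k`. -/
def flowField (k : ℕ) (g : Mat n) : Mat n :=
  g * (Complex.I • upperPart (g ^ k) + Complex.I • (upperPart (g ^ k))ᴴ) -
    (Complex.I • upperPart (g ^ k) + Complex.I • (upperPart (g ^ k))ᴴ) * g

/-- The manifold `GL(n, ℂ)` without its usual group structure: the underlying manifold of the
dual group. -/
def DualGl (n : ℕ) : Type := Gl n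

instance : TopologicalSpace (DualGl n) := inferInstanceAs (TopologicalSpace (Gl n))

instance : ChartedSpace (Mat n) (DualGl n) := inferInstanceAs (ChartedSpace (Mat n) (Gl n))

end PoissonLie

end

open PoissonLie

/-! Every bracket here comes from one algebraic construction. Let `𝔸` be a finite-dimensional real
algebra with a nondegenerate trace `τ`, and let `R` be skew for `τ (x * y)` and satisfy the modified
Yang-Baxter equation. With covectors written as `τ (u * ·)`, the Sklyanin bivector becomes the
algebraic expression `bivector`. Its multiplicativity is a telescoping sum (`bivector_mul`). In the
Jacobi identity the second derivatives cancel by symmetry, and the rest (`bivector_jacobi`) is the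
difference of the Yang-Baxter identities for left and right translates. Both produce the same
invariant 3-form, so the modified equation suffices. The bivector vanishes at `1`, and its
linearization there is `([R u, w] + [u, R w]) / 2` (`bivectorDeriv_one`).

For `GL(n, ℂ)` take `R = J`, which is an `R`-matrix because `𝔨` and `𝔟` are complementary isotropic
subalgebras (`isRMatrix_of_projection`). Since `J = 2 projK - 1` and the constant part drops out of
Hamiltonian vectors, the equations of motion contain only `projK`. Conjugation by `K` preserves `𝔨`,
so Hamiltonian fields are tangent to `K` and the bracket restricts to it (`IsPoissonImmersion`).

The map `g ↦ (g₊, g₋)` identifies the dual group with `K × B`, a group of units of the double `Mat n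
× Mat n`. For the difference of the two trace forms, the double splits into the isotropic
subalgebras `𝔨 × 𝔟` and the diagonal. This gives a second `R`-matrix, whose bracket restricts to the
image of the dual group. It is the identity on the diagonal, and functions of `g₊ * g₋⁻¹` have
diagonal gradients at `1`, so the linearized bracket is the ordinary commutator. The cocycle
conditions on the two sides are one identity with the roles of the two Lie algebras exchanged.
Smoothness of the factors comes from the inverse function theorem at `1` and translations.

For the product, the gradients of `H_k (g₁ g₂)` in each variable give the two equations, and the
inner terms cancel in the derivative of `g₁ g₂`. -/

noncomputable section

namespace PoissonLie

/-! ### Trace forms and classical `R`-matrices on an associative algebra -/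

section Algebra

variable {𝔸 : Type*} [Ring 𝔸] [Algebra ℝ 𝔸]

/-- `τ` is a nondegenerate trace on `𝔸`, and `R` is a solution of the modified classical
Yang-Baxter equation which is skew-symmetric for the form `τ (x * y)`. -/
structure IsRMatrix (τ : 𝔸 →ₗ[ℝ] ℝ) (R : 𝔸 →ₗ[ℝ] 𝔸) : Prop where
  trace : ∀ x y, τ (x * y) = τ (y * x)
  nondegenerate : ∀ z, (∀ x, τ (z * x) = 0) → z = 0
  skew : ∀ x y, τ (R x * y) = - τ (x * R y)
  yangBaxter : ∀ x y, R x * R y - R y * R x =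
    R ((R x * y - y * R x) + (x * R y - R y * x)) - (x * y - y * x)

/-- The Sklyanin bivector at `a`, evaluated on the covectors `τ (u * ·)` and `τ (w * ·)`. -/
def bivector (τ : 𝔸 →ₗ[ℝ] ℝ) (R : 𝔸 →ₗ[ℝ] 𝔸) (a u w : 𝔸) : ℝ :=
  (1 / 2) * (τ (R (u * a) * (w * a)) - τ (R (a * u) * (a * w)))

/-- The derivative of `bivector` in the direction `v`. -/
def bivectorDeriv (τ : 𝔸 →ₗ[ℝ] ℝ) (R : 𝔸 →ₗ[ℝ] 𝔸) (a v u w : 𝔸) : ℝ :=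
  (1 / 2) * ((τ (R (u * v) * (w * a)) + τ (R (u * a) * (w * v))) -
    (τ (R (v * u) * (a * w)) + τ (R (a * u) * (v * w))))

/-- The contraction of the Sklyanin bivector at `a` with the covector `τ (u * ·)`. -/
def hamVector (R : 𝔸 →ₗ[ℝ] 𝔸) (a u : 𝔸) : 𝔸 :=
  (1 / 2 : ℝ) • (a * R (u * a) - R (a * u) * a)

/-- The term in `b * u * a` occurs once with each sign; this telescoping needs no property of `R` or
`τ`. -/
theorem bivector_mul (τ : 𝔸 →ₗ[ℝ] ℝ) (R : 𝔸 →ₗ[ℝ] 𝔸) (a b u w : 𝔸) :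
    bivector τ R a (b * u) (b * w) + bivector τ R b (u * a) (w * a) =
      bivector τ R (a * b) u w := by
  simp only [bivector, mul_assoc]
  ring

namespace IsRMatrix

variable {τ : 𝔸 →ₗ[ℝ] ℝ} {R : 𝔸 →ₗ[ℝ] 𝔸} (h : IsRMatrix τ R)

include h

theorem eq_of_trace_mul_eq {z w : 𝔸} (hzw : ∀ x, τ (z * x) = τ (w * x)) : z = w :=
  sub_eq_zero.1 <| h.nondegenerate _ fun x => by rw [sub_mul, map_sub, hzw, sub_self]

theorem bivector_eq (a u w : 𝔸) : bivector τ R a u w = τ (w * hamVector R a u) := by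
  have h1 := h.trace (R (u * a)) (w * a)
  have h2 := h.trace (R (a * u) * a) w
  simp only [bivector, hamVector, mul_smul_comm, map_smul, mul_sub, map_sub, smul_eq_mul,
    mul_assoc] at h1 h2 ⊢
  rw [h1, h2]

theorem bivector_skew (a u w : 𝔸) : bivector τ R a u w = - bivector τ R a w u := by
  have h1 := h.skew (u * a) (w * a)
  have h2 := h.skew (a * u) (a * w)
  rw [h.trace _ (R _)] at h1 h2
  simp only [bivector]
  linarith

/-- Pair the Yang-Baxter equation with `z`, move the outer `R` onto `z` by skewness, and rotate the
traces. The right-hand side is the invariant 3-form, free of `R`. -/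
theorem cyclic_yangBaxter (x y z : 𝔸) :
    τ (x * (R y * R z)) - τ (x * (R z * R y)) + (τ (y * (R z * R x)) - τ (y * (R x * R z))) +
      (τ (z * (R x * R y)) - τ (z * (R y * R x))) = - (τ (z * (x * y)) - τ (z * (y * x))) := by
  have h0 := congrArg (fun t => τ (z * t)) (h.yangBaxter x y)
  have h1 := h.skew z (R x * y - y * R x + (x * R y - R y * x))
  simp only [mul_sub, mul_add, map_sub, map_add] at h0 h1
  have e1 := h.trace (R z * R x) y
  have e2 := h.trace (R z) (y * R x)
  have e3 := h.trace (R z) (x * R y)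
  have e4 := h.trace (R z * R y) x
  simp only [mul_assoc] at e1 e2 e3 e4
  linarith

/-- The Jacobi identity for the Sklyanin bivector. -/
theorem bivector_jacobi (a u w z : 𝔸) :
    bivectorDeriv τ R a (hamVector R a u) w z + bivectorDeriv τ R a (hamVector R a w) z u +
      bivectorDeriv τ R a (hamVector R a z) u w = 0 := by
  -- Skewness takes `R` off the factor containing the Hamiltonian vector, so no nested `R` remains:
  -- each trace has exactly two separate occurrences of `R`.
  have key : ∀ u w z, bivectorDeriv τ R a (hamVector R a u) w z = (1 / 4) *
      (-τ ((w * a) * (R (u * a) * R (z * a))) + τ (w * (R (a * u) * (a * R (z * a)))) +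
        τ ((z * a) * (R (u * a) * R (w * a))) - τ (R (w * a) * (z * (R (a * u) * a))) +
        τ (a * (R (u * a) * (w * R (a * z)))) - τ ((a * w) * (R (a * z) * R (a * u))) -
        τ (R (a * w) * (a * (R (u * a) * z))) + τ ((a * z) * (R (a * w) * R (a * u)))) := by
    intro u w z
    have s1 := h.skew (w * hamVector R a u) (z * a)
    have s2 := h.skew (hamVector R a u * w) (a * z)
    have e1 := h.trace (R (w * a)) (z * a * R (u * a))
    have e2 := h.trace (R (a * u)) (a * w * R (a * z))
    have e3 := h.trace (R (a * w) * R (a * u)) (a * z)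
    simp only [bivectorDeriv, s1, s2]
    simp only [hamVector, mul_smul_comm, smul_mul_assoc, map_smul, mul_sub, sub_mul, map_sub,
      smul_eq_mul, mul_assoc] at e1 e2 e3 ⊢
    linarith
  -- The traces mixing left and right translates are brought to one normal form, in which they
  -- cancel in the cyclic sum.
  have c : ∀ u w z, τ (w * (R (a * u) * (a * R (z * a)))) =
      τ (R (a * u) * (a * (R (z * a) * w))) := fun u w z => by
    rw [h.trace w]; simp only [mul_assoc]
  have c' : ∀ u w z, τ (R (w * a) * (z * (R (a * u) * a))) =
      τ (R (a * u) * (a * (R (w * a) * z))) := fun u w z => by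
    rw [h.trace (R (a * u)), ← mul_assoc, ← mul_assoc, h.trace _ a]; simp only [mul_assoc]
  have c'' : ∀ u w z, τ (a * (R (u * a) * (w * R (a * z)))) =
      τ (R (a * z) * (a * (R (u * a) * w))) := fun u w z => by
    rw [h.trace (R (a * z))]; simp only [mul_assoc]
  have y1 := h.cyclic_yangBaxter (u * a) (w * a) (z * a)
  have y2 := h.cyclic_yangBaxter (a * u) (a * w) (a * z)
  rw [key, key, key]
  simp only [c, c', c'']
  -- The 3-form takes the same value on left and right translates, so the right-hand sides of `y1`
  -- and `y2` cancel.
  have f1 : τ (a * z * (a * u * (a * w))) = τ (z * a * (u * a * (w * a))) := by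
    have := h.trace a (z * (a * u * (a * w)))
    simp only [mul_assoc] at this ⊢; exact this
  have f2 : τ (a * z * (a * w * (a * u))) = τ (z * a * (w * a * (u * a))) := by
    have := h.trace a (z * (a * w * (a * u)))
    simp only [mul_assoc] at this ⊢; exact this
  linear_combination (1 / 4) * y1 - (1 / 4) * y2 + (1 / 4) * (f1 - f2)

/-- Skewness and cyclicity isolate `v`; what it multiplies is the Lie bracket that `R` induces on
the dual. -/
theorem bivectorDeriv_one (v u w : 𝔸) : bivectorDeriv τ R 1 v u w =
    τ (v * ((1 / 2 : ℝ) • ((R u * w - w * R u) + (u * R w - R w * u)))) := by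
  have s1 := h.skew (u * v) w
  have s2 := h.skew (v * u) w
  have e1 := h.trace u (v * R w)
  have e2 := h.trace (R u * w) v
  have e3 := h.trace (R u) (v * w)
  simp only [bivectorDeriv, mul_one, one_mul, s1, s2, mul_smul_comm, map_smul, mul_add, mul_sub,
    map_add, map_sub, smul_eq_mul, mul_assoc] at e1 e2 e3 ⊢
  linarith

end IsRMatrix

/-- For a projection `P` whose range and kernel are Lie subalgebras, isotropic for the form
`τ (x * y)`, the reflection `2 P - 1` is an `R`-matrix. -/
theorem isRMatrix_of_projection {τ : 𝔸 →ₗ[ℝ] ℝ} {P : 𝔸 →ₗ[ℝ] 𝔸}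
    (trace : ∀ x y, τ (x * y) = τ (y * x)) (nondegenerate : ∀ z, (∀ x, τ (z * x) = 0) → z = 0)
    (range_lie : ∀ x y, P (P x * P y - P y * P x) = P x * P y - P y * P x)
    (ker_lie : ∀ x y, P ((x - P x) * (y - P y) - (y - P y) * (x - P x)) = 0)
    (range_isotropic : ∀ x y, τ (P x * P y) = 0)
    (ker_isotropic : ∀ x y, τ ((x - P x) * (y - P y)) = 0) :
    IsRMatrix τ ((2 : ℝ) • P - 1) where
  trace := trace
  nondegenerate := nondegenerate
  skew x y := by
    have h1 := range_isotropic x y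
    have h2 := ker_isotropic x y
    simp [sub_mul, mul_sub] at h1 h2 ⊢
    linarith
  yangBaxter x y := by
    have h1 := range_lie x y
    have h2 := ker_lie x y
    simp only [LinearMap.sub_apply, LinearMap.smul_apply, Module.End.one_apply, map_sub, sub_mul,
      mul_sub, smul_mul_assoc, mul_smul_comm, map_add, map_smul, smul_sub] at h1 h2 ⊢
    rw [← sub_eq_zero] at h1 ⊢
    -- For `R = 2 P - 1` the Yang-Baxter defect is four times the difference of the closure defects
    -- of the kernel and the range.
    have := congrArg₂ (fun s t => (4 : ℝ) • (t - s)) h1 h2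
    simp only [sub_zero, smul_zero] at this
    rw [← this]
    module

/-- The Yang-Baxter equation is even in `R`. This freedom fixes the sign of the bracket on the dual
group. -/
theorem IsRMatrix.neg {τ : 𝔸 →ₗ[ℝ] ℝ} {R : 𝔸 →ₗ[ℝ] 𝔸} (h : IsRMatrix τ R) :
    IsRMatrix τ (-R) where
  trace := h.trace
  nondegenerate := h.nondegenerate
  skew x y := by simp [h.skew x y]
  yangBaxter x y := by
    have := h.yangBaxter x y
    simp only [map_add, map_sub] at this
    simp only [LinearMap.neg_apply, neg_mul, mul_neg, map_add, map_sub, map_neg, neg_neg, this]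

end Algebra

/-! ### Calculus on the group of units of a Banach algebra -/

section UnitsCalculus

open Filter Topology

variable {𝔸 : Type*} [NormedRing 𝔸] [CompleteSpace 𝔸]

/-- The function on the algebra which on units is `φ`. -/
def unitsLift {α : Type*} (φ : 𝔸ˣ → α) (a : 𝔸) : α := φ ((chartAt 𝔸 (1 : 𝔸ˣ)).symm a)

theorem chartAt_symm_val (g : 𝔸ˣ) : (chartAt 𝔸 (1 : 𝔸ˣ)).symm (g : 𝔸) = g :=
  (chartAt 𝔸 (1 : 𝔸ˣ)).left_inv (by rw [Units.chartAt_source]; trivial)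

@[simp]
theorem unitsLift_val {α : Type*} (φ : 𝔸ˣ → α) (g : 𝔸ˣ) : unitsLift φ (g : 𝔸) = φ g :=
  congrArg φ (chartAt_symm_val g)

theorem eventually_isUnit (g : 𝔸ˣ) : ∀ᶠ a in 𝓝 (g : 𝔸), ∃ u : 𝔸ˣ, (u : 𝔸) = a :=
  Units.isOpen.mem_nhds g.isUnit

/-- Units form an open set, so the values of a lift off the units do not affect its derivatives at a
unit. -/
theorem unitsLift_eventuallyEq {α : Type*} {φ : 𝔸ˣ → α} {f : 𝔸 → α}
    (h : ∀ g : 𝔸ˣ, φ g = f g) (g : 𝔸ˣ) : unitsLift φ =ᶠ[𝓝 (g : 𝔸)] f := by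
  filter_upwards [eventually_isUnit g]
  rintro _ ⟨u, rfl⟩
  rw [unitsLift_val, h]

variable [NormedAlgebra ℝ 𝔸]

theorem Smooth.contDiffAt {φ : 𝔸ˣ → ℝ} (h : Smooth 𝓘(ℝ, 𝔸) φ) (g : 𝔸ˣ) :
    ContDiffAt ℝ ∞ (unitsLift φ) (g : 𝔸) := by
  have hm : ContMDiffAt 𝓘(ℝ, 𝔸) 𝓘(ℝ, 𝔸) ∞ (chartAt 𝔸 (1 : 𝔸ˣ)).symm (g : 𝔸) := by
    refine contMDiffOn_chart_symm.contMDiffAt ((chartAt 𝔸 (1 : 𝔸ˣ)).open_target.mem_nhds ?_)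
    have := (chartAt 𝔸 (1 : 𝔸ˣ)).map_source (x := g) (by rw [Units.chartAt_source]; trivial)
    exact this
  exact (ContMDiffAt.comp (g : 𝔸) (h _) hm).contDiffAt

theorem smooth_of_contDiffAt {φ : 𝔸ˣ → ℝ} {f : 𝔸 → ℝ} (hf : ∀ g : 𝔸ˣ, ContDiffAt ℝ ∞ f g)
    (h : ∀ g : 𝔸ˣ, φ g = f g) : Smooth 𝓘(ℝ, 𝔸) φ := by
  have : φ = fun g : 𝔸ˣ => f (g : 𝔸) := funext h
  rw [this]
  exact fun g => ContMDiffAt.comp g (hf g).contMDiffAt (Units.contMDiff_val g)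

theorem Smooth.hasFDerivAt {φ : 𝔸ˣ → ℝ} (h : Smooth 𝓘(ℝ, 𝔸) φ) (g : 𝔸ˣ) :
    HasFDerivAt (unitsLift φ) (fderiv ℝ (unitsLift φ) (g : 𝔸)) (g : 𝔸) :=
  ((h.contDiffAt g).differentiableAt (by simp)).hasFDerivAt

theorem Smooth.hasDerivAt_comp {φ : 𝔸ˣ → ℝ} (h : Smooth 𝓘(ℝ, 𝔸) φ) {γ : ℝ → 𝔸ˣ} {V : 𝔸} {t : ℝ}
    (hγ : HasDerivAt (fun s => (γ s : 𝔸)) V t) :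
    HasDerivAt (fun s => φ (γ s)) (fderiv ℝ (unitsLift φ) (γ t : 𝔸) V) t := by
  have := (h.hasFDerivAt (γ t)).comp_hasDerivAt t hγ
  simpa [Function.comp_def] using this

theorem Smooth.mul_left {φ : 𝔸ˣ → ℝ} (h : Smooth 𝓘(ℝ, 𝔸) φ) (g : 𝔸ˣ) :
    Smooth 𝓘(ℝ, 𝔸) fun x => φ (g * x) :=
  h.comp contMDiff_mul_left

theorem Smooth.mul_right {φ : 𝔸ˣ → ℝ} (h : Smooth 𝓘(ℝ, 𝔸) φ) (g : 𝔸ˣ) :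
    Smooth 𝓘(ℝ, 𝔸) fun x => φ (x * g) :=
  h.comp contMDiff_mul_right

theorem fderiv_unitsLift_eq {φ : 𝔸ˣ → ℝ} {f : 𝔸 → ℝ} (h : ∀ g : 𝔸ˣ, φ g = f g) {g : 𝔸ˣ}
    {f' : 𝔸 →L[ℝ] ℝ} (hf : HasFDerivAt f f' g) : fderiv ℝ (unitsLift φ) (g : 𝔸) = f' :=
  (hf.congr_of_eventuallyEq (unitsLift_eventuallyEq h g)).fderiv

theorem fderiv_unitsLift_mul_left {φ : 𝔸ˣ → ℝ} (h : Smooth 𝓘(ℝ, 𝔸) φ) (g x : 𝔸ˣ) (V : 𝔸) :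
    fderiv ℝ (unitsLift fun y => φ (g * y)) (x : 𝔸) V =
      fderiv ℝ (unitsLift φ) ((g * x : 𝔸ˣ) : 𝔸) (g * V) := by
  have h1 : HasFDerivAt (fun a : 𝔸 => unitsLift φ (g * a))
      ((fderiv ℝ (unitsLift φ) ((g * x : 𝔸ˣ) : 𝔸)).comp (ContinuousLinearMap.mul ℝ 𝔸 g)) (x : 𝔸) :=
    HasFDerivAt.comp (x : 𝔸) (h.hasFDerivAt (g * x)) (ContinuousLinearMap.mul ℝ 𝔸 g).hasFDerivAt
  rw [fderiv_unitsLift_eq (fun y => ?_) h1]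
  · rfl
  · rw [← Units.val_mul, unitsLift_val]

theorem fderiv_unitsLift_mul_right {φ : 𝔸ˣ → ℝ} (h : Smooth 𝓘(ℝ, 𝔸) φ) (g x : 𝔸ˣ) (V : 𝔸) :
    fderiv ℝ (unitsLift fun y => φ (y * g)) (x : 𝔸) V =
      fderiv ℝ (unitsLift φ) ((x * g : 𝔸ˣ) : 𝔸) (V * g) := by
  have h1 : HasFDerivAt (fun a : 𝔸 => unitsLift φ (a * g))
      ((fderiv ℝ (unitsLift φ) ((x * g : 𝔸ˣ) : 𝔸)).comp
        ((ContinuousLinearMap.mul ℝ 𝔸).flip g)) (x : 𝔸) :=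
    HasFDerivAt.comp (f := fun a : 𝔸 => a * g) (x : 𝔸) (h.hasFDerivAt (x * g))
      ((ContinuousLinearMap.mul ℝ 𝔸).flip g).hasFDerivAt
  rw [fderiv_unitsLift_eq (fun y => ?_) h1]
  · rfl
  · rw [← Units.val_mul, unitsLift_val]

theorem smooth_clm_val (l : 𝔸 →L[ℝ] ℝ) : Smooth 𝓘(ℝ, 𝔸) fun g : 𝔸ˣ => l g :=
  smooth_of_contDiffAt (fun _ => l.contDiff.contDiffAt) fun _ => rfl

theorem fderiv_unitsLift_clm (l : 𝔸 →L[ℝ] ℝ) (g : 𝔸ˣ) :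
    fderiv ℝ (unitsLift fun g : 𝔸ˣ => l g) (g : 𝔸) = l :=
  fderiv_unitsLift_eq (fun _ => rfl) l.hasFDerivAt

theorem mfderiv_units_eq {φ : 𝔸ˣ → ℝ} (h : Smooth 𝓘(ℝ, 𝔸) φ) (g : 𝔸ˣ) :
    (mfderiv 𝓘(ℝ, 𝔸) 𝓘(ℝ, ℝ) φ g : 𝔸 →L[ℝ] ℝ) = fderiv ℝ (unitsLift φ) (g : 𝔸) := by
  have hm : MDifferentiableAt 𝓘(ℝ, 𝔸) 𝓘(ℝ, ℝ) φ g := h.mdifferentiable (by simp) g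
  simp only [mfderiv, hm, writtenInExtChartAt, extChartAt, mfld_simps,
    fderivWithin_univ]
  rfl

theorem diffOne_units_apply {φ : 𝔸ˣ → ℝ} (h : Smooth 𝓘(ℝ, 𝔸) φ)
    (X : GroupLieAlgebra 𝓘(ℝ, 𝔸) 𝔸ˣ) :
    diffOne 𝓘(ℝ, 𝔸) φ X = fderiv ℝ (unitsLift φ) ((1 : 𝔸ˣ) : 𝔸) (X : 𝔸) := by
  rw [← mfderiv_units_eq h]
  rfl

/-- Coordinates in a finite basis are linear forms. This recovers an equation of motion from linear
test functions. -/
theorem hasDerivAt_of_forall_clm {E : Type*} [NormedAddCommGroup E] [NormedSpace ℝ E]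
    [FiniteDimensional ℝ E] {γ : ℝ → E} {V : E} {t : ℝ}
    (h : ∀ l : E →L[ℝ] ℝ, HasDerivAt (fun s => l (γ s)) (l V) t) : HasDerivAt γ V t := by
  let e := (Module.finBasis ℝ E).equivFunL
  have h1 : HasDerivAt (fun s => e (γ s)) (e V) t :=
    hasDerivAt_pi.2 fun i =>
      h ((ContinuousLinearMap.proj (R := ℝ) (φ := fun _ => ℝ) i).comp e.toContinuousLinearMap)
  have := (e.symm : _ →L[ℝ] E).hasFDerivAt.comp_hasDerivAt t h1
  simpa [Function.comp_def] using this

end UnitsCalculus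

/-! ### The Sklyanin bracket on the group of units -/

section UnitsBracket

open Filter Topology

variable {𝔸 : Type*} [NormedRing 𝔸] [NormedAlgebra ℝ 𝔸] [FiniteDimensional ℝ 𝔸]
  {τ : 𝔸 →ₗ[ℝ] ℝ} {R : 𝔸 →ₗ[ℝ] 𝔸}

theorem HasDerivAt.linearMap_comp {E F : Type*} [NormedAddCommGroup E] [NormedSpace ℝ E]
    [FiniteDimensional ℝ E] [NormedAddCommGroup F] [NormedSpace ℝ F] (l : E →ₗ[ℝ] F)
    {γ : ℝ → E} {V : E} {t : ℝ} (h : HasDerivAt γ V t) : HasDerivAt (fun s => l (γ s)) (l V) t :=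
  (LinearMap.toContinuousLinearMap l).hasFDerivAt.comp_hasDerivAt t h

theorem ContDiffAt.linearMap_comp {E F M : Type*} [NormedAddCommGroup E] [NormedSpace ℝ E]
    [FiniteDimensional ℝ E] [NormedAddCommGroup F] [NormedSpace ℝ F] [NormedAddCommGroup M]
    [NormedSpace ℝ M] (l : E →ₗ[ℝ] F) {f : M → E} {x : M} {m : ℕ∞ω} (h : ContDiffAt ℝ m f x) :
    ContDiffAt ℝ m (fun y => l (f y)) x :=
  (LinearMap.toContinuousLinearMap l).contDiff.contDiffAt.comp x h

theorem HasDerivAt.bivector {a u w : ℝ → 𝔸} {a' u' w' : 𝔸} {t : ℝ} (ha : HasDerivAt a a' t)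
    (hu : HasDerivAt u u' t) (hw : HasDerivAt w w' t) :
    HasDerivAt (fun s => bivector τ R (a s) (u s) (w s))
      (bivectorDeriv τ R (a t) a' (u t) (w t) + bivector τ R (a t) u' (w t) +
        bivector τ R (a t) (u t) w') t := by
  have h := (((HasDerivAt.linearMap_comp τ ((HasDerivAt.linearMap_comp R (hu.mul ha)).mul
    (hw.mul ha))).sub (HasDerivAt.linearMap_comp τ
      ((HasDerivAt.linearMap_comp R (ha.mul hu)).mul (ha.mul hw)))).const_mul (1 / 2 : ℝ))
  refine h.congr_deriv ?_
  simp only [PoissonLie.bivector, bivectorDeriv, map_add, add_mul, mul_add, Pi.mul_apply]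
  ring

theorem ContDiffAt.bivector {M : Type*} [NormedAddCommGroup M] [NormedSpace ℝ M] {a u w : M → 𝔸}
    {x : M} {m : ℕ∞ω} (ha : ContDiffAt ℝ m a x) (hu : ContDiffAt ℝ m u x)
    (hw : ContDiffAt ℝ m w x) : ContDiffAt ℝ m (fun y => bivector τ R (a y) (u y) (w y)) x := by
  unfold PoissonLie.bivector
  exact contDiffAt_const.mul ((ContDiffAt.linearMap_comp τ
    ((ContDiffAt.linearMap_comp R (hu.mul ha)).mul (hw.mul ha))).sub
      (ContDiffAt.linearMap_comp τ ((ContDiffAt.linearMap_comp R (ha.mul hu)).mul (ha.mul hw))))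

namespace IsRMatrix

variable (h : IsRMatrix τ R)

include h in
-- Nondegeneracy makes `z ↦ τ (z * ·)` injective into a dual of the same dimension, hence
-- invertible.
theorem exists_sharp : ∃ s : (𝔸 →L[ℝ] ℝ) →L[ℝ] 𝔸, ∀ l x, τ (s l * x) = l x := by
  let b : 𝔸 →ₗ[ℝ] (𝔸 →L[ℝ] ℝ) :=
    { toFun := fun z => LinearMap.toContinuousLinearMap (τ ∘ₗ LinearMap.mulLeft ℝ z)
      map_add' := fun x y => by ext; simp [add_mul]
      map_smul' := fun c x => by ext; simp }
  have hb : Function.Injective b := by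
    refine (injective_iff_map_eq_zero b).2 fun z hz => h.nondegenerate z fun x => ?_
    exact congrArg (fun l : 𝔸 →L[ℝ] ℝ => l x) hz
  have hd : Module.finrank ℝ 𝔸 = Module.finrank ℝ (𝔸 →L[ℝ] ℝ) := by
    rw [← (LinearMap.toContinuousLinearMap (𝕜 := ℝ) (E := 𝔸) (F' := ℝ)).finrank_eq]
    exact (Subspace.dual_finrank_eq (K := ℝ) (V := 𝔸)).symm
  have : FiniteDimensional ℝ (𝔸 →L[ℝ] ℝ) :=
    (LinearMap.toContinuousLinearMap (𝕜 := ℝ) (E := 𝔸) (F' := ℝ)).finiteDimensional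
  let e := LinearEquiv.ofInjectiveOfFinrankEq b hb hd
  refine ⟨LinearMap.toContinuousLinearMap (e.symm : (𝔸 →L[ℝ] ℝ) →ₗ[ℝ] 𝔸), fun l x => ?_⟩
  have h1 : b (e.symm l) = l := e.apply_symm_apply l
  exact congrArg (fun l : 𝔸 →L[ℝ] ℝ => l x) h1

/-- The element of the algebra which represents a linear form. -/
def sharp : (𝔸 →L[ℝ] ℝ) →L[ℝ] 𝔸 := h.exists_sharp.choose

@[simp]
theorem trace_sharp_mul (l : 𝔸 →L[ℝ] ℝ) (x : 𝔸) : τ (h.sharp l * x) = l x :=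
  h.exists_sharp.choose_spec l x

theorem sharp_eq {l : 𝔸 →L[ℝ] ℝ} {z : 𝔸} (hz : ∀ x, l x = τ (z * x)) : h.sharp l = z :=
  h.eq_of_trace_mul_eq fun x => by rw [trace_sharp_mul, hz]

/-- The gradient of a function on the algebra. -/
def gradient (f : 𝔸 → ℝ) (a : 𝔸) : 𝔸 := h.sharp (fderiv ℝ f a)

/-- The Sklyanin bracket of functions on the algebra. -/
def bracket (f k : 𝔸 → ℝ) (a : 𝔸) : ℝ := bivector τ R a (h.gradient f a) (h.gradient k a)

theorem bracket_eq_fderiv (f k : 𝔸 → ℝ) (a : 𝔸) :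
    h.bracket f k a = fderiv ℝ k a (hamVector R a (h.gradient f a)) := by
  rw [bracket, h.bivector_eq, gradient, trace_sharp_mul]

theorem contDiffAt_gradient {f : 𝔸 → ℝ} {a : 𝔸} (hf : ContDiffAt ℝ ∞ f a) :
    ContDiffAt ℝ ∞ (h.gradient f) a :=
  h.sharp.contDiff.contDiffAt.comp a (hf.fderiv_right (by simp))

theorem contDiffAt_bracket {f k : 𝔸 → ℝ} {a : 𝔸} (hf : ContDiffAt ℝ ∞ f a)
    (hk : ContDiffAt ℝ ∞ k a) : ContDiffAt ℝ ∞ (h.bracket f k) a :=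
  ContDiffAt.bivector contDiffAt_id (h.contDiffAt_gradient hf) (h.contDiffAt_gradient hk)

theorem hasFDerivAt_gradient {f : 𝔸 → ℝ} {a : 𝔸} (hf : ContDiffAt ℝ ∞ f a) :
    HasFDerivAt (h.gradient f) (h.sharp.comp (fderiv ℝ (fderiv ℝ f) a)) a :=
  h.sharp.hasFDerivAt.comp a
    ((hf.fderiv_right (m := 1) (by norm_cast)).differentiableAt (by simp)).hasFDerivAt

/-- Differentiating the gradients yields second derivatives contracted with Hamiltonian vectors;
differentiating the base point yields `bivectorDeriv`. -/
theorem fderiv_bracket {f k : 𝔸 → ℝ} {a : 𝔸} (hf : ContDiffAt ℝ ∞ f a)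
    (hk : ContDiffAt ℝ ∞ k a) (v : 𝔸) :
    fderiv ℝ (h.bracket f k) a v = bivectorDeriv τ R a v (h.gradient f a) (h.gradient k a) -
      fderiv ℝ (fderiv ℝ f) a v (hamVector R a (h.gradient k a)) +
        fderiv ℝ (fderiv ℝ k) a v (hamVector R a (h.gradient f a)) := by
  have hl : HasDerivAt (fun t : ℝ => a + t • v) v 0 := by
    simpa using ((hasDerivAt_id (0 : ℝ)).smul_const v).const_add a
  have h0 : a + (0 : ℝ) • v = a := by simp
  have hd := ((h.contDiffAt_bracket hf hk).differentiableAt (by simp)).hasFDerivAt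
  rw [← h0] at hd
  have h1 := hd.comp_hasDerivAt (0 : ℝ) hl
  have hgf := h.hasFDerivAt_gradient hf
  have hgk := h.hasFDerivAt_gradient hk
  rw [← h0] at hgf hgk
  have h2 := HasDerivAt.bivector (τ := τ) (R := R) hl (hgf.comp_hasDerivAt (0 : ℝ) hl)
    (hgk.comp_hasDerivAt (0 : ℝ) hl)
  have h3 := h1.unique h2
  simp only [h0, Function.comp_apply, ContinuousLinearMap.comp_apply] at h3
  rw [h3, h.bivector_skew a _ (h.gradient k a), h.bivector_eq, h.bivector_eq, trace_sharp_mul,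
    trace_sharp_mul]
  ring

/-- Each Hessian is evaluated twice, with opposite signs, on the same pair of Hamiltonian vectors in
opposite orders. Symmetry removes it and leaves `bivector_jacobi`. -/
theorem bracket_jacobi {f k l : 𝔸 → ℝ} {a : 𝔸} (hf : ContDiffAt ℝ ∞ f a)
    (hk : ContDiffAt ℝ ∞ k a) (hl : ContDiffAt ℝ ∞ l a) :
    h.bracket f (h.bracket k l) a + h.bracket k (h.bracket l f) a +
      h.bracket l (h.bracket f k) a = 0 := by
  have hs : minSmoothness ℝ 2 ≤ (∞ : ℕ∞ω) := by
    rw [minSmoothness_of_isRCLikeNormedField]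
    norm_cast
  have sf := hf.isSymmSndFDerivAt hs (hamVector R a (h.gradient k a))
    (hamVector R a (h.gradient l a))
  have sk := hk.isSymmSndFDerivAt hs (hamVector R a (h.gradient f a))
    (hamVector R a (h.gradient l a))
  have sl := hl.isSymmSndFDerivAt hs (hamVector R a (h.gradient f a))
    (hamVector R a (h.gradient k a))
  have hj := h.bivector_jacobi a (h.gradient f a) (h.gradient k a) (h.gradient l a)
  rw [h.bracket_eq_fderiv f, h.bracket_eq_fderiv k, h.bracket_eq_fderiv l,
    h.fderiv_bracket hk hl, h.fderiv_bracket hl hf, h.fderiv_bracket hf hk]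
  linarith

/-! ### From functions on the algebra to functions on its units -/

section Units

variable [CompleteSpace 𝔸]

/-- The Sklyanin bracket of functions on the group of units. -/
def unitsBracket (φ ψ : 𝔸ˣ → ℝ) (g : 𝔸ˣ) : ℝ := h.bracket (unitsLift φ) (unitsLift ψ) g

theorem unitsLift_unitsBracket (φ ψ : 𝔸ˣ → ℝ) (g : 𝔸ˣ) :
    unitsLift (h.unitsBracket φ ψ) =ᶠ[𝓝 (g : 𝔸)] h.bracket (unitsLift φ) (unitsLift ψ) :=
  unitsLift_eventuallyEq (fun _ => rfl) g

theorem fderiv_unitsLift_unitsBracket (φ ψ : 𝔸ˣ → ℝ) (g : 𝔸ˣ) :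
    fderiv ℝ (unitsLift (h.unitsBracket φ ψ)) (g : 𝔸) =
      fderiv ℝ (h.bracket (unitsLift φ) (unitsLift ψ)) (g : 𝔸) :=
  (h.unitsLift_unitsBracket φ ψ g).fderiv_eq

/-- The Hamiltonian vector field of a function on the group of units. -/
def hamField (φ : 𝔸ˣ → ℝ) (g : 𝔸ˣ) : 𝔸 := hamVector R g (h.gradient (unitsLift φ) g)

theorem unitsBracket_eq_fderiv (φ ψ : 𝔸ˣ → ℝ) (g : 𝔸ˣ) :
    h.unitsBracket φ ψ g = fderiv ℝ (unitsLift ψ) (g : 𝔸) (h.hamField φ g) :=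
  h.bracket_eq_fderiv _ _ _

theorem unitsBracket_skew (φ ψ : 𝔸ˣ → ℝ) : h.unitsBracket φ ψ = - h.unitsBracket ψ φ :=
  funext fun _ => h.bivector_skew _ _ _

theorem smooth_unitsBracket {φ ψ : 𝔸ˣ → ℝ} (hφ : Smooth 𝓘(ℝ, 𝔸) φ) (hψ : Smooth 𝓘(ℝ, 𝔸) ψ) :
    Smooth 𝓘(ℝ, 𝔸) (h.unitsBracket φ ψ) :=
  smooth_of_contDiffAt (fun g => h.contDiffAt_bracket (hφ.contDiffAt g) (hψ.contDiffAt g))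
    fun _ => rfl

theorem unitsBracket_add_right {φ ψ χ : 𝔸ˣ → ℝ} (hψ : Smooth 𝓘(ℝ, 𝔸) ψ)
    (hχ : Smooth 𝓘(ℝ, 𝔸) χ) :
    h.unitsBracket φ (ψ + χ) = h.unitsBracket φ ψ + h.unitsBracket φ χ := by
  ext g
  have : unitsLift (ψ + χ) = unitsLift ψ + unitsLift χ := rfl
  simp only [unitsBracket_eq_fderiv, Pi.add_apply, this]
  rw [((hψ.hasFDerivAt g).add (hχ.hasFDerivAt g)).fderiv]
  rfl

theorem unitsBracket_smul_right (c : ℝ) {φ ψ : 𝔸ˣ → ℝ} (hψ : Smooth 𝓘(ℝ, 𝔸) ψ) :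
    h.unitsBracket φ (c • ψ) = c • h.unitsBracket φ ψ := by
  ext g
  have : unitsLift (c • ψ) = c • unitsLift ψ := rfl
  simp only [unitsBracket_eq_fderiv, Pi.smul_apply, this]
  rw [((hψ.hasFDerivAt g).const_smul c).fderiv]
  rfl

theorem unitsBracket_mul_right {φ ψ χ : 𝔸ˣ → ℝ} (hψ : Smooth 𝓘(ℝ, 𝔸) ψ)
    (hχ : Smooth 𝓘(ℝ, 𝔸) χ) :
    h.unitsBracket φ (ψ * χ) = h.unitsBracket φ ψ * χ + ψ * h.unitsBracket φ χ := by
  ext g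
  have : unitsLift (ψ * χ) = unitsLift ψ * unitsLift χ := rfl
  simp only [unitsBracket_eq_fderiv, Pi.add_apply, Pi.mul_apply, this]
  rw [((hψ.hasFDerivAt g).mul (hχ.hasFDerivAt g)).fderiv]
  simp
  ring

theorem isPoissonBracket_unitsBracket : IsPoissonBracket (Smooth 𝓘(ℝ, 𝔸)) h.unitsBracket where
  smooth _ _ hφ hψ := h.smooth_unitsBracket hφ hψ
  add_left φ₁ φ₂ ψ h₁ h₂ _ := by
    rw [h.unitsBracket_skew, h.unitsBracket_add_right h₁ h₂, h.unitsBracket_skew φ₁,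
      h.unitsBracket_skew φ₂, neg_add]
  smul_left c φ ψ hφ _ := by
    rw [h.unitsBracket_skew, h.unitsBracket_smul_right c hφ, h.unitsBracket_skew φ, smul_neg]
  skew φ ψ _ _ := h.unitsBracket_skew φ ψ
  leibniz _ _ _ _ hψ hχ := h.unitsBracket_mul_right hψ hχ
  jacobi φ ψ χ hφ hψ hχ := by
    ext g
    have := h.bracket_jacobi (hφ.contDiffAt g) (hψ.contDiffAt g) (hχ.contDiffAt g)
    rw [h.bracket_eq_fderiv, h.bracket_eq_fderiv, h.bracket_eq_fderiv,
      ← h.fderiv_unitsLift_unitsBracket, ← h.fderiv_unitsLift_unitsBracket,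
      ← h.fderiv_unitsLift_unitsBracket] at this
    simpa only [Pi.add_apply, h.unitsBracket_eq_fderiv _ (h.unitsBracket _ _), hamField]

theorem gradient_mul_left {φ : 𝔸ˣ → ℝ} (hφ : Smooth 𝓘(ℝ, 𝔸) φ) (g x : 𝔸ˣ) :
    h.gradient (unitsLift fun y => φ (g * y)) (x : 𝔸) =
      h.gradient (unitsLift φ) ((g * x : 𝔸ˣ) : 𝔸) * g :=
  h.sharp_eq fun V => by
    rw [fderiv_unitsLift_mul_left hφ, mul_assoc, gradient, trace_sharp_mul]

theorem gradient_mul_right {φ : 𝔸ˣ → ℝ} (hφ : Smooth 𝓘(ℝ, 𝔸) φ) (g x : 𝔸ˣ) :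
    h.gradient (unitsLift fun y => φ (y * g)) (x : 𝔸) =
      g * h.gradient (unitsLift φ) ((x * g : 𝔸ˣ) : 𝔸) :=
  h.sharp_eq fun V => by
    rw [fderiv_unitsLift_mul_right hφ, h.trace, ← mul_assoc, h.trace, gradient, trace_sharp_mul]

/-- The partial gradients of `φ (x * y)` are `y * u` and `u * x`, with `u` the gradient of `φ` at
the product, so `bivector_mul` applies. -/
theorem isMultiplicative_unitsBracket :
    IsMultiplicative (Smooth 𝓘(ℝ, 𝔸)) h.unitsBracket := fun φ ψ hφ hψ p => by
  simp only [prodBracket, unitsBracket, bracket, h.gradient_mul_left hφ, h.gradient_mul_left hψ,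
    h.gradient_mul_right hφ, h.gradient_mul_right hψ]
  rw [bivector_mul, Units.val_mul]

theorem isPoissonLieGroup_unitsBracket : IsPoissonLieGroup 𝓘(ℝ, 𝔸) h.unitsBracket where
  lieGroup := inferInstance
  poisson := h.isPoissonBracket_unitsBracket
  multiplicative := h.isMultiplicative_unitsBracket

/-- Linear functions of the matrix are enough to recover the velocity; the converse is the chain
rule. -/
theorem hamiltonEqAt_iff {φ : 𝔸ˣ → ℝ} (γ : ℝ → 𝔸ˣ) (t : ℝ) :
    HamiltonEqAt (Smooth 𝓘(ℝ, 𝔸)) h.unitsBracket φ γ t ↔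
      HasDerivAt (fun s => (γ s : 𝔸)) (h.hamField φ (γ t)) t := by
  refine ⟨fun hH => hasDerivAt_of_forall_clm fun l => ?_, fun hγ ψ hψ => ?_⟩
  · have := hH _ (smooth_clm_val l)
    rwa [unitsBracket_eq_fderiv, fderiv_unitsLift_clm] at this
  · rw [unitsBracket_eq_fderiv]
    exact hψ.hasDerivAt_comp hγ

/-- Hamiltonian vectors vanish at `1`, so the Hessian terms drop out and only first derivatives
matter. -/
theorem diffOne_unitsBracket {φ ψ : 𝔸ˣ → ℝ} (hφ : Smooth 𝓘(ℝ, 𝔸) φ) (hψ : Smooth 𝓘(ℝ, 𝔸) ψ)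
    (v : 𝔸) : fderiv ℝ (unitsLift (h.unitsBracket φ ψ)) ((1 : 𝔸ˣ) : 𝔸) v =
      bivectorDeriv τ R 1 v (h.gradient (unitsLift φ) 1) (h.gradient (unitsLift ψ) 1) := by
  have hz : ∀ u : 𝔸, hamVector R 1 u = 0 := fun u => by simp [hamVector]
  rw [h.fderiv_unitsLift_unitsBracket,
    h.fderiv_bracket (hφ.contDiffAt 1) (hψ.contDiffAt 1)]
  simp [hz]

end Units

end IsRMatrix

end UnitsBracket

/-! ### Restriction of the Sklyanin bracket to subgroups -/

section Restriction

open Filter Topology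

variable {𝔸 : Type*} [NormedRing 𝔸] [NormedAlgebra ℝ 𝔸] [CompleteSpace 𝔸]
  {τ : 𝔸 →ₗ[ℝ] ℝ} {R : 𝔸 →ₗ[ℝ] 𝔸} {M : Type*}

/-- The Hamiltonian vector fields on the group of units are tangent to the image of `ι`, and the
functions with property `S` are those induced by smooth functions on the group of units. -/
structure IsPoissonImmersion (R : 𝔸 →ₗ[ℝ] 𝔸) (S : (M → ℝ) → Prop) (ι : M → 𝔸ˣ) : Prop where
  extend : ∀ f, S f → ∃ φ, Smooth 𝓘(ℝ, 𝔸) φ ∧ ∀ m, φ (ι m) = f m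
  restrict : ∀ φ, Smooth 𝓘(ℝ, 𝔸) φ → S fun m => φ (ι m)
  tangent : ∀ m u, ∃ c : ℝ → M, ι (c 0) = ι m ∧
    HasDerivAt (fun t => (ι (c t) : 𝔸)) (hamVector R (ι m : 𝔸) u) 0

/-- A smooth extension of a function along `ι`. -/
def extension (ι : M → 𝔸ˣ) (f : M → ℝ) : 𝔸ˣ → ℝ :=
  Classical.epsilon fun φ => Smooth 𝓘(ℝ, 𝔸) φ ∧ ∀ m, φ (ι m) = f m

/-- The bracket induced by the Sklyanin bracket along `ι`. -/
def IsRMatrix.restrictBracket [FiniteDimensional ℝ 𝔸] (h : IsRMatrix τ R) (ι : M → 𝔸ˣ) (f k : M → ℝ) (m : M) : ℝ :=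
  h.unitsBracket (extension ι f) (extension ι k) (ι m)

namespace IsPoissonImmersion

variable {S : (M → ℝ) → Prop} {ι : M → 𝔸ˣ} (hι : IsPoissonImmersion R S ι)
include hι

theorem extension_spec {f : M → ℝ} (hf : S f) :
    Smooth 𝓘(ℝ, 𝔸) (extension ι f) ∧ ∀ m, extension ι f (ι m) = f m :=
  Classical.epsilon_spec (hι.extend f hf)

variable [FiniteDimensional ℝ 𝔸] (h : IsRMatrix τ R)

/-- The bracket differentiates `ψ` along a Hamiltonian vector, which is the velocity of a curve in
the image of `ι`; there `ψ` and `ψ'` coincide. -/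
theorem unitsBracket_congr_right (φ : 𝔸ˣ → ℝ) {ψ ψ' : 𝔸ˣ → ℝ} (hψ : Smooth 𝓘(ℝ, 𝔸) ψ)
    (hψ' : Smooth 𝓘(ℝ, 𝔸) ψ') (heq : ∀ m, ψ (ι m) = ψ' (ι m)) (m : M) :
    h.unitsBracket φ ψ (ι m) = h.unitsBracket φ ψ' (ι m) := by
  obtain ⟨c, hc0, hc⟩ := hι.tangent m (h.gradient (unitsLift φ) (ι m))
  have h1 := hψ.hasDerivAt_comp hc
  have h2 := hψ'.hasDerivAt_comp hc
  simp only [heq, hc0] at h1 h2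
  rw [h.unitsBracket_eq_fderiv, h.unitsBracket_eq_fderiv]
  exact h1.unique h2

/-- Independence of the chosen extensions: the right argument by tangency, the left one by skewness.
All axioms for the restricted bracket are inherited through this. -/
theorem restrictBracket_eq {f k : M → ℝ} {φ ψ : 𝔸ˣ → ℝ} (hφ : Smooth 𝓘(ℝ, 𝔸) φ)
    (hψ : Smooth 𝓘(ℝ, 𝔸) ψ) (hf : ∀ m, φ (ι m) = f m) (hk : ∀ m, ψ (ι m) = k m) (m : M) :
    h.restrictBracket ι f k m = h.unitsBracket φ ψ (ι m) := by
  obtain rfl : (fun m => φ (ι m)) = f := funext hf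
  obtain rfl : (fun m => ψ (ι m)) = k := funext hk
  have h1 := hι.extension_spec (hι.restrict φ hφ)
  have h2 := hι.extension_spec (hι.restrict ψ hψ)
  rw [IsRMatrix.restrictBracket, hι.unitsBracket_congr_right h _ h2.1 hψ h2.2,
    h.unitsBracket_skew, Pi.neg_apply, hι.unitsBracket_congr_right h _ h1.1 hφ h1.2,
    ← Pi.neg_apply, ← h.unitsBracket_skew]

theorem isPoissonBracket_restrictBracket : IsPoissonBracket S (h.restrictBracket ι) where
  smooth f k hf hk := hι.restrict _
    (h.smooth_unitsBracket (hι.extension_spec hf).1 (hι.extension_spec hk).1)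
  add_left f₁ f₂ k h₁ h₂ hk := by
    ext m
    obtain ⟨φ₁, s₁, e₁⟩ := hι.extend _ h₁
    obtain ⟨φ₂, s₂, e₂⟩ := hι.extend _ h₂
    obtain ⟨ψ, s, e⟩ := hι.extend _ hk
    rw [Pi.add_apply, hι.restrictBracket_eq h (s₁.add s₂) s (fun m => ?_) e,
      hι.restrictBracket_eq h s₁ s e₁ e, hι.restrictBracket_eq h s₂ s e₂ e]
    · exact congrFun (h.isPoissonBracket_unitsBracket.add_left φ₁ φ₂ ψ s₁ s₂ s) (ι m)
    · simp [e₁, e₂]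
  smul_left c f k hf hk := by
    ext m
    obtain ⟨φ, s, e⟩ := hι.extend _ hf
    obtain ⟨ψ, s', e'⟩ := hι.extend _ hk
    have sc : Smooth 𝓘(ℝ, 𝔸) (c • φ) :=
      (contDiff_const.mul contDiff_id : ContDiff ℝ ∞ fun x : ℝ => c * x).contMDiff.comp s
    rw [Pi.smul_apply, hι.restrictBracket_eq h sc s' (fun m => ?_) e',
      hι.restrictBracket_eq h s s' e e']
    · exact congrFun (h.isPoissonBracket_unitsBracket.smul_left c φ ψ s s') (ι m)
    · simp [e]
  skew f k _ _ := by
    ext m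
    simp only [IsRMatrix.restrictBracket, h.unitsBracket_skew (extension ι f), Pi.neg_apply]
  leibniz f k l hf hk hl := by
    ext m
    obtain ⟨φ, s, e⟩ := hι.extend _ hf
    obtain ⟨ψ, s', e'⟩ := hι.extend _ hk
    obtain ⟨χ, s'', e''⟩ := hι.extend _ hl
    rw [Pi.add_apply, Pi.mul_apply, Pi.mul_apply,
      hι.restrictBracket_eq h s (s'.mul s'') e (fun m => ?_),
      hι.restrictBracket_eq h s s' e e', hι.restrictBracket_eq h s s'' e e'', ← e', ← e'']
    · exact congrFun (h.unitsBracket_mul_right s' s'') (ι m)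
    · simp [e', e'']
  jacobi f k l hf hk hl := by
    ext m
    obtain ⟨φ, s, e⟩ := hι.extend _ hf
    obtain ⟨ψ, s', e'⟩ := hι.extend _ hk
    obtain ⟨χ, s'', e''⟩ := hι.extend _ hl
    have key := fun {f₁ f₂ : M → ℝ} {φ₁ φ₂ : 𝔸ˣ → ℝ} (s₁ : Smooth 𝓘(ℝ, 𝔸) φ₁)
        (s₂ : Smooth 𝓘(ℝ, 𝔸) φ₂) (e₁ : ∀ m, φ₁ (ι m) = f₁ m) (e₂ : ∀ m, φ₂ (ι m) = f₂ m) m =>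
      (hι.restrictBracket_eq h s₁ s₂ e₁ e₂ m).symm
    rw [Pi.add_apply, Pi.add_apply,
      hι.restrictBracket_eq h s (h.smooth_unitsBracket s' s'') e (key s' s'' e' e''),
      hι.restrictBracket_eq h s' (h.smooth_unitsBracket s'' s) e' (key s'' s e'' e),
      hι.restrictBracket_eq h s'' (h.smooth_unitsBracket s s') e'' (key s s' e e')]
    exact congrFun (h.isPoissonBracket_unitsBracket.jacobi φ ψ χ s s' s'') (ι m)

theorem isMultiplicative_restrictBracket [Mul M] (hmul : ∀ x y, ι (x * y) = ι x * ι y) :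
    IsMultiplicative S (h.restrictBracket ι) := fun f k hf hk p => by
  obtain ⟨φ, s, e⟩ := hι.extend _ hf
  obtain ⟨ψ, s', e'⟩ := hι.extend _ hk
  rw [hι.restrictBracket_eq h s s' e e', hmul, ← h.isMultiplicative_unitsBracket φ ψ s s'
    (ι p.1, ι p.2)]
  simp only [prodBracket]
  rw [hι.restrictBracket_eq h (s.mul_right (ι p.2)) (s'.mul_right (ι p.2)),
    hι.restrictBracket_eq h (s.mul_left (ι p.1)) (s'.mul_left (ι p.1))]
  all_goals intro m; simp only [← hmul, e, e']

end IsPoissonImmersion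

end Restriction

/-! ### Lie brackets of vector fields on the group of units -/

section LieBracket

open Filter Topology VectorField

theorem lieBracket_apply_of_hasFDerivAt {E : Type*} [NormedAddCommGroup E] [NormedSpace ℝ E]
    {V W : E → E} {V' W' : E →L[ℝ] E} {a : E} (hV : HasFDerivAt V V' a)
    (hW : HasFDerivAt W W' a) : lieBracket ℝ V W a = W' (V a) - V' (W a) := by
  rw [lieBracket, hV.fderiv, hW.fderiv]

variable {𝔸 : Type*} [NormedRing 𝔸] [NormedAlgebra ℝ 𝔸] [CompleteSpace 𝔸]

theorem mfderiv_units_units_eq {f : 𝔸ˣ → 𝔸ˣ} {g : 𝔸ˣ}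
    (hf : MDifferentiableAt 𝓘(ℝ, 𝔸) 𝓘(ℝ, 𝔸) f g) :
    @Eq (𝔸 →L[ℝ] 𝔸) (mfderiv 𝓘(ℝ, 𝔸) 𝓘(ℝ, 𝔸) f g)
      (fderiv ℝ (unitsLift fun u => (f u : 𝔸)) (g : 𝔸)) := by
  simp only [mfderiv, hf, writtenInExtChartAt, extChartAt, mfld_simps, fderivWithin_univ]
  rfl

theorem fderiv_unitsLift_val (g : 𝔸ˣ) :
    fderiv ℝ (unitsLift (Units.val : 𝔸ˣ → 𝔸)) (g : 𝔸) = ContinuousLinearMap.id ℝ 𝔸 := by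
  have h : unitsLift (Units.val : 𝔸ˣ → 𝔸) =ᶠ[𝓝 (g : 𝔸)] id :=
    unitsLift_eventuallyEq (φ := Units.val) (f := id) (fun _ => rfl) g
  rw [h.fderiv_eq, fderiv_id]

theorem mfderiv_units_val (g : 𝔸ˣ) :
    @Eq (𝔸 →L[ℝ] 𝔸) (mfderiv 𝓘(ℝ, 𝔸) 𝓘(ℝ, 𝔸) (Units.val : 𝔸ˣ → 𝔸) g)
      (ContinuousLinearMap.id ℝ 𝔸) := by
  have hf : MDifferentiableAt 𝓘(ℝ, 𝔸) 𝓘(ℝ, 𝔸) (Units.val : 𝔸ˣ → 𝔸) g :=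
    (Units.contMDiff_val (n := 1)).mdifferentiable (by simp) g
  refine Eq.trans ?_ (fderiv_unitsLift_val g)
  simp only [mfderiv, hf, writtenInExtChartAt, extChartAt, mfld_simps, fderivWithin_univ]
  rfl

theorem mfderiv_chart_symm (g : 𝔸ˣ) :
    @Eq (𝔸 →L[ℝ] 𝔸) (mfderiv 𝓘(ℝ, 𝔸) 𝓘(ℝ, 𝔸) (chartAt 𝔸 (1 : 𝔸ˣ)).symm (g : 𝔸))
      (ContinuousLinearMap.id ℝ 𝔸) := by
  have hf : MDifferentiableAt 𝓘(ℝ, 𝔸) 𝓘(ℝ, 𝔸) (chartAt 𝔸 (1 : 𝔸ˣ)).symm (g : 𝔸) := by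
    refine (contMDiffOn_chart_symm.contMDiffAt (n := 1)
      ((chartAt 𝔸 (1 : 𝔸ˣ)).open_target.mem_nhds ?_)).mdifferentiableAt (by simp)
    exact (chartAt 𝔸 (1 : 𝔸ˣ)).map_source (x := g) (by rw [Units.chartAt_source]; trivial)
  refine Eq.trans ?_ (fderiv_unitsLift_val g)
  rw [hf.mfderiv]
  simp only [writtenInExtChartAt, extChartAt, mfld_simps, fderivWithin_univ]
  rfl

theorem inverse_apply_of_eq_id {E : Type*} [NormedAddCommGroup E] [NormedSpace ℝ E]
    {L : E →L[ℝ] E} (hL : L = ContinuousLinearMap.id ℝ E) (v : E) : L.inverse v = v := by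
  rw [hL, ContinuousLinearMap.inverse_id]
  rfl

/-- The chart is the inclusion in the algebra, so its inverse has identity differential and pulling
back a field leaves its values unchanged. -/
theorem mpullbackWithin_chart_symm (V : 𝔸ˣ → 𝔸) (g u : 𝔸ˣ) :
    @Eq 𝔸 (mpullbackWithin 𝓘(ℝ, 𝔸) 𝓘(ℝ, 𝔸) (extChartAt 𝓘(ℝ, 𝔸) g).symm
      (V : ∀ u : 𝔸ˣ, TangentSpace 𝓘(ℝ, 𝔸) u) (Set.range id) (u : 𝔸)) (V u) := by
  have h1 : @Eq (𝔸 →L[ℝ] 𝔸) (mfderivWithin 𝓘(ℝ, 𝔸) 𝓘(ℝ, 𝔸) (extChartAt 𝓘(ℝ, 𝔸) g).symm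
      (Set.range id) (u : 𝔸)) (ContinuousLinearMap.id ℝ 𝔸) := by
    rw [Set.range_id, mfderivWithin_univ]
    exact mfderiv_chart_symm u
  refine (inverse_apply_of_eq_id h1 _).trans ?_
  exact unitsLift_val V u

/-- The Lie bracket of vector fields on the group of units in terms of their coordinate
expressions. -/
theorem mlieBracket_units_eq (V W : 𝔸ˣ → 𝔸) (g : 𝔸ˣ) :
    @Eq 𝔸 (mlieBracket 𝓘(ℝ, 𝔸) (M := 𝔸ˣ) V W g)
      (lieBracket ℝ (unitsLift V) (unitsLift W) (g : 𝔸)) := by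
  have hp : ∀ V : 𝔸ˣ → 𝔸, @Filter.EventuallyEq 𝔸 𝔸 (𝓝 (g : 𝔸))
      (mpullbackWithin 𝓘(ℝ, 𝔸) 𝓘(ℝ, 𝔸) (extChartAt 𝓘(ℝ, 𝔸) g).symm
        (V : ∀ u : 𝔸ˣ, TangentSpace 𝓘(ℝ, 𝔸) u) (Set.range id)) (unitsLift V) := by
    intro V
    filter_upwards [eventually_isUnit g]
    rintro _ ⟨u, rfl⟩
    exact (mpullbackWithin_chart_symm V g u).trans (unitsLift_val V u).symm
  -- The manifold bracket is defined by pulling the coordinate bracket back along the chart, whose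
  -- differential is the identity.
  refine (inverse_apply_of_eq_id (mfderiv_units_val g) _).trans ?_
  have hs : (extChartAt 𝓘(ℝ, 𝔸) g).symm ⁻¹' Set.univ ∩ Set.range 𝓘(ℝ, 𝔸) = Set.univ := by
    simp
  rw [hs]
  refine Eq.trans (congrFun lieBracketWithin_univ _) ?_
  exact (hp V).lieBracket_vectorField_eq (hp W)

/-- The Lie algebra of the group of units is the algebra with the commutator. -/
theorem groupLieAlgebra_units_bracket (X Y : 𝔸) :
    @Eq 𝔸 (Bracket.bracket (L := GroupLieAlgebra 𝓘(ℝ, 𝔸) 𝔸ˣ) (M := GroupLieAlgebra 𝓘(ℝ, 𝔸) 𝔸ˣ)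
      X Y) (X * Y - Y * X) := by
  have hinv : ∀ X : 𝔸, @Eq (𝔸ˣ → 𝔸) (mulInvariantVectorField (I := 𝓘(ℝ, 𝔸)) (G := 𝔸ˣ) X)
      fun g : 𝔸ˣ => (g : 𝔸) * X := by
    intro X
    funext g
    have hm : MDifferentiableAt 𝓘(ℝ, 𝔸) 𝓘(ℝ, 𝔸) (fun x : 𝔸ˣ => g * x) 1 :=
      (contMDiff_mul_left (n := 1)).mdifferentiable (by simp) _
    refine (congrArg (fun L : 𝔸 →L[ℝ] 𝔸 => L X) (mfderiv_units_units_eq hm)).trans ?_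
    have h : (unitsLift fun u : 𝔸ˣ => ((g * u : 𝔸ˣ) : 𝔸)) =ᶠ[𝓝 ((1 : 𝔸ˣ) : 𝔸)]
        ContinuousLinearMap.mul ℝ 𝔸 g := unitsLift_eventuallyEq (fun _ => rfl) 1
    rw [h.fderiv_eq, ContinuousLinearMap.fderiv]
    rfl
  have hd : ∀ X : 𝔸, HasFDerivAt (unitsLift fun g : 𝔸ˣ => (g : 𝔸) * X)
      ((ContinuousLinearMap.mul ℝ 𝔸).flip X) ((1 : 𝔸ˣ) : 𝔸) := fun X =>
    ((ContinuousLinearMap.mul ℝ 𝔸).flip X).hasFDerivAt.congr_of_eventuallyEq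
      (unitsLift_eventuallyEq (f := (ContinuousLinearMap.mul ℝ 𝔸).flip X) (fun _ => rfl) 1)
  refine Eq.trans (mlieBracket_units_eq (mulInvariantVectorField (I := 𝓘(ℝ, 𝔸)) (G := 𝔸ˣ) X)
    (mulInvariantVectorField (I := 𝓘(ℝ, 𝔸)) (G := 𝔸ˣ) Y) 1) ?_
  rw [hinv, hinv, lieBracket_apply_of_hasFDerivAt (hd _) (hd _), unitsLift_val,
    unitsLift_val]
  simp

end LieBracket

section GeneralTransfer

/-! ### Poisson Lie groups: transfer and coboundary structure -/

/-- The axioms see only functions in `S`, but also their sums, multiples and products, hence the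
closure hypotheses. It passes from the matrix-gradient bracket to `sklyanin`, which agrees with it
on smooth functions. -/
theorem IsPoissonBracket.congr {M : Type*} {S : (M → ℝ) → Prop}
    {b c : (M → ℝ) → (M → ℝ) → M → ℝ} (hb : IsPoissonBracket S b)
    (h : ∀ φ ψ, S φ → S ψ → c φ ψ = b φ ψ)
    (hadd : ∀ φ ψ, S φ → S ψ → S (φ + ψ)) (hsmul : ∀ (a : ℝ) φ, S φ → S (a • φ))
    (hmul : ∀ φ ψ, S φ → S ψ → S (φ * ψ)) : IsPoissonBracket S c where
  smooth φ ψ hφ hψ := by rw [h φ ψ hφ hψ]; exact hb.smooth φ ψ hφ hψ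
  add_left φ₁ φ₂ ψ h₁ h₂ hψ := by
    rw [h _ _ (hadd _ _ h₁ h₂) hψ, h _ _ h₁ hψ, h _ _ h₂ hψ, hb.add_left _ _ _ h₁ h₂ hψ]
  smul_left a φ ψ hφ hψ := by
    rw [h _ _ (hsmul a φ hφ) hψ, h _ _ hφ hψ, hb.smul_left _ _ _ hφ hψ]
  skew φ ψ hφ hψ := by rw [h _ _ hφ hψ, h _ _ hψ hφ, hb.skew _ _ hφ hψ]
  leibniz φ ψ χ hφ hψ hχ := by
    rw [h _ _ hφ (hmul _ _ hψ hχ), h _ _ hφ hψ, h _ _ hφ hχ, hb.leibniz _ _ _ hφ hψ hχ]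
  jacobi φ ψ χ hφ hψ hχ := by
    rw [h _ _ hψ hχ, h _ _ hχ hφ, h _ _ hφ hψ, h _ _ hφ (hb.smooth _ _ hψ hχ),
      h _ _ hψ (hb.smooth _ _ hχ hφ), h _ _ hχ (hb.smooth _ _ hφ hψ), hb.jacobi _ _ _ hφ hψ hχ]

variable {𝔸 : Type*} [NormedRing 𝔸] [NormedAlgebra ℝ 𝔸] [CompleteSpace 𝔸]

theorem Smooth.const_smul {φ : 𝔸ˣ → ℝ} (h : Smooth 𝓘(ℝ, 𝔸) φ) (c : ℝ) :
    Smooth 𝓘(ℝ, 𝔸) (c • φ) :=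
  (contDiff_const.mul contDiff_id : ContDiff ℝ ∞ fun x : ℝ => c * x).contMDiff.comp h

theorem IsPoissonLieGroup.congr_units {b c : (𝔸ˣ → ℝ) → (𝔸ˣ → ℝ) → 𝔸ˣ → ℝ}
    (hb : IsPoissonLieGroup 𝓘(ℝ, 𝔸) b)
    (h : ∀ φ ψ, Smooth 𝓘(ℝ, 𝔸) φ → Smooth 𝓘(ℝ, 𝔸) ψ → c φ ψ = b φ ψ) :
    IsPoissonLieGroup 𝓘(ℝ, 𝔸) c where
  lieGroup := hb.lieGroup
  poisson := hb.poisson.congr h (fun _ _ h₁ h₂ => h₁.add h₂) (fun a _ h₁ => h₁.const_smul a)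
    fun _ _ h₁ h₂ => h₁.mul h₂
  multiplicative φ ψ hφ hψ p := by
    rw [h φ ψ hφ hψ, ← hb.multiplicative φ ψ hφ hψ p]
    simp only [prodBracket]
    rw [h _ _ (hφ.mul_right _) (hψ.mul_right _), h _ _ (hφ.mul_left _) (hψ.mul_left _)]

open Filter Topology

/-! ### Functions on a product of two unit groups -/

theorem Smooth.slice_left {ψ : 𝔸ˣ × 𝔸ˣ → ℝ} (h : Smooth (𝓘(ℝ, 𝔸).prod 𝓘(ℝ, 𝔸)) ψ) (y : 𝔸ˣ) :
    Smooth 𝓘(ℝ, 𝔸) fun x => ψ (x, y) :=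
  h.comp (contMDiff_id.prodMk contMDiff_const)

theorem Smooth.slice_right {ψ : 𝔸ˣ × 𝔸ˣ → ℝ} (h : Smooth (𝓘(ℝ, 𝔸).prod 𝓘(ℝ, 𝔸)) ψ) (x : 𝔸ˣ) :
    Smooth 𝓘(ℝ, 𝔸) fun y => ψ (x, y) :=
  h.comp (contMDiff_const.prodMk contMDiff_id)

theorem contMDiffAt_chart_symm (g : 𝔸ˣ) :
    ContMDiffAt 𝓘(ℝ, 𝔸) 𝓘(ℝ, 𝔸) ∞ (chartAt 𝔸 (1 : 𝔸ˣ)).symm (g : 𝔸) :=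
  contMDiffOn_chart_symm.contMDiffAt ((chartAt 𝔸 (1 : 𝔸ˣ)).open_target.mem_nhds
    ((chartAt 𝔸 (1 : 𝔸ˣ)).map_source (x := g) (by rw [Units.chartAt_source]; trivial)))

/-- In the product chart the total derivative is the sum of the partial derivatives, and these are
the derivatives of the slices. -/
theorem Smooth.hasDerivAt_comp_prod {ψ : 𝔸ˣ × 𝔸ˣ → ℝ}
    (h : Smooth (𝓘(ℝ, 𝔸).prod 𝓘(ℝ, 𝔸)) ψ) {γ₁ γ₂ : ℝ → 𝔸ˣ} {V₁ V₂ : 𝔸} {t : ℝ}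
    (h₁ : HasDerivAt (fun s => (γ₁ s : 𝔸)) V₁ t) (h₂ : HasDerivAt (fun s => (γ₂ s : 𝔸)) V₂ t) :
    HasDerivAt (fun s => ψ (γ₁ s, γ₂ s))
      (fderiv ℝ (unitsLift fun x => ψ (x, γ₂ t)) (γ₁ t : 𝔸) V₁ +
        fderiv ℝ (unitsLift fun y => ψ (γ₁ t, y)) (γ₂ t : 𝔸) V₂) t := by
  let e := (chartAt 𝔸 (1 : 𝔸ˣ)).symm
  let f : 𝔸 × 𝔸 → ℝ := fun p => ψ (e p.1, e p.2)
  have hf : ContDiffAt ℝ ∞ f ((γ₁ t : 𝔸), (γ₂ t : 𝔸)) := by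
    have h1 : ContMDiffAt 𝓘(ℝ, 𝔸 × 𝔸) (𝓘(ℝ, 𝔸).prod 𝓘(ℝ, 𝔸)) ∞
        (fun p : 𝔸 × 𝔸 => (e p.1, e p.2)) ((γ₁ t : 𝔸), (γ₂ t : 𝔸)) :=
      ((contMDiffAt_chart_symm (γ₁ t)).comp ((γ₁ t : 𝔸), (γ₂ t : 𝔸))
        contDiff_fst.contMDiff.contMDiffAt).prodMk
      ((contMDiffAt_chart_symm (γ₂ t)).comp ((γ₁ t : 𝔸), (γ₂ t : 𝔸))
        contDiff_snd.contMDiff.contMDiffAt)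
    exact (ContMDiffAt.comp _ (h _) h1).contDiffAt
  have hd := (hf.differentiableAt (by simp)).hasFDerivAt
  have hγ := h₁.prodMk h₂
  have h3 := hd.comp_hasDerivAt t hγ
  have e1 : ∀ u : 𝔸ˣ, e (u : 𝔸) = u := chartAt_symm_val
  have hl : HasFDerivAt (unitsLift fun x => ψ (x, γ₂ t))
      ((fderiv ℝ f ((γ₁ t : 𝔸), (γ₂ t : 𝔸))).comp (ContinuousLinearMap.inl ℝ 𝔸 𝔸))
      (γ₁ t : 𝔸) := by
    have := HasFDerivAt.comp (γ₁ t : 𝔸) (f := fun x : 𝔸 => (x, (γ₂ t : 𝔸))) hd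
      (hasFDerivAt_prodMk_left (γ₁ t : 𝔸) (γ₂ t : 𝔸))
    have hE : (unitsLift fun x => ψ (x, γ₂ t)) = fun a : 𝔸 => f (a, (γ₂ t : 𝔸)) := by
      funext a
      simp only [f, e1]
      rfl
    rw [hE]
    exact this
  have hr : HasFDerivAt (unitsLift fun y => ψ (γ₁ t, y))
      ((fderiv ℝ f ((γ₁ t : 𝔸), (γ₂ t : 𝔸))).comp (ContinuousLinearMap.inr ℝ 𝔸 𝔸))
      (γ₂ t : 𝔸) := by
    have := HasFDerivAt.comp (γ₂ t : 𝔸) (f := fun x : 𝔸 => ((γ₁ t : 𝔸), x)) hd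
      (hasFDerivAt_prodMk_right (γ₁ t : 𝔸) (γ₂ t : 𝔸))
    have hE : (unitsLift fun y => ψ (γ₁ t, y)) = fun a : 𝔸 => f ((γ₁ t : 𝔸), a) := by
      funext a
      simp only [f, e1]
      rfl
    rw [hE]
    exact this
  rw [hl.fderiv, hr.fderiv]
  have h4 : (V₁, V₂) = ContinuousLinearMap.inl ℝ 𝔸 𝔸 V₁ + ContinuousLinearMap.inr ℝ 𝔸 𝔸 V₂ := by
    simp
  have h5 : (fun s => ψ (γ₁ s, γ₂ s)) = f ∘ fun s => ((γ₁ s : 𝔸), (γ₂ s : 𝔸)) := by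
    funext s
    simp only [f, e1, Function.comp_apply]
  rw [h4, map_add] at h3
  rw [h5]
  exact h3

variable [FiniteDimensional ℝ 𝔸] {τ : 𝔸 →ₗ[ℝ] ℝ} {R : 𝔸 →ₗ[ℝ] 𝔸}

/-- The element of `𝔤 ∧ 𝔤` given by an `R`-matrix. -/
def IsRMatrix.rForm (h : IsRMatrix τ R) :
    (𝔸 →L[ℝ] ℝ) →ₗ[ℝ] (𝔸 →L[ℝ] ℝ) →ₗ[ℝ] ℝ :=
  LinearMap.mk₂ ℝ (fun l m => (1 / 2) * τ (R (h.sharp l) * h.sharp m))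
    (fun l m k => by simp [add_mul, mul_add]) (fun c l m => by simp; ring)
    (fun l m k => by simp [mul_add]) (fun c l m => by simp; ring)

/-- At `1` the translates of `φ` have gradients `u * g` and `g * u`, with `u` its gradient at `g`;
these are the arguments of `R` in `bivector`. -/
theorem IsRMatrix.unitsBracket_eq_rForm (h : IsRMatrix τ R) {φ ψ : 𝔸ˣ → ℝ}
    (hφ : Smooth 𝓘(ℝ, 𝔸) φ) (hψ : Smooth 𝓘(ℝ, 𝔸) ψ) (g : 𝔸ˣ) :
    h.unitsBracket φ ψ g =
      h.rForm (diffOne 𝓘(ℝ, 𝔸) fun x => φ (g * x)) (diffOne 𝓘(ℝ, 𝔸) fun x => ψ (g * x)) -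
        h.rForm (diffOne 𝓘(ℝ, 𝔸) fun x => φ (x * g)) (diffOne 𝓘(ℝ, 𝔸) fun x => ψ (x * g)) := by
  have key : ∀ {φ : 𝔸ˣ → ℝ}, Smooth 𝓘(ℝ, 𝔸) φ →
      h.sharp (diffOne 𝓘(ℝ, 𝔸) φ) = h.gradient (unitsLift φ) ((1 : 𝔸ˣ) : 𝔸) := fun hφ =>
    congrArg h.sharp (mfderiv_units_eq hφ 1)
  change _ = (1 / 2) * τ (R (h.sharp _) * h.sharp _) - (1 / 2) * τ (R (h.sharp _) * h.sharp _)
  rw [key (hφ.mul_left g), key (hφ.mul_right g), key (hψ.mul_left g), key (hψ.mul_right g),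
    h.gradient_mul_left hφ, h.gradient_mul_left hψ, h.gradient_mul_right hφ,
    h.gradient_mul_right hψ, mul_one, one_mul]
  simp only [unitsBracket, bracket, bivector]
  ring

theorem IsRMatrix.hamiltonEqAt_prod_iff (h : IsRMatrix τ R) {H : 𝔸ˣ × 𝔸ˣ → ℝ}
    (γ₁ γ₂ : ℝ → 𝔸ˣ) (t : ℝ) :
    HamiltonEqAt (Smooth (𝓘(ℝ, 𝔸).prod 𝓘(ℝ, 𝔸))) (prodBracket h.unitsBracket h.unitsBracket) H
        (fun s => (γ₁ s, γ₂ s)) t ↔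
      HasDerivAt (fun s => (γ₁ s : 𝔸)) (h.hamField (fun x => H (x, γ₂ t)) (γ₁ t)) t ∧
        HasDerivAt (fun s => (γ₂ s : 𝔸)) (h.hamField (fun y => H (γ₁ t, y)) (γ₂ t)) t := by
  -- A test function of one factor is constant in the other, so it isolates one of the two
  -- equations.
  have hconst : ∀ (c : ℝ) (g : 𝔸ˣ), fderiv ℝ (unitsLift fun _ : 𝔸ˣ => c) (g : 𝔸) = 0 :=
    fun c g => fderiv_unitsLift_eq (f := fun _ => c) (fun _ => rfl) (hasFDerivAt_const c _)
  refine ⟨fun hH => ⟨hasDerivAt_of_forall_clm fun l => ?_, hasDerivAt_of_forall_clm fun l => ?_⟩,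
    fun hγ ψ hψ => ?_⟩
  · have := hH (fun p => l p.1) ((smooth_clm_val l).comp contMDiff_fst)
    simpa only [prodBracket, h.unitsBracket_eq_fderiv, fderiv_unitsLift_clm, hconst,
      zero_apply, add_zero] using this
  · have := hH (fun p => l p.2) ((smooth_clm_val l).comp contMDiff_snd)
    simpa only [prodBracket, h.unitsBracket_eq_fderiv, fderiv_unitsLift_clm, hconst,
      zero_apply, zero_add] using this
  · simp only [prodBracket, h.unitsBracket_eq_fderiv]
    exact hψ.hasDerivAt_comp_prod hγ.1 hγ.2

end GeneralTransfer

/-! ### The splitting of `gl(n, ℂ)` and its `R`-matrix -/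

section Splitting

variable {n : ℕ}

/-- The imaginary part of the trace. -/
def imTrace (n : ℕ) : Mat n →ₗ[ℝ] ℝ := Complex.imLm ∘ₗ Matrix.traceLinearMap (Fin n) ℝ ℂ

theorem imTrace_apply (X : Mat n) : imTrace n X = X.trace.im := rfl

theorem pairing_apply (X Y : Mat n) : pairing n X Y = imTrace n (X * Y) := rfl

theorem imTrace_mul_comm (X Y : Mat n) : imTrace n (X * Y) = imTrace n (Y * X) := by
  rw [imTrace_apply, Matrix.trace_mul_comm, imTrace_apply]

theorem pairing_comm (X Y : Mat n) : pairing n X Y = pairing n Y X := imTrace_mul_comm X Y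

theorem imTrace_nondegenerate (Z : Mat n) (h : ∀ X, imTrace n (Z * X) = 0) : Z = 0 :=
  (existsUnique_pairing_eq (0 : Mat n →ₗ[ℝ] ℝ)).unique h fun X => by simp

theorem projK_mem (X : Mat n) : projK X ∈ 𝔨 n := by
  simp [projK]

theorem sub_projK (X : Mat n) : X - projK X = projB X := by
  rw [sub_eq_iff_eq_add', projK, projB]
  exact (Submodule.projection_add_projection_eq_self (isCompl_𝔨_𝔟 n) X).symm

theorem projB_mem (X : Mat n) : projB X ∈ 𝔟 n := by
  simp [projB]

theorem sub_projK_mem (X : Mat n) : X - projK X ∈ 𝔟 n := by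
  rw [sub_projK]; exact projB_mem X

theorem projK_of_mem {X : Mat n} (h : X ∈ 𝔨 n) : projK X = X :=
  (Submodule.projection_eq_self_iff (isCompl_𝔨_𝔟 n) X).2 h

theorem projK_of_mem_𝔟 {X : Mat n} (h : X ∈ 𝔟 n) : projK X = 0 :=
  (Submodule.projection_apply_eq_zero_iff (isCompl_𝔨_𝔟 n)).2 h

theorem projK_eq {X Y : Mat n} (hY : Y ∈ 𝔨 n) (h : X - Y ∈ 𝔟 n) : projK X = Y := by
  have h1 := projK_of_mem_𝔟 h
  rwa [map_sub, projK_of_mem hY, sub_eq_zero] at h1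

theorem projK_eq_upperPart (X : Mat n) : projK X = upperPart X - (upperPart X)ᴴ :=
  projK_eq (upperPart_sub_mem X) (sub_upperPart_mem X)

theorem J_eq : (J : Mat n →ₗ[ℝ] Mat n) = (2 : ℝ) • projK - 1 := by
  ext1 X
  have := sub_projK X
  simp only [J, LinearMap.sub_apply, LinearMap.smul_apply, Module.End.one_apply, ← this]
  module

theorem mem_𝔨 {X : Mat n} : X ∈ 𝔨 n ↔ Xᴴ = -X := Iff.rfl

theorem commutator_mem_𝔨 {X Y : Mat n} (hX : X ∈ 𝔨 n) (hY : Y ∈ 𝔨 n) : X * Y - Y * X ∈ 𝔨 n := by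
  rw [mem_𝔨] at *
  rw [Matrix.conjTranspose_sub, Matrix.conjTranspose_mul, Matrix.conjTranspose_mul, hX, hY]
  noncomm_ring

theorem lower_mul_apply_self {X Y : Mat n} (hX : ∀ i j, i < j → X i j = 0)
    (hY : ∀ i j, i < j → Y i j = 0) (i : Fin n) : (X * Y) i i = X i i * Y i i := by
  rw [Matrix.mul_apply]
  refine Finset.sum_eq_single i (fun k _ hk => ?_) (by simp)
  rcases lt_or_gt_of_ne hk with h | h
  · rw [hY k i h, mul_zero]
  · rw [hX i k h, zero_mul]

theorem lower_mul_apply {X Y : Mat n} (hX : ∀ i j, i < j → X i j = 0)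
    (hY : ∀ i j, i < j → Y i j = 0) (i j : Fin n) (h : i < j) : (X * Y) i j = 0 := by
  rw [Matrix.mul_apply]
  refine Finset.sum_eq_zero fun k _ => ?_
  rcases lt_or_ge i k with h' | h'
  · rw [hX i k h', zero_mul]
  · rw [hY k j (h'.trans_lt h), mul_zero]

theorem mul_mem_𝔟 {X Y : Mat n} (hX : X ∈ 𝔟 n) (hY : Y ∈ 𝔟 n) : X * Y ∈ 𝔟 n :=
  ⟨lower_mul_apply hX.1 hY.1, fun i => by
    rw [lower_mul_apply_self hX.1 hY.1, Complex.mul_im, hX.2 i, hY.2 i]; simp⟩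

/-- The adjoint of `X * Y` is `Y * X`, so its trace is real. -/
theorem imTrace_mul_𝔨 {X Y : Mat n} (hX : X ∈ 𝔨 n) (hY : Y ∈ 𝔨 n) : imTrace n (X * Y) = 0 := by
  have h1 : star (X * Y).trace = (X * Y).trace := by
    rw [← Matrix.trace_conjTranspose, Matrix.conjTranspose_mul, mem_𝔨.1 hX, mem_𝔨.1 hY,
      neg_mul_neg, Matrix.trace_mul_comm]
  exact Complex.conj_eq_iff_im.1 h1

theorem imTrace_𝔟 {X : Mat n} (hX : X ∈ 𝔟 n) : imTrace n X = 0 := by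
  rw [imTrace_apply, Matrix.trace, Complex.im_sum]
  exact Finset.sum_eq_zero fun i _ => hX.2 i

/-- `J` is an `R`-matrix on `gl(n, ℂ)`. -/
theorem isRMatrix_J (n : ℕ) : IsRMatrix (imTrace n) (J : Mat n →ₗ[ℝ] Mat n) := by
  rw [J_eq]
  refine isRMatrix_of_projection imTrace_mul_comm imTrace_nondegenerate ?_ ?_ ?_ ?_
  · exact fun X Y => projK_of_mem (commutator_mem_𝔨 (projK_mem X) (projK_mem Y))
  · exact fun X Y => projK_of_mem_𝔟 (Submodule.sub_mem _
      (mul_mem_𝔟 (sub_projK_mem X) (sub_projK_mem Y))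
      (mul_mem_𝔟 (sub_projK_mem Y) (sub_projK_mem X)))
  · exact fun X Y => imTrace_mul_𝔨 (projK_mem X) (projK_mem Y)
  · exact fun X Y => imTrace_𝔟 (mul_mem_𝔟 (sub_projK_mem X) (sub_projK_mem Y))

theorem pairing_J (X Y : Mat n) : pairing n (J X) Y = - pairing n X (J Y) :=
  (isRMatrix_J n).skew X Y

/-- In `J = 2 projK - 1` the identity contributes `a * u * a` with both signs; this is why only
`projK` enters the equations of motion. -/
theorem hamVector_J (a u : Mat n) :
    hamVector J a u = a * projK (u * a) - projK (a * u) * a := by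
  simp only [hamVector, J_eq, LinearMap.sub_apply, LinearMap.smul_apply, Module.End.one_apply,
    mul_sub, sub_mul, mul_smul_comm, smul_mul_assoc, mul_assoc]
  module

/-- The mixed commutators cancel: `𝔤_J` is the direct sum of `𝔨` and `𝔟` with the opposite bracket.
The Jacobi identity follows componentwise. -/
theorem jBracket_eq (X Y : Mat n) : jBracket X Y =
    (projK X * projK Y - projK Y * projK X) - (projB X * projB Y - projB Y * projB X) := by
  simp only [jBracket, commBracket, J_eq, ← sub_projK, LinearMap.sub_apply, LinearMap.smul_apply,
    Module.End.one_apply, mul_sub, sub_mul, mul_smul_comm, smul_mul_assoc]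
  module

theorem projK_jBracket (X Y : Mat n) :
    projK (jBracket X Y) = projK X * projK Y - projK Y * projK X := by
  refine projK_eq (commutator_mem_𝔨 (projK_mem X) (projK_mem Y)) ?_
  rw [jBracket_eq, sub_sub_cancel_left]
  exact Submodule.neg_mem _ (Submodule.sub_mem _
    (mul_mem_𝔟 (projB_mem X) (projB_mem Y)) (mul_mem_𝔟 (projB_mem Y) (projB_mem X)))

theorem projB_jBracket (X Y : Mat n) :
    projB (jBracket X Y) = -(projB X * projB Y - projB Y * projB X) := by
  rw [← sub_projK, projK_jBracket, jBracket_eq]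
  abel

theorem isLieBracket_jBracket (n : ℕ) : IsLieBracket (jBracket : Mat n → Mat n → Mat n) where
  add_left X Y Z := by
    simp only [jBracket_eq, map_add]
    noncomm_ring
  smul_left c X Y := by
    simp only [jBracket_eq, map_smul, smul_mul_assoc, mul_smul_comm, smul_sub]
  skew X Y := by
    simp only [jBracket_eq]
    abel
  jacobi X Y Z := by
    rw [jBracket_eq X (jBracket Y Z), jBracket_eq Y (jBracket Z X), jBracket_eq Z (jBracket X Y)]
    simp only [projK_jBracket, projB_jBracket]
    noncomm_ring

theorem isLieBracket_commutator {A : Type*} [Ring A] [Algebra ℝ A] :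
    IsLieBracket (fun X Y : A => X * Y - Y * X) where
  add_left X Y Z := by noncomm_ring
  smul_left c X Y := by rw [smul_sub, smul_mul_assoc, mul_smul_comm]
  skew X Y := by abel
  jacobi X Y Z := by noncomm_ring

/-- The cobracket is a coboundary: `X` acts by commutators on both arguments of the form `(J ξ, η)`.
-/
theorem pairing_jBracket (X ξ η : Mat n) : imTrace n (X * jBracket ξ η) =
    -(1 / 2) * (imTrace n (J ξ * (X * η - η * X)) + imTrace n (J (X * ξ - ξ * X) * η)) := by
  have h1 := (isRMatrix_J n).skew (X * ξ - ξ * X) η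
  have e1 := imTrace_mul_comm (J ξ * η) X
  have e2 := imTrace_mul_comm (J ξ) (X * η)
  have e3 := imTrace_mul_comm ξ (X * J η)
  have e4 := imTrace_mul_comm (ξ * J η) X
  have e5 := imTrace_mul_comm (J η) (X * ξ)
  rw [h1]
  simp only [jBracket, commBracket, mul_smul_comm, map_smul, smul_eq_mul, mul_add, mul_sub,
    sub_mul, map_add, map_sub, mul_assoc] at e1 e2 e3 e4 e5 ⊢
  linarith

/-- The cocycle identity relating the commutator and the `J`-bracket. -/
theorem pairing_commutator_jBracket (X Y ξ η : Mat n) :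
    imTrace n ((X * Y - Y * X) * jBracket ξ η) =
      -(imTrace n (Y * jBracket (X * ξ - ξ * X) η) + imTrace n (Y * jBracket ξ (X * η - η * X))) +
        (imTrace n (X * jBracket (Y * ξ - ξ * Y) η) +
          imTrace n (X * jBracket ξ (Y * η - η * Y))) := by
  -- A coboundary is a cocycle: after this substitution only associativity is needed, not
  -- Yang-Baxter.
  rw [pairing_jBracket]
  simp only [pairing_jBracket, mul_sub, sub_mul, map_sub, mul_assoc]
  ring

end Splitting

/-! ### The Sklyanin bracket on `GL(n, ℂ)` -/

section Sklyanin

variable {n : ℕ}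

/-- The gradient of a function on `GL(n, ℂ)` with respect to the matrix entries. -/
abbrev matGrad (φ : Gl n → ℝ) (g : Gl n) : Mat n :=
  (isRMatrix_J n).gradient (unitsLift φ) (g : Mat n)

/-- The Sklyanin bracket in terms of gradients with respect to the matrix entries. -/
abbrev glBracket (n : ℕ) : (Gl n → ℝ) → (Gl n → ℝ) → Gl n → ℝ := (isRMatrix_J n).unitsBracket

theorem imTrace_matGrad_mul (φ : Gl n → ℝ) (g : Gl n) (V : Mat n) :
    imTrace n (matGrad φ g * V) = fderiv ℝ (unitsLift φ) (g : Mat n) V :=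
  (isRMatrix_J n).trace_sharp_mul _ _

/-- The curve `e^{tX} g` has velocity `X * g`, and cyclicity moves `g` to the left of the gradient;
nondegeneracy then pins down the chosen `grad`. -/
theorem grad_eq {φ : Gl n → ℝ} (h : Smooth (Imat n) φ) (g : Gl n) :
    grad φ g = (g : Mat n) * matGrad φ g := by
  refine (isRMatrix_J n).eq_of_trace_mul_eq fun X => ?_
  have h0 : expGl ((0 : ℝ) • X) * g = g := by rw [zero_smul, expGl_zero, one_mul]
  have hd : HasDerivAt (fun t : ℝ => ((expGl (t • X) * g : Gl n) : Mat n)) (X * g) 0 :=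
    (hasDerivAt_expGl X).mul_const (g : Mat n)
  have h1 := (grad_spec h g X).unique (h.hasDerivAt_comp hd)
  rw [h0, ← imTrace_matGrad_mul] at h1
  rw [← pairing_apply, h1, imTrace_mul_comm, mul_assoc, imTrace_mul_comm, mul_assoc,
    imTrace_mul_comm, mul_assoc, imTrace_mul_comm]

theorem grad'_eq {φ : Gl n → ℝ} (h : Smooth (Imat n) φ) (g : Gl n) :
    grad' φ g = matGrad φ g * (g : Mat n) := by
  refine (isRMatrix_J n).eq_of_trace_mul_eq fun X => ?_
  have h0 : g * expGl ((0 : ℝ) • X) = g := by rw [zero_smul, expGl_zero, mul_one]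
  have hd : HasDerivAt (fun t : ℝ => ((g * expGl (t • X) : Gl n) : Mat n)) (g * X) 0 :=
    (hasDerivAt_expGl X).const_mul (g : Mat n)
  have h1 := (grad'_spec h g X).unique (h.hasDerivAt_comp hd)
  rw [h0, ← imTrace_matGrad_mul] at h1
  rw [← pairing_apply, h1, mul_assoc]

theorem sklyanin_eq {φ ψ : Gl n → ℝ} (hφ : Smooth (Imat n) φ) (hψ : Smooth (Imat n) ψ) :
    sklyanin n φ ψ = glBracket n φ ψ := by
  ext g
  simp only [sklyanin, grad_eq hφ, grad_eq hψ, grad'_eq hφ, grad'_eq hψ, pairing_apply]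
  rfl

theorem hamField_eq {φ : Gl n → ℝ} (h : Smooth (Imat n) φ) (g : Gl n) :
    (isRMatrix_J n).hamField φ g = g * projK (grad' φ g) - projK (grad φ g) * g := by
  rw [IsRMatrix.hamField, hamVector_J, grad_eq h, grad'_eq h]

theorem isPoissonLieGroup_sklyanin (n : ℕ) : IsPoissonLieGroup (Imat n) (sklyanin n) :=
  (isRMatrix_J n).isPoissonLieGroup_unitsBracket.congr_units fun _ _ hφ hψ => sklyanin_eq hφ hψ

theorem isCoboundaryPoissonLieGroup_sklyanin (n : ℕ) :
    IsCoboundaryPoissonLieGroup (Imat n) (sklyanin n) where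
  toIsPoissonLieGroup := isPoissonLieGroup_sklyanin n
  coboundary := by
    refine ⟨(isRMatrix_J n).rForm, fun l => ?_, fun φ ψ hφ hψ g => ?_⟩
    · have h1 := (isRMatrix_J n).skew ((isRMatrix_J n).sharp l) ((isRMatrix_J n).sharp l)
      rw [imTrace_mul_comm _ (J _)] at h1
      change (1 / 2) * imTrace n (J ((isRMatrix_J n).sharp l) * (isRMatrix_J n).sharp l) = 0
      linarith
    · rw [sklyanin_eq hφ hψ]
      exact (isRMatrix_J n).unitsBracket_eq_rForm hφ hψ g

/-! ### The tangent Lie bialgebra -/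

theorem groupLieAlgebra_gl_bracket (X Y : GroupLieAlgebra (Imat n) (Gl n)) :
    ⁅X, Y⁆ = commBracket (n := n) X Y :=
  groupLieAlgebra_units_bracket (𝔸 := Mat n) X Y

/-- The trace form is invariant, so it identifies the coadjoint action with the adjoint one. -/
theorem eq_commutator_of_isCoad {X ξ ξ' : Mat n}
    (h : IsCoad (G := Gl n) (I := Imat n) (pairing n) X ξ ξ') : ξ' = X * ξ - ξ * X := by
  refine (isRMatrix_J n).eq_of_trace_mul_eq fun Z => ?_
  have h2 : pairing n Z ξ' = - pairing n (X * Z - Z * X) ξ :=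
    (h Z).trans (congrArg (fun W : Mat n => - pairing n W ξ) (groupLieAlgebra_gl_bracket X Z))
  have e1 := imTrace_mul_comm X (Z * ξ)
  have e2 := imTrace_mul_comm Z (X * ξ)
  have e3 := imTrace_mul_comm Z (ξ * X)
  rw [imTrace_mul_comm, ← pairing_apply, h2, pairing_apply]
  simp only [sub_mul, map_sub, mul_assoc] at e1 e2 e3 ⊢
  linarith

theorem matGrad_one_eq {φ : Gl n → ℝ} (h : Smooth (Imat n) φ) {ξ : Mat n}
    (hξ : ∀ X, diffOne (Imat n) φ X = pairing n X ξ) :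
    (isRMatrix_J n).gradient (unitsLift φ) 1 = ξ := by
  refine (isRMatrix_J n).eq_of_trace_mul_eq fun X => ?_
  have h1 := (diffOne_units_apply h X).symm.trans (hξ X)
  rw [imTrace_mul_comm ξ, ← pairing_apply X, ← h1]
  exact imTrace_matGrad_mul φ 1 X

/-- The tangent Lie bialgebra of `GL(n, ℂ)` is `(𝔤, 𝔤_J)`. -/
theorem hasTangentLieBialgebra_sklyanin (n : ℕ) :
    HasTangentLieBialgebra (G := Gl n) (Imat n) (sklyanin n) (𝔥 := Mat n) jBracket (pairing n) where
  perfect l := by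
    let l' : Mat n →L[ℝ] ℝ := l
    obtain ⟨ξ, h1, h2⟩ := existsUnique_pairing_eq (n := n) (l' : Mat n →ₗ[ℝ] ℝ)
    exact ⟨ξ, fun X => (pairing_comm _ _).trans (h1 X),
      fun η hη => h2 η fun X => (pairing_comm _ _).trans (hη X)⟩
  lie := isLieBracket_jBracket n
  cocycle X Y ξ η Xξ Xη Yξ Yη h1 h2 h3 h4 := by
    obtain rfl := eq_commutator_of_isCoad h1
    obtain rfl := eq_commutator_of_isCoad h2
    obtain rfl := eq_commutator_of_isCoad h3
    obtain rfl := eq_commutator_of_isCoad h4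
    exact (congrArg (fun W : Mat n => pairing n W (jBracket ξ η))
      (groupLieAlgebra_gl_bracket X Y)).trans (pairing_commutator_jBracket X Y ξ η)
  tangent φ ψ hφ hψ ξ η hξ hη X := by
    have h1 := (isRMatrix_J n).diffOne_unitsBracket hφ hψ (X : Mat n)
    rw [matGrad_one_eq hφ hξ, matGrad_one_eq hψ hη] at h1
    rw [sklyanin_eq hφ hψ]
    exact (diffOne_units_apply ((isRMatrix_J n).smooth_unitsBracket hφ hψ) X).trans
      (h1.trans ((isRMatrix_J n).bivectorDeriv_one _ _ _))

/-! ### Hamiltonian equations of motion -/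

theorem hamiltonEqAt_sklyanin_iff {φ : Gl n → ℝ} (h : Smooth (Imat n) φ) (γ : ℝ → Gl n) (t : ℝ) :
    HamiltonEqAt (Smooth (Imat n)) (sklyanin n) φ γ t ↔
      HasDerivAt (fun s => (γ s : Mat n))
        (γ t * projK (grad' φ (γ t)) - projK (grad φ (γ t)) * γ t) t := by
  rw [← hamField_eq h, ← (isRMatrix_J n).hamiltonEqAt_iff]
  exact forall₂_congr fun ψ hψ => by rw [sklyanin_eq h hψ]

/-- The `k` terms of the derivative of a power differ only by a cyclic rotation, so they have the
same trace. -/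
theorem hasFDerivAt_trace_pow (k : ℕ) (a : Mat n) : ∃ L : Mat n →L[ℝ] Mat n,
    HasFDerivAt (fun x : Mat n => x ^ k) L a ∧
      ∀ V, (L V).trace = k * (a ^ (k - 1) * V).trace := by
  refine ⟨_, hasFDerivAt_pow' k, fun V => ?_⟩
  simp only [sum_apply, Matrix.trace_sum]
  rw [Finset.sum_congr rfl (g := fun _ => (a ^ (k - 1) * V).trace)]
  · simp
  · intro i hi
    change (a ^ (k.pred - i) * V * a ^ i).trace = _
    rw [Matrix.trace_mul_comm, ← mul_assoc, ← pow_add, Nat.pred_eq_sub_one]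
    rw [Finset.mem_range] at hi
    congr 3
    omega

/-- The factor `I` converts the real part into the imaginary part of the trace, and `1 / k` absorbs
the number of equal terms. -/
theorem hasFDerivAt_ham {k : ℕ} (hk : 1 ≤ k) (a : Mat n) : ∃ L : Mat n →L[ℝ] ℝ,
    HasFDerivAt (fun x : Mat n => (1 / k : ℝ) * (x ^ k).trace.re) L a ∧
      ∀ V, L V = imTrace n ((Complex.I • a ^ (k - 1)) * V) := by
  obtain ⟨L, hL, hV⟩ := hasFDerivAt_trace_pow k a
  let T : Mat n →L[ℝ] ℝ := LinearMap.toContinuousLinearMap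
    (Complex.reLm ∘ₗ Matrix.traceLinearMap (Fin n) ℝ ℂ)
  refine ⟨(1 / k : ℝ) • T.comp L, (T.hasFDerivAt.comp a hL).const_mul (1 / k : ℝ), fun V => ?_⟩
  have hk' : (k : ℝ) ≠ 0 := by positivity
  change (1 / k : ℝ) * (L V).trace.re = _
  rw [hV, imTrace_apply, smul_mul_assoc, Matrix.trace_smul]
  simp
  field_simp

theorem contDiff_ham (n k : ℕ) :
    ContDiff ℝ ∞ (fun x : Mat n => (1 / k : ℝ) * (x ^ k).trace.re) := by
  let T : Mat n →L[ℝ] ℝ := LinearMap.toContinuousLinearMap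
    (Complex.reLm ∘ₗ Matrix.traceLinearMap (Fin n) ℝ ℂ)
  exact contDiff_const.mul (T.contDiff.comp (contDiff_id.pow k))

theorem smooth_ham (n k : ℕ) : Smooth (Imat n) (ham (n := n) k) :=
  smooth_of_contDiffAt (fun _ => (contDiff_ham n k).contDiffAt) fun _ => rfl

theorem matGrad_ham {k : ℕ} (hk : 1 ≤ k) (g : Gl n) :
    matGrad (ham k) g = Complex.I • (g : Mat n) ^ (k - 1) := by
  obtain ⟨L, hL, hV⟩ := hasFDerivAt_ham hk (g : Mat n)
  refine (isRMatrix_J n).sharp_eq fun V => ?_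
  rw [fderiv_unitsLift_eq (φ := ham k) (fun _ => rfl) hL, hV]

/-- Conjugating `I` turns the minus sign of `upperPart - upperPartᴴ` into a plus. -/
theorem projK_I_smul (X : Mat n) :
    projK (Complex.I • X) = Complex.I • upperPart X + Complex.I • (upperPart X)ᴴ := by
  have : upperPart (Complex.I • X) = Complex.I • upperPart X := by
    ext i j
    simp only [upperPart, Matrix.of_apply, Matrix.smul_apply, smul_eq_mul]
    split_ifs <;> ring
  rw [projK_eq_upperPart, this, Matrix.conjTranspose_smul]
  simp

theorem flowField_eq (k : ℕ) (g : Mat n) :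
    flowField k g = g * projK (Complex.I • g ^ k) - projK (Complex.I • g ^ k) * g := by
  rw [flowField, projK_I_smul]

theorem hamiltonEqAt_ham_iff {k : ℕ} (hk : 1 ≤ k) (γ : ℝ → Gl n) (t : ℝ) :
    HamiltonEqAt (Smooth (Imat n)) (sklyanin n) (ham k) γ t ↔
      HasDerivAt (fun s => (γ s : Mat n)) (flowField k (γ t : Mat n)) t := by
  have hs := smooth_ham n k
  rw [hamiltonEqAt_sklyanin_iff hs, grad_eq hs, grad'_eq hs, matGrad_ham hk, flowField_eq,
    smul_mul_assoc, mul_smul_comm, ← pow_succ, ← pow_succ', Nat.sub_add_cancel hk]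

/-! ### The product system and its monodromy -/

theorem contMDiff_gl_mul (n : ℕ) :
    ContMDiff ((Imat n).prod (Imat n)) (Imat n) ∞ (fun p : Gl n × Gl n => p.1 * p.2) :=
  contMDiff_mul (Imat n) ∞

theorem smooth_ham_mul (n k : ℕ) :
    Smooth ((Imat n).prod (Imat n)) (fun p : Gl n × Gl n => ham k (p.1 * p.2)) :=
  (smooth_ham n k).comp (contMDiff_gl_mul n)

/-- The gradient in `x` is `y * I (x y)^(k-1)`; multiplying by `x` on the right or left regroups it
as `I (y x)^k` or `I (x y)^k`. -/
theorem hamField_ham_mul_right {k : ℕ} (hk : 1 ≤ k) (x y : Gl n) :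
    (isRMatrix_J n).hamField (fun x => ham k (x * y)) x =
      x * projK (Complex.I • (y * x : Mat n) ^ k) - projK (Complex.I • (x * y : Mat n) ^ k) * x := by
  obtain ⟨k, rfl⟩ := Nat.exists_eq_add_of_le' hk
  have h := matGrad_ham hk (x * y)
  rw [IsRMatrix.hamField, hamVector_J, (isRMatrix_J n).gradient_mul_right (smooth_ham n _)]
  simp only [matGrad, Units.val_mul] at h ⊢
  have e : (y : Mat n) * (x * y) ^ k * x = (y * x) ^ (k + 1) := by
    rw [mul_assoc, mul_pow_mul, ← mul_assoc, ← pow_succ']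
  rw [h, Nat.add_sub_cancel, mul_smul_comm, smul_mul_assoc, mul_smul_comm, ← mul_assoc, e,
    ← pow_succ']

theorem hamField_ham_mul_left {k : ℕ} (hk : 1 ≤ k) (x y : Gl n) :
    (isRMatrix_J n).hamField (fun y => ham k (x * y)) y =
      y * projK (Complex.I • (x * y : Mat n) ^ k) - projK (Complex.I • (y * x : Mat n) ^ k) * y := by
  obtain ⟨k, rfl⟩ := Nat.exists_eq_add_of_le' hk
  have h := matGrad_ham hk (x * y)
  rw [IsRMatrix.hamField, hamVector_J, (isRMatrix_J n).gradient_mul_left (smooth_ham n _)]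
  simp only [matGrad, Units.val_mul] at h ⊢
  have e : (y : Mat n) * ((x * y) ^ k * x) = (y * x) ^ (k + 1) := by
    rw [mul_pow_mul, ← mul_assoc, ← pow_succ']
  rw [h, Nat.add_sub_cancel, smul_mul_assoc, smul_mul_assoc, mul_smul_comm, e, mul_assoc,
    ← pow_succ]

theorem hamiltonEqAt_ham_mul_iff {k : ℕ} (hk : 1 ≤ k) (γ₁ γ₂ : ℝ → Gl n) (t : ℝ) :
    HamiltonEqAt (Smooth ((Imat n).prod (Imat n))) (prodBracket (sklyanin n) (sklyanin n))
        (fun p => ham k (p.1 * p.2)) (fun s => (γ₁ s, γ₂ s)) t ↔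
      HasDerivAt (fun s => (γ₁ s : Mat n))
        (γ₁ t * projK (Complex.I • (γ₂ t * γ₁ t : Mat n) ^ k) -
          projK (Complex.I • (γ₁ t * γ₂ t : Mat n) ^ k) * γ₁ t) t ∧
      HasDerivAt (fun s => (γ₂ s : Mat n))
        (γ₂ t * projK (Complex.I • (γ₁ t * γ₂ t : Mat n) ^ k) -
          projK (Complex.I • (γ₂ t * γ₁ t : Mat n) ^ k) * γ₂ t) t := by
  rw [← hamField_ham_mul_right hk, ← hamField_ham_mul_left hk,
    ← (isRMatrix_J n).hamiltonEqAt_prod_iff (H := fun p => ham k (p.1 * p.2))]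
  refine forall₂_congr fun ψ hψ => ?_
  have hH := smooth_ham_mul n k
  simp only [prodBracket]
  rw [sklyanin_eq (hH.slice_left _) (hψ.slice_left _),
    sklyanin_eq (hH.slice_right _) (hψ.slice_right _)]

/-- In the product rule the terms with `projK` of `I (g₂ g₁)^k` between `γ₁` and `γ₂` cancel. -/
theorem hasDerivAt_monodromy {k : ℕ} {γ₁ γ₂ : ℝ → Gl n} {t : ℝ}
    (h₁ : HasDerivAt (fun s => (γ₁ s : Mat n))
      (γ₁ t * projK (Complex.I • (γ₂ t * γ₁ t : Mat n) ^ k) -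
        projK (Complex.I • (γ₁ t * γ₂ t : Mat n) ^ k) * γ₁ t) t)
    (h₂ : HasDerivAt (fun s => (γ₂ s : Mat n))
      (γ₂ t * projK (Complex.I • (γ₁ t * γ₂ t : Mat n) ^ k) -
        projK (Complex.I • (γ₂ t * γ₁ t : Mat n) ^ k) * γ₂ t) t) :
    HasDerivAt (fun s => (γ₁ s * γ₂ s : Mat n)) (flowField k (γ₁ t * γ₂ t : Mat n)) t := by
  refine (h₁.mul h₂).congr_deriv ?_
  rw [flowField_eq]
  noncomm_ring

/-! ### The Poisson Lie subgroup `U(n)` -/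

theorem mem_K_iff {g : Gl n} : g ∈ K n ↔ (g : Mat n)ᴴ * g = 1 := by
  rw [K, Submonoid.mem_units_iff]
  refine ⟨fun h => Matrix.mem_unitaryGroup_iff'.1 h.1, fun h => ?_⟩
  have h1 : (g : Mat n) ∈ Matrix.unitaryGroup (Fin n) ℂ := Matrix.mem_unitaryGroup_iff'.2 h
  refine ⟨h1, ?_⟩
  rw [Units.inv_eq_of_mul_eq_one_left h]
  exact Unitary.star_mem h1

theorem inv_eq_conjTranspose {k : Gl n} (hk : k ∈ K n) : ((k⁻¹ : Gl n) : Mat n) = (k : Mat n)ᴴ :=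
  Units.inv_eq_of_mul_eq_one_left (mem_K_iff.1 hk)

theorem expGl_mem_K {X : Mat n} (h : X ∈ 𝔨 n) : expGl X ∈ K n := by
  rw [mem_K_iff]
  change (NormedSpace.exp X)ᴴ * NormedSpace.exp X = 1
  rw [← Matrix.exp_conjTranspose, mem_𝔨.1 h, ← Matrix.exp_add_of_commute _ _ (by simp)]
  simp

theorem conj_mem_𝔨 {k : Gl n} (hk : k ∈ K n) {X : Mat n} (hX : X ∈ 𝔨 n) :
    ((k⁻¹ : Gl n) : Mat n) * X * k ∈ 𝔨 n := by
  rw [inv_eq_conjTranspose hk, mem_𝔨, Matrix.conjTranspose_mul, Matrix.conjTranspose_mul,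
    Matrix.conjTranspose_conjTranspose, mem_𝔨.1 hX]
  simp [mul_assoc]

theorem hasDerivAt_mul_expGl (g : Gl n) (Y : Mat n) :
    HasDerivAt (fun t : ℝ => ((g * expGl (t • Y) : Gl n) : Mat n)) (g * Y) 0 :=
  (hasDerivAt_expGl Y).const_mul (g : Mat n)

theorem isPoissonImmersion_K (n : ℕ) :
    IsPoissonImmersion (J : Mat n →ₗ[ℝ] Mat n) (SmoothOn (Imat n) (K n)) (Subtype.val) where
  extend f hf := by
    obtain ⟨φ, h1, h2⟩ := hf
    exact ⟨φ, h1, fun m => (h2 m).symm⟩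
  restrict φ hφ := ⟨φ, hφ, fun _ => rfl⟩
  tangent k u := by
    -- The Hamiltonian vector at `k` is `k * Y`, and `Y` lies in `𝔨` because conjugation by `K`
    -- preserves `𝔨`.
    let Y : Mat n := projK (u * ((k : Gl n) : Mat n)) -
      (((k : Gl n)⁻¹ : Gl n) : Mat n) * projK (((k : Gl n) : Mat n) * u) *
        ((k : Gl n) : Mat n)
    have hY : Y ∈ 𝔨 n := Submodule.sub_mem _ (projK_mem _) (conj_mem_𝔨 k.2 (projK_mem _))
    refine ⟨fun t => ⟨k * expGl (t • Y), (K n).mul_mem k.2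
      (expGl_mem_K (Submodule.smul_mem _ t hY))⟩, ?_, ?_⟩
    · simp [expGl_zero]
    · refine (hasDerivAt_mul_expGl (k : Gl n) Y).congr_deriv ?_
      rw [hamVector_J]
      simp [Y, mul_sub, ← mul_assoc]

theorem isPoissonLieSubgroup_K (n : ℕ) : IsPoissonLieSubgroup (Imat n) (sklyanin n) (K n) := by
  have hι := isPoissonImmersion_K n
  refine ⟨?_, (isRMatrix_J n).restrictBracket Subtype.val,
    hι.isPoissonBracket_restrictBracket _,
    hι.isMultiplicative_restrictBracket _ fun _ _ => rfl, fun φ ψ hφ hψ k => ?_⟩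
  · have : (K n : Set (Gl n)) = {g : Gl n | (g : Mat n)ᴴ * g = 1} := by
      ext g; exact mem_K_iff
    rw [this]
    exact isClosed_eq ((Units.continuous_val.matrix_conjTranspose).mul Units.continuous_val)
      continuous_const
  · rw [hι.restrictBracket_eq _ hφ hψ (fun _ => rfl) fun _ => rfl, sklyanin_eq hφ hψ]

end Sklyanin

/-! ### The Iwasawa decomposition -/

section Iwasawa

open Filter Topology
open scoped ComplexOrder

variable {n : ℕ}

theorem mem_𝔟_of_mem_B {g : Gl n} (h : g ∈ B n) : (g : Mat n) ∈ 𝔟 n :=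
  ⟨h.1, fun i => (h.2 i).2⟩

theorem one_mem_B (n : ℕ) : (1 : Gl n) ∈ B n :=
  ⟨fun i j h => by simp [h.ne], fun i => by simp⟩

theorem mul_mem_B {g h : Gl n} (hg : g ∈ B n) (hh : h ∈ B n) : g * h ∈ B n := by
  refine ⟨lower_mul_apply hg.1 hh.1, fun i => ?_⟩
  rw [Units.val_mul, lower_mul_apply_self hg.1 hh.1, Complex.mul_re, Complex.mul_im,
    (hg.2 i).2, (hh.2 i).2]
  simpa using mul_pos (hg.2 i).1 (hh.2 i).1

theorem lower_inv {g : Gl n} (hg : ∀ i j, i < j → (g : Mat n) i j = 0) (i j : Fin n)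
    (h : i < j) : ((g⁻¹ : Gl n) : Mat n) i j = 0 := by
  have h1 : (g : Mat n).BlockTriangular OrderDual.toDual := fun i j hij => hg i j hij
  let _ : Invertible (g : Mat n) := g.isUnit.invertible
  have h2 := Matrix.blockTriangular_inv_of_blockTriangular h1
  rw [Matrix.coe_units_inv]
  exact h2 h

theorem inv_mem_B {g : Gl n} (hg : g ∈ B n) : g⁻¹ ∈ B n := by
  refine ⟨lower_inv hg.1, fun i => ?_⟩
  have h1 := lower_mul_apply_self hg.1 (lower_inv hg.1) i
  rw [← Units.val_mul, mul_inv_cancel, Units.val_one, Matrix.one_apply_eq] at h1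
  have hr := congrArg Complex.re h1
  have hi := congrArg Complex.im h1
  rw [Complex.mul_re, (hg.2 i).2] at hr
  rw [Complex.mul_im, (hg.2 i).2] at hi
  have hp := (hg.2 i).1
  simp only [Complex.one_re, Complex.one_im, zero_mul, sub_zero, add_zero] at hr hi
  refine ⟨(mul_pos_iff_of_pos_left hp).1 (by rw [← hr]; exact one_pos), ?_⟩
  exact (mul_eq_zero.1 hi.symm).resolve_left hp.ne'

/-- The inverse is lower triangular and equals the adjoint, so `g` is diagonal; its entries are
positive of modulus one. -/
theorem eq_one_of_mem_K_of_mem_B {g : Gl n} (hK : g ∈ K n) (hB : g ∈ B n) : g = 1 := by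
  have hu := inv_eq_conjTranspose hK
  have hl : ∀ i j, i < j → (g : Mat n) j i = 0 := fun i j h => by
    have := (inv_mem_B hB).1 i j h
    rw [hu, Matrix.conjTranspose_apply] at this
    exact star_eq_zero.1 this
  ext i j
  rcases lt_trichotomy i j with h | rfl | h
  · rw [hB.1 i j h, Units.val_one, Matrix.one_apply_ne h.ne]
  · have h1 := lower_mul_apply_self hB.1 (inv_mem_B hB).1 i
    rw [← Units.val_mul, mul_inv_cancel, hu, Matrix.conjTranspose_apply, Units.val_one,
      Matrix.one_apply_eq] at h1
    have hr := congrArg Complex.re h1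
    obtain ⟨hp, hi⟩ := hB.2 i
    simp [hi] at hr
    rw [Units.val_one, Matrix.one_apply_eq]
    refine Complex.ext ?_ hi
    rw [Complex.one_re]
    nlinarith
  · rw [hl j i h, Units.val_one, Matrix.one_apply_ne h.ne']

/-- An LDL decomposition of `S = g⁻¹ (g⁻¹)ᴴ` gives `c ∈ B` with `c S cᴴ = 1`. Then `c g⁻¹` is
unitary, and the factors are `g c⁻¹` and `c⁻¹`. -/
theorem exists_isIwasawa (g : Gl n) : ∃ p, IsIwasawa g p := by
  have hinj : ∀ h : Gl n, Function.Injective (h : Mat n).vecMul := fun h x y hxy => by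
    have := congrArg (Matrix.vecMul · ((h⁻¹ : Gl n) : Mat n)) hxy
    simpa [Matrix.vecMul_vecMul] using this
  have hS : (((g⁻¹ : Gl n) : Mat n) * ((g⁻¹ : Gl n) : Mat n)ᴴ).PosDef :=
    Matrix.PosDef.mul_conjTranspose_self _ (hinj _)
  set S := ((g⁻¹ : Gl n) : Mat n) * ((g⁻¹ : Gl n) : Mat n)ᴴ with hSdef
  let _ := LDL.invertibleLowerInv hS
  let L : Mat n := LDL.lowerInv hS
  have hlow : ∀ i j, i < j → L i j = 0 := fun i j h => LDL.lowerInv_triangular hS h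
  have hLu : IsUnit L := isUnit_of_invertible _
  have hD : (L * S * Lᴴ).PosDef := hS.mul_mul_conjTranspose_same (hinj hLu.unit)
  have hdiag : L * S * Lᴴ = Matrix.diagonal (LDL.diagEntries hS) :=
    (LDL.diag_eq_lowerInv_conj hS).symm
  have hpos : ∀ i, 0 < LDL.diagEntries hS i := fun i => by
    have := hD.diag_pos (i := i)
    rwa [hdiag, Matrix.diagonal_apply_eq] at this
  have hne : ∀ i, L i i ≠ 0 := fun i h0 => by
    have hdet : L.det = 0 :=
      (Matrix.det_of_isLowerTriangular L fun i j hij => hlow i j hij).trans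
        (Finset.prod_eq_zero (Finset.mem_univ i) h0)
    have := (Matrix.isUnit_iff_isUnit_det L).1 hLu
    rw [hdet] at this
    exact not_isUnit_zero this
  let d : Fin n → ℝ := fun i => (LDL.diagEntries hS i).re
  have hd : ∀ i, 0 < d i := fun i => (Complex.pos_iff.1 (hpos i)).1
  have hdc : ∀ i, LDL.diagEntries hS i = (d i : ℂ) := fun i =>
    Complex.ext rfl (Complex.pos_iff.1 (hpos i)).2.symm
  -- Row scaling: the phase makes the diagonal of `L` positive, and the modulus `1 / √(d i)`
  -- normalizes the diagonal of `L S Lᴴ` to one.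
  let e : Fin n → ℂ := fun i => star (L i i) / ((‖L i i‖ * √(d i) : ℝ) : ℂ)
  have hn : ∀ i, 0 < ‖L i i‖ * √(d i) := fun i =>
    mul_pos (norm_pos_iff.2 (hne i)) (Real.sqrt_pos.2 (hd i))
  have he : ∀ i, e i * L i i = ((‖L i i‖ ^ 2 / (‖L i i‖ * √(d i)) : ℝ) : ℂ) := fun i => by
    have := Complex.conj_mul' (L i i)
    change star (L i i) / _ * L i i = _
    rw [div_mul_eq_mul_div, Complex.star_def, this]
    push_cast
    rfl
  have hed : ∀ i, e i * LDL.diagEntries hS i * star (e i) = 1 := fun i => by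
    have h1 : e i * star (e i) = ((1 / d i : ℝ) : ℂ) := by
      rw [Complex.star_def, Complex.mul_conj', norm_div, norm_star, Complex.norm_real,
        Real.norm_of_nonneg (hn i).le, ← Complex.ofReal_pow, div_pow, mul_pow,
        Real.sq_sqrt (hd i).le]
      have := (norm_pos_iff.2 (hne i)).ne'
      congr 1
      field_simp
    rw [mul_right_comm, h1, hdc, ← Complex.ofReal_mul, one_div_mul_cancel (hd i).ne',
      Complex.ofReal_one]
  have hc : Matrix.diagonal e * L * (S * (Matrix.diagonal e * L)ᴴ) = 1 := by
    calc Matrix.diagonal e * L * (S * (Matrix.diagonal e * L)ᴴ)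
        = Matrix.diagonal e * (L * S * Lᴴ) * (Matrix.diagonal e)ᴴ := by
          simp only [Matrix.conjTranspose_mul, mul_assoc]
      _ = 1 := by
          rw [hdiag, Matrix.diagonal_conjTranspose, Matrix.diagonal_mul_diagonal,
            Matrix.diagonal_mul_diagonal, ← Matrix.diagonal_one]
          congr 1
          funext i
          exact hed i
  let c : Gl n := ⟨_, _, hc, mul_eq_one_comm.1 hc⟩
  have hcB : c ∈ B n := by
    refine ⟨fun i j h => ?_, fun i => ?_⟩
    · change (Matrix.diagonal e * L) i j = 0
      rw [Matrix.diagonal_mul, hlow i j h, mul_zero]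
    · change 0 < ((Matrix.diagonal e * L) i i).re ∧ ((Matrix.diagonal e * L) i i).im = 0
      rw [Matrix.diagonal_mul, he i]
      exact ⟨div_pos (pow_pos (norm_pos_iff.2 (hne i)) 2) (hn i), Complex.ofReal_im _⟩
  have hK : c * g⁻¹ ∈ K n := by
    rw [mem_K_iff, mul_eq_one_comm, Units.val_mul, Matrix.conjTranspose_mul, ← hc]
    simp only [c, hSdef, mul_assoc]
  refine ⟨(g * c⁻¹, c⁻¹), ?_, inv_mem_B hcB, ?_⟩
  · have := (K n).inv_mem hK
    rwa [mul_inv_rev, inv_inv] at this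
  · simp

theorem IsIwasawa.eq {g : Gl n} {p q : Gl n × Gl n} (hp : IsIwasawa g p) (hq : IsIwasawa g q) :
    p = q := by
  obtain ⟨hp1, hp2, hp3⟩ := hp
  obtain ⟨hq1, hq2, hq3⟩ := hq
  have h : q.1⁻¹ * p.1 = q.2⁻¹ * p.2 := by
    have : p.1 * p.2⁻¹ = q.1 * q.2⁻¹ := hp3.symm.trans hq3
    rw [inv_mul_eq_iff_eq_mul, ← mul_assoc, ← this, inv_mul_cancel_right]
  have h1 : q.1⁻¹ * p.1 = 1 := eq_one_of_mem_K_of_mem_B ((K n).mul_mem ((K n).inv_mem hq1) hp1)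
    (h ▸ mul_mem_B (inv_mem_B hq2) hp2)
  exact Prod.ext (inv_mul_eq_one.1 h1).symm (inv_mul_eq_one.1 (h ▸ h1)).symm

theorem existsUnique_isIwasawa (g : Gl n) : ∃! p, IsIwasawa g p := by
  obtain ⟨p, hp⟩ := exists_isIwasawa g
  exact ⟨p, hp, fun q hq => hq.eq hp⟩

theorem isIwasawa_iwasawa (g : Gl n) : IsIwasawa g (iwasawa g) :=
  Classical.epsilon_spec (exists_isIwasawa g)

theorem iwasawa_eq {k b : Gl n} (hk : k ∈ K n) (hb : b ∈ B n) : iwasawa (k * b⁻¹) = (k, b) :=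
  (isIwasawa_iwasawa _).eq ⟨hk, hb, rfl⟩

theorem iwasawa_mul_inv (g : Gl n) : (iwasawa g).1 * (iwasawa g).2⁻¹ = g :=
  (isIwasawa_iwasawa g).2.2.symm

/-! ### Smoothness of the Iwasawa factors -/

theorem exp_mem_𝔟 {X : Mat n} (h : X ∈ 𝔟 n) : NormedSpace.exp X ∈ 𝔟 n := by
  rw [NormedSpace.exp_eq_tsum ℝ]
  have hc : IsClosed (𝔟 n : Set (Mat n)) := (𝔟 n).closed_of_finiteDimensional
  refine tsum_mem (s := 𝔟 n) hc fun i => Submodule.smul_mem _ _ ?_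
  induction i with
  | zero => rw [pow_zero]; exact mem_𝔟_of_mem_B (one_mem_B n)
  | succ i ih => rw [pow_succ]; exact mul_mem_𝔟 ih h

/-- Each diagonal entry is the square of the corresponding entry of `exp (X / 2)`, which is real
and, being invertible, nonzero. -/
theorem expGl_mem_B {X : Mat n} (h : X ∈ 𝔟 n) : expGl X ∈ B n := by
  have hh : (2⁻¹ : ℝ) • X ∈ 𝔟 n := Submodule.smul_mem _ _ h
  have h1 := exp_mem_𝔟 hh
  have h2 := exp_mem_𝔟 (Submodule.neg_mem _ hh)
  have e1 : NormedSpace.exp X = NormedSpace.exp ((2⁻¹ : ℝ) • X) * NormedSpace.exp ((2⁻¹ : ℝ) • X) := by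
    rw [← Matrix.exp_add_of_commute _ _ rfl, ← add_smul]
    norm_num
  have e2 : NormedSpace.exp ((2⁻¹ : ℝ) • X) * NormedSpace.exp (-((2⁻¹ : ℝ) • X)) = 1 := by
    rw [← Matrix.exp_add_of_commute _ _ (by simp), add_neg_cancel, NormedSpace.exp_zero]
  refine ⟨(exp_mem_𝔟 h).1, fun i => ⟨?_, (exp_mem_𝔟 h).2 i⟩⟩
  have h3 := lower_mul_apply_self h1.1 h1.1 i
  have h4 := lower_mul_apply_self h1.1 h2.1 i
  rw [e2, Matrix.one_apply_eq] at h4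
  rw [← e1] at h3
  change 0 < (NormedSpace.exp X i i).re
  rw [h3, Complex.mul_re, h1.2 i, mul_zero, sub_zero]
  refine mul_self_pos.2 fun h0 => ?_
  have : NormedSpace.exp ((2⁻¹ : ℝ) • X) i i = 0 := Complex.ext h0 (h1.2 i)
  rw [this, zero_mul] at h4
  exact one_ne_zero h4

/-- Inverse function theorem: `Z ↦ exp (projK Z) * exp (projB Z)` has derivative `projK + projB = 1`
at `0`. -/
theorem exists_exp_coordinates (n : ℕ) : ∃ G : Mat n → Mat n, ContDiffAt ℝ ∞ G 1 ∧ G 1 = 0 ∧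
    ∀ᶠ a in 𝓝 (1 : Mat n),
      NormedSpace.exp (projK (G a)) * NormedSpace.exp (projB (G a)) = a := by
  let F : Mat n → Mat n := fun Z => NormedSpace.exp (projK Z) * NormedSpace.exp (projB Z)
  have hexp : ContDiffAt ℝ ∞ (NormedSpace.exp : Mat n → Mat n) 0 :=
    ((NormedSpace.exp_hasFPowerSeriesAt_zero (𝕂 := ℝ) (𝔸 := Mat n)).analyticAt).contDiffAt
  have hF0 : F 0 = 1 := by simp [F]
  have hcomp : ∀ P : Mat n →ₗ[ℝ] Mat n,
      ContDiffAt ℝ ∞ (fun Z => NormedSpace.exp (P Z)) (0 : Mat n) := fun P =>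
    ContDiffAt.comp (0 : Mat n) (by rwa [map_zero]) (ContDiffAt.linearMap_comp P contDiffAt_id)
  have hF : ContDiffAt ℝ ∞ F 0 := (hcomp projK).mul (hcomp projB)
  have hd : ∀ P : Mat n →ₗ[ℝ] Mat n, HasFDerivAt (fun Z => NormedSpace.exp (P Z))
      (LinearMap.toContinuousLinearMap P) (0 : Mat n) := fun P => by
    have h1 : HasFDerivAt (NormedSpace.exp : Mat n → Mat n) (1 : Mat n →L[ℝ] Mat n)
        (LinearMap.toContinuousLinearMap P 0) := by
      rw [map_zero]; exact hasFDerivAt_exp_zero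
    exact h1.comp (0 : Mat n) (LinearMap.toContinuousLinearMap P).hasFDerivAt
  have hF' : HasFDerivAt F (ContinuousLinearEquiv.refl ℝ (Mat n) : Mat n →L[ℝ] Mat n) 0 := by
    refine ((hd projK).mul' (hd projB)).congr_fderiv ?_
    ext1 Z
    simp [← sub_projK]
  refine ⟨hF.localInverse hF' (by simp), ?_, ?_, ?_⟩
  · have := hF.to_localInverse hF' (by simp)
    rwa [hF0] at this
  · have := hF.localInverse_apply_image hF' (by simp)
    rwa [hF0] at this
  · have := (hF.hasStrictFDerivAt' hF' (by simp)).eventually_right_inverse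
    rwa [hF0] at this

/-- With `g = k b⁻¹`, the translate `k⁻¹ x b` is near `1` for `x` near `g`. Its exponential
coordinates yield factors of `x`, and uniqueness identifies them with the chosen ones. -/
theorem contDiffAt_iwasawa_fst (g : Gl n) :
    ContDiffAt ℝ ∞ (unitsLift fun x : Gl n => ((iwasawa x).1 : Mat n)) (g : Mat n) := by
  obtain ⟨G, hG, hG1, hGa⟩ := exists_exp_coordinates n
  set k := (iwasawa g).1
  set b := (iwasawa g).2
  have hk : k ∈ K n := (isIwasawa_iwasawa g).1
  have hb : b ∈ B n := (isIwasawa_iwasawa g).2.1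
  let m : Mat n → Mat n := fun a => ((k⁻¹ : Gl n) : Mat n) * a * b
  have hm : ContDiff ℝ ∞ m := (contDiff_const.mul contDiff_id).mul contDiff_const
  have hm1 : m g = 1 := by
    change ((k⁻¹ * g * b : Gl n) : Mat n) = 1
    rw [← iwasawa_mul_inv g]
    simp [k, b]
  have hev : (unitsLift fun x : Gl n => ((iwasawa x).1 : Mat n)) =ᶠ[𝓝 (g : Mat n)]
      fun a => k * NormedSpace.exp (projK (G (m a))) := by
    have h1 : ∀ᶠ a in 𝓝 (g : Mat n), NormedSpace.exp (projK (G (m a))) *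
        NormedSpace.exp (projB (G (m a))) = m a := by
      have := hm.continuous.continuousAt (x := (g : Mat n))
      rw [ContinuousAt, hm1] at this
      exact this.eventually hGa
    filter_upwards [h1, eventually_isUnit g]
    rintro _ h ⟨x, rfl⟩
    rw [unitsLift_val]
    -- The minus sign compensates for the inverse on the second factor.
    have hx : x = (k * expGl (projK (G (m x)))) * (b * expGl (-projB (G (m x))))⁻¹ := by
      ext1
      have h2 : expGl (-projB (G (m x))) = (expGl (projB (G (m x))))⁻¹ := by
        ext1
        rw [Matrix.coe_units_inv]
        exact Matrix.exp_neg _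
      rw [h2, mul_inv_rev, inv_inv]
      have h3 : (x : Mat n) = k * m x * (b⁻¹ : Gl n) := by
        simp [m, mul_assoc]
      rw [← h] at h3
      refine h3.trans ?_
      simp only [Units.val_mul, mul_assoc]
      rfl
    have h4 := iwasawa_eq ((K n).mul_mem hk (expGl_mem_K (projK_mem (G (m x)))))
      (mul_mem_B hb (expGl_mem_B (Submodule.neg_mem _ (projB_mem (G (m x))))))
    rw [← hx] at h4
    rw [h4]
    rfl
  refine ContDiffAt.congr_of_eventuallyEq ?_ hev
  have hexp : ContDiffAt ℝ ∞ (NormedSpace.exp : Mat n → Mat n) 0 :=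
    ((NormedSpace.exp_hasFPowerSeriesAt_zero (𝕂 := ℝ) (𝔸 := Mat n)).analyticAt).contDiffAt
  refine contDiffAt_const.mul (ContDiffAt.comp (g : Mat n) ?_
    (ContDiffAt.linearMap_comp projK (ContDiffAt.comp (g : Mat n) ?_ hm.contDiffAt)))
  · rwa [hm1, hG1, map_zero]
  · rwa [hm1]

theorem iwasawa_snd_inv (g : Gl n) :
    (((iwasawa g).2⁻¹ : Gl n) : Mat n) = ((iwasawa g).1 : Mat n)ᴴ * g := by
  rw [← inv_eq_conjTranspose (isIwasawa_iwasawa g).1, ← Units.val_mul]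
  congr 1
  rw [eq_inv_mul_iff_mul_eq, iwasawa_mul_inv]

/-- The conjugate transpose as a real linear map. -/
def conjTransposeLM (n : ℕ) : Mat n →ₗ[ℝ] Mat n where
  toFun X := Xᴴ
  map_add' := Matrix.conjTranspose_add
  map_smul' c X := by simp [Matrix.conjTranspose_smul]

theorem contDiffAt_iwasawa_snd_inv (g : Gl n) :
    ContDiffAt ℝ ∞ (unitsLift fun x : Gl n => (((iwasawa x).2⁻¹ : Gl n) : Mat n)) (g : Mat n) := by
  have h1 := (ContDiffAt.linearMap_comp (conjTransposeLM n) (contDiffAt_iwasawa_fst g)).mul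
    contDiffAt_id
  refine h1.congr_of_eventuallyEq (unitsLift_eventuallyEq (fun x => ?_) g)
  simp only [unitsLift_val]
  exact iwasawa_snd_inv x

theorem contDiffAt_iwasawa_snd (g : Gl n) :
    ContDiffAt ℝ ∞ (unitsLift fun x : Gl n => ((iwasawa x).2 : Mat n)) (g : Mat n) := by
  have h1 : ContDiffAt ℝ ∞ (Ring.inverse ∘
      unitsLift fun x : Gl n => (((iwasawa x).2⁻¹ : Gl n) : Mat n)) (g : Mat n) := by
    refine ContDiffAt.comp (g : Mat n) ?_ (contDiffAt_iwasawa_snd_inv g)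
    rw [unitsLift_val]
    exact contDiffAt_ringInverse ℝ _
  refine h1.congr_of_eventuallyEq (unitsLift_eventuallyEq (fun x => ?_) g)
  simp only [unitsLift_val, Function.comp_apply, Ring.inverse_unit, inv_inv]

theorem iwasawa_one (n : ℕ) : iwasawa (1 : Gl n) = (1, 1) := by
  simpa using iwasawa_eq (K n).one_mem (one_mem_B n)

/-- Let `A` be the derivative. Differentiating `g₊ᴴ g₊ = 1` puts `A X` in `𝔨`; differentiating `g₊ᴴ
g ∈ 𝔟` puts `X - A X` in `𝔟`. Hence `A X` is the `𝔨`-component of `X`. -/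
theorem hasFDerivAt_iwasawa_fst_one (n : ℕ) :
    HasFDerivAt (unitsLift fun x : Gl n => ((iwasawa x).1 : Mat n))
      (LinearMap.toContinuousLinearMap (projK : Mat n →ₗ[ℝ] Mat n)) ((1 : Gl n) : Mat n) := by
  have hd := ((contDiffAt_iwasawa_fst (1 : Gl n)).differentiableAt (by simp)).hasFDerivAt
  set A := fderiv ℝ (unitsLift fun x : Gl n => ((iwasawa x).1 : Mat n)) ((1 : Gl n) : Mat n)
  have hs := (LinearMap.toContinuousLinearMap (conjTransposeLM n)).hasFDerivAt.comp _ hd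
  have hv : unitsLift (fun x : Gl n => ((iwasawa x).1 : Mat n)) ((1 : Gl n) : Mat n) = 1 := by
    rw [unitsLift_val, iwasawa_one]; rfl
  have hA : ∀ X, (A X)ᴴ = - A X := by
    intro X
    have he : (fun a : Mat n => conjTransposeLM n (unitsLift (fun x : Gl n =>
        ((iwasawa x).1 : Mat n)) a) * unitsLift (fun x : Gl n => ((iwasawa x).1 : Mat n)) a)
        =ᶠ[𝓝 ((1 : Gl n) : Mat n)] fun _ => 1 := by
      filter_upwards [eventually_isUnit (1 : Gl n)]
      rintro _ ⟨u, rfl⟩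
      rw [unitsLift_val]
      exact mem_K_iff.1 (isIwasawa_iwasawa u).1
    have h1 := congrArg (fun L : Mat n →L[ℝ] Mat n => L X) ((hs.mul' hd).unique
      ((hasFDerivAt_const (1 : Mat n) ((1 : Gl n) : Mat n)).congr_of_eventuallyEq he))
    rw [Units.val_one] at hv
    simp [conjTransposeLM, hv] at h1
    exact eq_neg_of_add_eq_zero_right h1
  have hB : ∀ X, projK ((A X)ᴴ + X) = 0 := by
    intro X
    have he : (fun a : Mat n => projK (conjTransposeLM n (unitsLift (fun x : Gl n =>
        ((iwasawa x).1 : Mat n)) a) * a))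
        =ᶠ[𝓝 ((1 : Gl n) : Mat n)] fun _ => 0 := by
      filter_upwards [eventually_isUnit (1 : Gl n)]
      rintro _ ⟨u, rfl⟩
      rw [unitsLift_val]
      have := projK_of_mem_𝔟 (mem_𝔟_of_mem_B (inv_mem_B (isIwasawa_iwasawa u).2.1))
      rw [iwasawa_snd_inv] at this
      exact this
    have h2 := (LinearMap.toContinuousLinearMap (projK : Mat n →ₗ[ℝ] Mat n)).hasFDerivAt.comp _
      (hs.mul' (hasFDerivAt_id ((1 : Gl n) : Mat n)))
    have h1 := congrArg (fun L : Mat n →L[ℝ] Mat n => L X) (h2.unique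
      ((hasFDerivAt_const (0 : Mat n) ((1 : Gl n) : Mat n)).congr_of_eventuallyEq he))
    rw [Units.val_one] at hv
    simp [conjTransposeLM, hv] at h1
    simpa [add_comm] using h1
  refine hd.congr_fderiv ?_
  ext1 X
  have h1 := hB X
  rw [hA, map_add, map_neg, projK_of_mem (mem_𝔨.2 (hA X))] at h1
  exact (neg_add_eq_zero.1 h1)

end Iwasawa

/-! ### The dual group -/

section DualGroup

open Filter Topology

variable {n : ℕ}

theorem starMul_eq (g h : Gl n) : starMul g h =
    ((iwasawa g).1 * (iwasawa h).1) * ((iwasawa g).2 * (iwasawa h).2)⁻¹ := by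
  conv_lhs => rw [starMul, ← iwasawa_mul_inv h]
  group

/-- In Iwasawa factors `starMul` is componentwise multiplication on `K × B`; the group axioms are
pulled back through injectivity. -/
theorem iwasawa_starMul (g h : Gl n) : iwasawa (starMul g h) =
    ((iwasawa g).1 * (iwasawa h).1, (iwasawa g).2 * (iwasawa h).2) := by
  rw [starMul_eq]
  exact iwasawa_eq ((K n).mul_mem (isIwasawa_iwasawa g).1 (isIwasawa_iwasawa h).1)
    (mul_mem_B (isIwasawa_iwasawa g).2.1 (isIwasawa_iwasawa h).2.1)

/-- The inverse of `g` with respect to `starMul`. -/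
def starInv (g : Gl n) : Gl n := (iwasawa g).1⁻¹ * (iwasawa g).2

theorem iwasawa_starInv (g : Gl n) :
    iwasawa (starInv g) = ((iwasawa g).1⁻¹, (iwasawa g).2⁻¹) := by
  have := iwasawa_eq ((K n).inv_mem (isIwasawa_iwasawa g).1)
    (inv_mem_B (isIwasawa_iwasawa g).2.1)
  rwa [inv_inv] at this

theorem iwasawa_injective : Function.Injective (iwasawa : Gl n → Gl n × Gl n) := fun g h e => by
  rw [← iwasawa_mul_inv g, e, iwasawa_mul_inv]

theorem starMul_assoc (g h k : Gl n) : starMul (starMul g h) k = starMul g (starMul h k) :=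
  iwasawa_injective (by simp only [iwasawa_starMul, mul_assoc])

theorem one_starMul (g : Gl n) : starMul 1 g = g :=
  iwasawa_injective (by simp only [iwasawa_starMul, iwasawa_one, one_mul])

theorem starInv_starMul (g : Gl n) : starMul (starInv g) g = 1 :=
  iwasawa_injective (by simp only [iwasawa_starMul, iwasawa_starInv, iwasawa_one, inv_mul_cancel])

instance dualGroup (n : ℕ) : Group (DualGl n) :=
  letI : Mul (DualGl n) := ⟨starMul (n := n)⟩
  letI : One (DualGl n) := ⟨(1 : Gl n)⟩
  letI : Inv (DualGl n) := ⟨starInv (n := n)⟩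
  Group.ofLeftAxioms (starMul_assoc (n := n)) (one_starMul (n := n)) (starInv_starMul (n := n))

theorem dual_mul_def (g h : DualGl n) : g * h = starMul (n := n) g h := rfl

/-! ### The Lie group structure and Lie algebra of the dual group -/

theorem contMDiff_gl_of_val {E H M : Type*} [NormedAddCommGroup E] [NormedSpace ℝ E]
    [TopologicalSpace H] {I : ModelWithCorners ℝ E H} [TopologicalSpace M] [ChartedSpace H M]
    {f : M → Gl n} (h : ContMDiff I 𝓘(ℝ, Mat n) ∞ fun x => (f x : Mat n)) :
    ContMDiff I (Imat n) ∞ f :=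
  ContMDiff.of_comp_isOpenEmbedding Units.isOpenEmbedding_val h

theorem contMDiff_iwasawa_fst :
    ContMDiff (Imat n) 𝓘(ℝ, Mat n) ∞ fun g : Gl n => ((iwasawa g).1 : Mat n) := fun g => by
  have := ContMDiffAt.comp g (contDiffAt_iwasawa_fst g).contMDiffAt (Units.contMDiff_val g)
  refine this.congr_of_eventuallyEq (Eventually.of_forall fun x => ?_)
  exact (unitsLift_val (fun x : Gl n => ((iwasawa x).1 : Mat n)) x).symm

theorem contMDiff_iwasawa_snd_inv :
    ContMDiff (Imat n) 𝓘(ℝ, Mat n) ∞ fun g : Gl n => (((iwasawa g).2⁻¹ : Gl n) : Mat n) :=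
  fun g => by
  have := ContMDiffAt.comp g (contDiffAt_iwasawa_snd_inv g).contMDiffAt (Units.contMDiff_val g)
  refine this.congr_of_eventuallyEq (Eventually.of_forall fun x => ?_)
  exact (unitsLift_val (fun x : Gl n => (((iwasawa x).2⁻¹ : Gl n) : Mat n)) x).symm

theorem contMDiff_iwasawa_snd :
    ContMDiff (Imat n) 𝓘(ℝ, Mat n) ∞ fun g : Gl n => ((iwasawa g).2 : Mat n) := fun g => by
  have := ContMDiffAt.comp g (contDiffAt_iwasawa_snd g).contMDiffAt (Units.contMDiff_val g)
  refine this.congr_of_eventuallyEq (Eventually.of_forall fun x => ?_)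
  exact (unitsLift_val (fun x : Gl n => ((iwasawa x).2 : Mat n)) x).symm

theorem contMDiff_mat_mul {E H M : Type*} [NormedAddCommGroup E] [NormedSpace ℝ E]
    [TopologicalSpace H] {I : ModelWithCorners ℝ E H} [TopologicalSpace M] [ChartedSpace H M]
    {f k : M → Mat n} (hf : ContMDiff I 𝓘(ℝ, Mat n) ∞ f) (hk : ContMDiff I 𝓘(ℝ, Mat n) ∞ k) :
    ContMDiff I 𝓘(ℝ, Mat n) ∞ fun x => f x * k x :=
  (contDiff_fst.mul contDiff_snd : ContDiff ℝ ∞ fun p : Mat n × Mat n => p.1 * p.2).contMDiff.comp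
    (hf.prodMk_space hk)

theorem contMDiff_starMul : ContMDiff ((Imat n).prod (Imat n)) (Imat n) ∞
    fun p : Gl n × Gl n => starMul p.1 p.2 :=
  contMDiff_gl_of_val (contMDiff_mat_mul
    (contMDiff_mat_mul (contMDiff_iwasawa_fst.comp contMDiff_fst)
      (Units.contMDiff_val.comp contMDiff_snd))
    (contMDiff_iwasawa_snd_inv.comp contMDiff_fst))

theorem contMDiff_starInv : ContMDiff (Imat n) (Imat n) ∞ (starInv : Gl n → Gl n) := by
  refine contMDiff_gl_of_val (ContMDiff.congr (contMDiff_mat_mul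
    ((LinearMap.toContinuousLinearMap (conjTransposeLM n)).contDiff.contMDiff.comp
      contMDiff_iwasawa_fst) contMDiff_iwasawa_snd) fun g => ?_)
  rw [starInv, Units.val_mul, inv_eq_conjTranspose (isIwasawa_iwasawa g).1]
  rfl

instance isManifold_dual (n : ℕ) : IsManifold (Imat n) ∞ (DualGl n) :=
  inferInstanceAs (IsManifold (Imat n) ∞ (Gl n))

instance lieGroup_dual (n : ℕ) : LieGroup (Imat n) ∞ (DualGl n) where
  contMDiff_mul := contMDiff_starMul (n := n)
  contMDiff_inv := contMDiff_starInv (n := n)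

theorem hasFDerivAt_iwasawa_snd_inv_one (n : ℕ) :
    HasFDerivAt (unitsLift fun x : Gl n => (((iwasawa x).2⁻¹ : Gl n) : Mat n))
      (LinearMap.toContinuousLinearMap (projB : Mat n →ₗ[ℝ] Mat n)) ((1 : Gl n) : Mat n) := by
  have hv : unitsLift (fun x : Gl n => ((iwasawa x).1 : Mat n)) 1 = 1 := by
    rw [← Units.val_one, unitsLift_val, iwasawa_one]
  have h1 := ((LinearMap.toContinuousLinearMap (conjTransposeLM n)).hasFDerivAt.comp _
    (hasFDerivAt_iwasawa_fst_one n)).mul' (hasFDerivAt_id ((1 : Gl n) : Mat n))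
  refine (h1.congr_of_eventuallyEq (unitsLift_eventuallyEq (f := fun a => conjTransposeLM n
    (unitsLift (fun x : Gl n => ((iwasawa x).1 : Mat n)) a) * a)
    (fun x => ?_) 1)).congr_fderiv ?_
  · rw [unitsLift_val]
    exact iwasawa_snd_inv x
  · ext1 X
    simp [hv, conjTransposeLM, ← sub_projK, mem_𝔨.1 (projK_mem X), sub_eq_add_neg]

open VectorField in
/-- The Lie algebra of the dual group is `gl(n, ℂ)` with the `J`-bracket. -/
theorem groupLieAlgebra_dual_bracket (X Y : Mat n) :
    @Eq (Mat n) (Bracket.bracket (L := GroupLieAlgebra (Imat n) (DualGl n))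
      (M := GroupLieAlgebra (Imat n) (DualGl n)) X Y) (jBracket X Y) := by
  -- For fixed `g`, `starMul g` is the restriction of a linear map of matrices, so it is its own
  -- derivative.
  have hinv : ∀ X : Mat n, @Eq (Gl n → Mat n)
      (mulInvariantVectorField (I := Imat n) (G := DualGl n) X)
      fun g : Gl n => ((iwasawa g).1 : Mat n) * X * ((iwasawa g).2⁻¹ : Gl n) := by
    intro X
    funext g
    have hm : MDifferentiableAt (Imat n) (Imat n) (fun x : Gl n => starMul g x) 1 :=
      (contMDiff_starMul.comp (contMDiff_const.prodMk contMDiff_id)).mdifferentiable (by simp) _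
    refine (congrArg (fun L : Mat n →L[ℝ] Mat n => L X) (mfderiv_units_units_eq
      (f := fun x : Gl n => starMul g x) (g := 1) hm)).trans ?_
    have h : HasFDerivAt (unitsLift fun u : Gl n => ((starMul g u : Gl n) : Mat n))
        (((ContinuousLinearMap.mul ℝ (Mat n)).flip ((iwasawa g).2⁻¹ : Gl n)).comp
          (ContinuousLinearMap.mul ℝ (Mat n) (iwasawa g).1)) ((1 : Gl n) : Mat n) :=
      (ContinuousLinearMap.hasFDerivAt _).congr_of_eventuallyEq
        (unitsLift_eventuallyEq (f := ((ContinuousLinearMap.mul ℝ (Mat n)).flip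
          ((iwasawa g).2⁻¹ : Gl n)).comp (ContinuousLinearMap.mul ℝ (Mat n) (iwasawa g).1))
          (fun _ => rfl) 1)
    rw [h.fderiv]
    rfl
  have hv1 : unitsLift (fun x : Gl n => ((iwasawa x).1 : Mat n)) 1 = 1 := by
    rw [← Units.val_one, unitsLift_val, iwasawa_one]
  have hv2 : unitsLift (fun x : Gl n => (((iwasawa x).2⁻¹ : Gl n) : Mat n)) 1 = 1 := by
    rw [← Units.val_one, unitsLift_val, iwasawa_one, inv_one]
  have hd : ∀ X : Mat n, HasFDerivAt
      (unitsLift fun g : Gl n => ((iwasawa g).1 : Mat n) * X * ((iwasawa g).2⁻¹ : Gl n))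
      (((ContinuousLinearMap.mul ℝ (Mat n)).flip X).comp
        (LinearMap.toContinuousLinearMap (projK : Mat n →ₗ[ℝ] Mat n)) +
        (ContinuousLinearMap.mul ℝ (Mat n) X).comp
        (LinearMap.toContinuousLinearMap (projB : Mat n →ₗ[ℝ] Mat n)))
      ((1 : Gl n) : Mat n) := fun X => by
    have h : HasFDerivAt (fun a : Mat n => unitsLift (fun x : Gl n => ((iwasawa x).1 : Mat n)) a *
        X * unitsLift (fun x : Gl n => (((iwasawa x).2⁻¹ : Gl n) : Mat n)) a) _
        ((1 : Gl n) : Mat n) :=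
      ((hasFDerivAt_iwasawa_fst_one n).mul_const' X).mul' (hasFDerivAt_iwasawa_snd_inv_one n)
    refine HasFDerivAt.congr_fderiv h ?_
    ext1 Z
    rw [Units.val_one, hv1, hv2]
    simp [add_comm]
  have hval : ∀ X : Mat n, unitsLift (fun g : Gl n => ((iwasawa g).1 : Mat n) * X *
      ((iwasawa g).2⁻¹ : Gl n)) ((1 : Gl n) : Mat n) = X := fun X => by
    rw [unitsLift_val, iwasawa_one]
    simp
  refine Eq.trans (mlieBracket_units_eq
    (mulInvariantVectorField (I := Imat n) (G := DualGl n) X)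
    (mulInvariantVectorField (I := Imat n) (G := DualGl n) Y) 1) ?_
  -- What remains is `projK X * Y + Y * projB X - projK Y * X - X * projB Y`, whose mixed products
  -- cancel.
  rw [hinv, hinv, lieBracket_apply_of_hasFDerivAt (hd _) (hd _), hval, hval, jBracket_eq]
  simp [← sub_projK]
  noncomm_ring

end DualGroup

/-! ### The Poisson structure of the dual group -/

section DualPoisson

open Filter Topology

variable {n : ℕ}

/-- The invariant form on the double of `gl(n, ℂ)`, as a trace. -/
def doubleTrace (n : ℕ) : Mat n × Mat n →ₗ[ℝ] ℝ :=
  imTrace n ∘ₗ LinearMap.fst ℝ _ _ - imTrace n ∘ₗ LinearMap.snd ℝ _ _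

/-- The projection of the double onto the Lie algebra of the dual group along the diagonal. -/
def doubleProj (n : ℕ) : Mat n × Mat n →ₗ[ℝ] Mat n × Mat n :=
  (projK ∘ₗ (LinearMap.fst ℝ _ _ - LinearMap.snd ℝ _ _)).prod
    (-(projB ∘ₗ (LinearMap.fst ℝ _ _ - LinearMap.snd ℝ _ _)))

theorem doubleTrace_apply (X : Mat n × Mat n) :
    doubleTrace n X = imTrace n X.1 - imTrace n X.2 := rfl

theorem doubleProj_apply (X : Mat n × Mat n) :
    doubleProj n X = (projK (X.1 - X.2), -projB (X.1 - X.2)) := rfl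

theorem doubleProj_of_mem {X : Mat n × Mat n} (h1 : X.1 ∈ 𝔨 n) (h2 : X.2 ∈ 𝔟 n) :
    doubleProj n X = X := by
  have h : projK (X.1 - X.2) = X.1 := projK_eq h1 (by simpa using Submodule.neg_mem _ h2)
  rw [doubleProj_apply, ← sub_projK, h]
  simp

theorem doubleProj_of_eq {X : Mat n × Mat n} (h : X.1 = X.2) : doubleProj n X = 0 := by
  simp [doubleProj_apply, h]

theorem sub_doubleProj (X : Mat n × Mat n) :
    (X - doubleProj n X).1 = (X - doubleProj n X).2 := by
  simp [doubleProj_apply, ← sub_projK]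
  abel

/-- The range `𝔨 × 𝔟` and the kernel, the diagonal, are isotropic subalgebras for the difference
form. The sign makes the `R`-matrix `+1` on the diagonal. -/
theorem isRMatrix_double (n : ℕ) :
    IsRMatrix (doubleTrace n) (-((2 : ℝ) • doubleProj n - 1)) := by
  refine (isRMatrix_of_projection (fun X Y => ?_) (fun Z h => ?_) (fun X Y => ?_) (fun X Y => ?_)
    (fun X Y => ?_) fun X Y => ?_).neg
  · simp [doubleTrace_apply, imTrace_mul_comm]
  · have h1 : Z.1 = 0 := imTrace_nondegenerate _ fun X => by
      simpa [doubleTrace_apply] using h (X, 0)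
    have h2 : Z.2 = 0 := imTrace_nondegenerate _ fun X => by
      simpa [doubleTrace_apply] using h (0, X)
    exact Prod.ext h1 h2
  · refine doubleProj_of_mem (commutator_mem_𝔨 (projK_mem _) (projK_mem _)) ?_
    have h : ∀ Z : Mat n × Mat n, (doubleProj n Z).2 ∈ 𝔟 n := fun Z =>
      Submodule.neg_mem _ (projB_mem _)
    exact Submodule.sub_mem _ (mul_mem_𝔟 (h X) (h Y)) (mul_mem_𝔟 (h Y) (h X))
  · refine doubleProj_of_eq ?_
    simp only [Prod.fst_sub, Prod.snd_sub, Prod.fst_mul, Prod.snd_mul]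
    simp only [← Prod.fst_sub, ← Prod.snd_sub, sub_doubleProj]
  · rw [doubleTrace_apply]
    simp [doubleProj_apply, imTrace_mul_𝔨 (projK_mem _) (projK_mem _),
      imTrace_𝔟 (mul_mem_𝔟 (projB_mem _) (projB_mem _)), -map_sub]
  · rw [doubleTrace_apply, Prod.fst_mul, Prod.snd_mul, sub_doubleProj, sub_doubleProj, sub_self]

theorem hamVector_double (a u : Mat n × Mat n) :
    hamVector (-((2 : ℝ) • doubleProj n - 1)) a u =
      doubleProj n (a * u) * a - a * doubleProj n (u * a) := by
  simp only [hamVector, LinearMap.neg_apply, LinearMap.sub_apply, LinearMap.smul_apply,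
    Module.End.one_apply, mul_sub, sub_mul, mul_smul_comm, smul_mul_assoc, mul_assoc, mul_neg,
    neg_mul]
  module

/-! ### The dual group inside the units of the double -/

/-- The embedding `g ↦ (g₊, g₋)` of the dual group. -/
def dualEmbedding (g : Gl n) : (Mat n × Mat n)ˣ := MulEquiv.prodUnits.symm (iwasawa g)

theorem dualEmbedding_val (g : Gl n) :
    (dualEmbedding g : Mat n × Mat n) = (((iwasawa g).1 : Mat n), ((iwasawa g).2 : Mat n)) := rfl

theorem dualEmbedding_starMul (g h : Gl n) :
    dualEmbedding (starMul g h) = dualEmbedding g * dualEmbedding h := by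
  rw [dualEmbedding, iwasawa_starMul, dualEmbedding, dualEmbedding, ← map_mul]
  rfl

theorem dualEmbedding_one : dualEmbedding (1 : Gl n) = 1 := by
  rw [dualEmbedding, iwasawa_one]
  exact map_one (MulEquiv.prodUnits (M := Mat n) (N := Mat n)).symm

/-- The extension of a function along `dualEmbedding`. -/
def dualExtension (f : Gl n → ℝ) (u : (Mat n × Mat n)ˣ) : ℝ :=
  f ((MulEquiv.prodUnits u).1 * (MulEquiv.prodUnits u).2⁻¹)

theorem dualExtension_dualEmbedding (f : Gl n → ℝ) (g : Gl n) :
    dualExtension f (dualEmbedding g) = f g := by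
  rw [dualExtension, dualEmbedding, MulEquiv.apply_symm_apply, iwasawa_mul_inv]

theorem smooth_dualExtension {f : Gl n → ℝ} (hf : Smooth (Imat n) f) :
    Smooth 𝓘(ℝ, Mat n × Mat n) (dualExtension f) := by
  have key : ∀ u : (Mat n × Mat n)ˣ,
      (u : Mat n × Mat n).1 * Ring.inverse (u : Mat n × Mat n).2 =
        (((MulEquiv.prodUnits u).1 * (MulEquiv.prodUnits u).2⁻¹ : Gl n) : Mat n) := fun u => by
    rw [Units.val_mul, ← Ring.inverse_unit]
    rfl
  refine smooth_of_contDiffAt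
    (f := fun a : Mat n × Mat n => unitsLift f (a.1 * Ring.inverse a.2)) (fun u => ?_) fun u => ?_
  · refine ContDiffAt.comp (u : Mat n × Mat n) (g := unitsLift f) ?_ (contDiffAt_fst.mul
      (ContDiffAt.comp (u : Mat n × Mat n) (g := Ring.inverse)
        (contDiffAt_ringInverse ℝ (MulEquiv.prodUnits u).2) contDiffAt_snd))
    rw [key]
    exact hf.contDiffAt _
  · rw [key, unitsLift_val, dualExtension]

theorem conj_mem_𝔟 {b : Gl n} (hb : b ∈ B n) {X : Mat n} (hX : X ∈ 𝔟 n) :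
    ((b⁻¹ : Gl n) : Mat n) * X * b ∈ 𝔟 n :=
  mul_mem_𝔟 (mul_mem_𝔟 (mem_𝔟_of_mem_B (inv_mem_B hb)) hX) (mem_𝔟_of_mem_B hb)

theorem hasDerivAt_dualEmbedding (g : Gl n) {Y : Mat n × Mat n} (h1 : Y.1 ∈ 𝔨 n)
    (h2 : Y.2 ∈ 𝔟 n) : HasDerivAt (fun t : ℝ => (dualEmbedding
      (((iwasawa g).1 * expGl (t • Y.1)) * ((iwasawa g).2 * expGl (t • Y.2))⁻¹) : Mat n × Mat n))
      ((dualEmbedding g : Mat n × Mat n) * Y) 0 := by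
  refine ((hasDerivAt_mul_expGl (iwasawa g).1 Y.1).prodMk
    (hasDerivAt_mul_expGl (iwasawa g).2 Y.2)).congr_of_eventuallyEq
    (Eventually.of_forall fun t => ?_)
  have h := isIwasawa_iwasawa g
  simp only [dualEmbedding_val, iwasawa_eq
    ((K n).mul_mem h.1 (expGl_mem_K (Submodule.smul_mem _ t h1)))
    (mul_mem_B h.2.1 (expGl_mem_B (Submodule.smul_mem _ t h2)))]

theorem isPoissonImmersion_dualEmbedding (n : ℕ) :
    IsPoissonImmersion (M := Gl n) (-((2 : ℝ) • doubleProj n - 1)) (Smooth (Imat n))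
      dualEmbedding where
  extend f hf := ⟨dualExtension f, smooth_dualExtension hf, dualExtension_dualEmbedding f⟩
  restrict φ hφ := by
    refine smooth_of_contDiffAt (f := fun a : Mat n => unitsLift φ
      (unitsLift (fun x : Gl n => ((iwasawa x).1 : Mat n)) a,
        unitsLift (fun x : Gl n => ((iwasawa x).2 : Mat n)) a)) (fun g => ?_) fun g => ?_
    · refine ContDiffAt.comp (g : Mat n) (g := unitsLift φ) ?_
        ((contDiffAt_iwasawa_fst g).prodMk (contDiffAt_iwasawa_snd g))
      rw [unitsLift_val, unitsLift_val]
      exact hφ.contDiffAt (dualEmbedding g)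
    · rw [unitsLift_val, unitsLift_val, ← dualEmbedding_val, unitsLift_val]
  tangent g u := by
    have h := isIwasawa_iwasawa g
    set a : Mat n × Mat n := (dualEmbedding g : Mat n × Mat n) with ha
    -- The Hamiltonian vector is `a * Y`. Both terms of `Y` lie in `𝔨 × 𝔟`, the range of
    -- `doubleProj`, which conjugation by `K × B` preserves.
    let Y : Mat n × Mat n :=
      (((dualEmbedding g)⁻¹ : (Mat n × Mat n)ˣ) : Mat n × Mat n) * doubleProj n (a * u) * a -
        doubleProj n (u * a)
    have h1 : Y.1 ∈ 𝔨 n :=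
      Submodule.sub_mem _ (conj_mem_𝔨 h.1 (projK_mem _)) (projK_mem _)
    have h2 : Y.2 ∈ 𝔟 n :=
      Submodule.sub_mem _ (conj_mem_𝔟 h.2.1 (Submodule.neg_mem _ (projB_mem _)))
        (Submodule.neg_mem _ (projB_mem _))
    refine ⟨_, ?_, (hasDerivAt_dualEmbedding g h1 h2).congr_deriv ?_⟩
    · simp only [zero_smul, expGl_zero, mul_one, iwasawa_mul_inv]
    · rw [hamVector_double]
      simp only [Y, mul_sub, ← mul_assoc, ha, Units.mul_inv, one_mul]

/-- The Poisson bracket of the dual group. -/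
def dualBracket (n : ℕ) : (DualGl n → ℝ) → (DualGl n → ℝ) → DualGl n → ℝ :=
  (isRMatrix_double n).restrictBracket (dualEmbedding (n := n))

theorem isPoissonLieGroup_dualBracket (n : ℕ) :
    IsPoissonLieGroup (Imat n) (dualBracket n) where
  lieGroup := lieGroup_dual n
  poisson := (isPoissonImmersion_dualEmbedding n).isPoissonBracket_restrictBracket
    (isRMatrix_double n)
  multiplicative := IsPoissonImmersion.isMultiplicative_restrictBracket (M := DualGl n)
    (ι := dualEmbedding (n := n)) (isPoissonImmersion_dualEmbedding n) (isRMatrix_double n)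
    (dualEmbedding_starMul (n := n))

/-! ### Linearization of the dual bracket -/

theorem hasDerivAt_expGl_mul_inv (X Y : Mat n) :
    HasDerivAt (fun t : ℝ => ((expGl (t • X) * (expGl (t • Y))⁻¹ : Gl n) : Mat n)) (X - Y) 0 := by
  have h : ∀ t : ℝ, (expGl (t • Y))⁻¹ = expGl (t • -Y) := fun t => by
    ext1
    rw [Matrix.coe_units_inv, smul_neg]
    exact (Matrix.exp_neg _).symm
  simp only [h]
  refine ((hasDerivAt_expGl X).fun_mul (hasDerivAt_expGl (-Y))).congr_deriv ?_
  simp [expGl_zero, sub_eq_add_neg]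

/-- The extension depends on `u.1 * u.2⁻¹`, whose derivative at `1` is `V.1 - V.2`; against the
difference form this is represented by a diagonal element. -/
theorem gradient_dualExtension_one {φ : Gl n → ℝ} (h : Smooth (Imat n) φ) {ξ : Mat n}
    (hξ : ∀ X : Mat n, fderiv ℝ (unitsLift φ) ((1 : Gl n) : Mat n) X = pairing n ξ X) :
    (isRMatrix_double n).gradient (unitsLift (dualExtension φ)) 1 = (ξ, ξ) := by
  refine (isRMatrix_double n).sharp_eq fun V => ?_
  have hc : HasDerivAt (fun t : ℝ => ((MulEquiv.prodUnits.symm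
      (expGl (t • V.1), expGl (t • V.2)) : (Mat n × Mat n)ˣ) : Mat n × Mat n)) V 0 :=
    (hasDerivAt_expGl V.1).prodMk (hasDerivAt_expGl V.2)
  have hd := hasDerivAt_expGl_mul_inv V.1 V.2
  have h1 := (smooth_dualExtension h).hasDerivAt_comp hc
  have h3 := h.hasDerivAt_comp hd
  simp only [zero_smul, expGl_zero, inv_one, mul_one] at h1 h3
  rw [hξ] at h3
  have h4 := h1.unique h3
  refine Eq.trans ?_ (h4.trans ?_)
  · rfl
  · simp only [doubleTrace_apply, pairing_apply, map_sub, Prod.fst_mul, Prod.snd_mul]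

theorem diffOne_dualBracket {φ ψ : Gl n → ℝ} (hφ : Smooth (Imat n) φ) (hψ : Smooth (Imat n) ψ)
    {ξ η : Mat n}
    (hξ : ∀ X : Mat n, fderiv ℝ (unitsLift φ) ((1 : Gl n) : Mat n) X = pairing n ξ X)
    (hη : ∀ X : Mat n, fderiv ℝ (unitsLift ψ) ((1 : Gl n) : Mat n) X = pairing n η X)
    (X : Mat n) :
    fderiv ℝ (unitsLift (𝔸 := Mat n) (dualBracket n φ ψ)) ((1 : Gl n) : Mat n) X =
      pairing n (commBracket ξ η) X := by
  have hb : Smooth (G := Gl n) (Imat n) (dualBracket n φ ψ) :=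
    (isPoissonLieGroup_dualBracket n).poisson.smooth φ ψ hφ hψ
  have heq : ∀ g : Gl n, (isRMatrix_double n).unitsBracket (dualExtension φ) (dualExtension ψ)
      (dualEmbedding g) = dualBracket n φ ψ g := fun g =>
    ((isPoissonImmersion_dualEmbedding n).restrictBracket_eq (isRMatrix_double n)
      (smooth_dualExtension hφ) (smooth_dualExtension hψ) (dualExtension_dualEmbedding φ)
      (dualExtension_dualEmbedding ψ) g).symm
  -- The pair is chosen so that the difference of its components is `X`: it is the tangent vector of
  -- `K × B` corresponding to `X`.
  have hc := hasDerivAt_dualEmbedding (1 : Gl n) (Y := (projK X, -projB X)) (projK_mem X)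
    (Submodule.neg_mem _ (projB_mem X))
  simp only [iwasawa_one, one_mul, dualEmbedding_one, Units.val_one] at hc
  have hd := hasDerivAt_expGl_mul_inv (projK X) (-projB X)
  rw [sub_neg_eq_add, ← sub_projK, add_sub_cancel] at hd
  have h1 := hb.hasDerivAt_comp hd
  have h2 := ((isRMatrix_double n).smooth_unitsBracket (smooth_dualExtension hφ)
    (smooth_dualExtension hψ)).hasDerivAt_comp hc
  simp only [heq, zero_smul, expGl_zero, inv_one, mul_one, dualEmbedding_one] at h1 h2
  rw [sub_projK] at h1
  refine (h1.unique h2).trans ?_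
  rw [IsRMatrix.diffOne_unitsBracket _ (smooth_dualExtension hφ) (smooth_dualExtension hψ),
    (isRMatrix_double n).bivectorDeriv_one, gradient_dualExtension_one hφ hξ,
    gradient_dualExtension_one hψ hη]
  -- On the diagonal the two halves of the induced bracket coincide and add up to the ordinary
  -- commutator.
  have hR : ∀ Z : Mat n, (-((2 : ℝ) • doubleProj n - 1)) (Z, Z) = (Z, Z) := fun Z => by
    rw [LinearMap.neg_apply, LinearMap.sub_apply, LinearMap.smul_apply, doubleProj_of_eq rfl]
    simp
  rw [hR, hR, ← two_smul ℝ, smul_smul, pairing_apply, imTrace_mul_comm]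
  conv_rhs => rw [← add_sub_cancel (projK X) X, sub_projK]
  simp [doubleTrace_apply, commBracket, add_mul]

/-- The cocycle condition is self-dual: invariance of the form moves the commutators across the
pairing, and the claim becomes `pairing_commutator_jBracket` with `(ξ, η)` and `(X, Y)` exchanged.
-/
theorem cocycle_dual (X Y ξ η Xξ Xη Yξ Yη : Mat n)
    (h1 : ∀ Z, pairing n Xξ Z = - pairing n ξ (jBracket X Z))
    (h2 : ∀ Z, pairing n Xη Z = - pairing n η (jBracket X Z))
    (h3 : ∀ Z, pairing n Yξ Z = - pairing n ξ (jBracket Y Z))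
    (h4 : ∀ Z, pairing n Yη Z = - pairing n η (jBracket Y Z)) :
    pairing n (commBracket ξ η) (jBracket X Y) =
      - (pairing n (commBracket Xξ η) Y + pairing n (commBracket ξ Xη) Y) +
        (pairing n (commBracket Yξ η) X + pairing n (commBracket ξ Yη) X) := by
  have e1 : ∀ ξ η Y : Mat n,
      pairing n (commBracket ξ η) Y = pairing n ξ (commBracket η Y) := fun ξ η Y => by
    have := imTrace_mul_comm η (ξ * Y)
    rw [pairing_apply, pairing_apply]
    simp only [commBracket, sub_mul, mul_sub, map_sub, mul_assoc] at this ⊢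
    rw [this]
  have e2 : ∀ ξ η Y : Mat n,
      pairing n (commBracket ξ η) Y = - pairing n η (commBracket ξ Y) := fun ξ η Y => by
    rw [← e1, ← LinearMap.neg_apply, ← map_neg, commBracket, commBracket, neg_sub]
  have e3 : ∀ ξ X Y, pairing n ξ (jBracket Y X) = - pairing n ξ (jBracket X Y) :=
    fun ξ X Y => by rw [(isLieBracket_jBracket n).skew, map_neg]
  rw [e1 Xξ, e2 ξ Xη, e1 Yξ, e2 ξ Yη, h1, h2, h3, h4, e3 ξ _ Y, e3 η _ Y]
  have := pairing_commutator_jBracket ξ η X Y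
  simp only [pairing_apply, commBracket]
  rw [this]
  ring

theorem diffOne_dual_apply {φ : DualGl n → ℝ} (h : Smooth (Imat n) φ) (X : Mat n) :
    diffOne (G := DualGl n) (Imat n) φ X =
      fderiv ℝ (unitsLift (𝔸 := Mat n) φ) ((1 : Gl n) : Mat n) X :=
  diffOne_units_apply (𝔸 := Mat n) h X

theorem diffOne_dualBracket_apply {φ ψ : DualGl n → ℝ} (hφ : Smooth (Imat n) φ)
    (hψ : Smooth (Imat n) ψ) (ξ η : Mat n)
    (hξ : ∀ X : Mat n, diffOne (G := DualGl n) (Imat n) φ X = pairing n ξ X)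
    (hη : ∀ X : Mat n, diffOne (G := DualGl n) (Imat n) ψ X = pairing n η X) (X : Mat n) :
    diffOne (G := DualGl n) (Imat n) (dualBracket n φ ψ) X = pairing n (commBracket ξ η) X := by
  rw [diffOne_dual_apply ((isPoissonLieGroup_dualBracket n).poisson.smooth φ ψ hφ hψ)]
  refine diffOne_dualBracket hφ hψ (fun X => ?_) (fun X => ?_) X
  · exact (diffOne_dual_apply hφ X).symm.trans (hξ X)
  · exact (diffOne_dual_apply hψ X).symm.trans (hη X)

/-- The tangent Lie bialgebra of the dual group is `(𝔤_J, 𝔤)`. -/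
theorem hasTangentLieBialgebra_dualBracket (n : ℕ) :
    HasTangentLieBialgebra (G := DualGl n) (Imat n) (dualBracket n) (𝔥 := Mat n) commBracket
      (pairing n).flip where
  perfect l := by
    let l' : Mat n →L[ℝ] ℝ := l
    exact existsUnique_pairing_eq (n := n) (l' : Mat n →ₗ[ℝ] ℝ)
  lie := isLieBracket_commutator (A := Mat n)
  cocycle X Y ξ η Xξ Xη Yξ Yη h1 h2 h3 h4 := by
    have key : ∀ {X ξ ξ' : Mat n},
        IsCoad (G := DualGl n) (I := Imat n) (pairing n).flip X ξ ξ' →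
        ∀ Z, pairing n ξ' Z = - pairing n ξ (jBracket X Z) := fun {X ξ ξ'} h Z =>
      (h Z).trans (congrArg (fun W : Mat n => - pairing n ξ W) (groupLieAlgebra_dual_bracket X Z))
    exact (congrArg (fun W : Mat n => pairing n (commBracket ξ η) W)
      (groupLieAlgebra_dual_bracket X Y)).trans
      (cocycle_dual X Y ξ η Xξ Xη Yξ Yη (key h1) (key h2) (key h3) (key h4))
  tangent _ _ hφ hψ := diffOne_dualBracket_apply hφ hψ

/-- The dual group and `GL(n, ℂ)` with the Sklyanin bracket are dual Poisson Lie groups. -/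
theorem areDualPoissonLieGroups (n : ℕ) :
    AreDualPoissonLieGroups (G := Gl n) (G' := DualGl n) (Imat n) (Imat n) (sklyanin n)
      (dualBracket n) (pairing n) where
  left := isPoissonLieGroup_sklyanin n
  right := isPoissonLieGroup_dualBracket n
  tangent_left := by
    -- `GroupLieAlgebra` unfolds to `Mat n`, so the whole bracket can be exchanged as a function on
    -- matrices.
    let d : GroupLieAlgebra (Imat n) (DualGl n) → GroupLieAlgebra (Imat n) (DualGl n) →
      GroupLieAlgebra (Imat n) (DualGl n) := fun X Y => ⁅X, Y⁆
    have h : @Eq (Mat n → Mat n → Mat n) d jBracket :=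
      funext₂ groupLieAlgebra_dual_bracket
    exact (congrArg (fun d => HasTangentLieBialgebra (G := Gl n) (Imat n) (sklyanin n)
      (𝔥 := Mat n) d (pairing n)) h).mpr (hasTangentLieBialgebra_sklyanin n)
  tangent_right := by
    let d : GroupLieAlgebra (Imat n) (Gl n) → GroupLieAlgebra (Imat n) (Gl n) →
      GroupLieAlgebra (Imat n) (Gl n) := fun X Y => ⁅X, Y⁆
    have h : @Eq (Mat n → Mat n → Mat n) d commBracket :=
      funext₂ groupLieAlgebra_gl_bracket
    exact (congrArg (fun d => HasTangentLieBialgebra (G := DualGl n) (Imat n) (dualBracket n)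
      (𝔥 := Mat n) d (pairing n).flip) h).mpr (hasTangentLieBialgebra_dualBracket n)

end DualPoisson

end PoissonLie

end

theorem proposition2p1 (n : ℕ) :
    -- (a) `J` is skew-symmetric; `GL(n, ℂ)` with the Sklyanin bracket is a coboundary Poisson Lie
    -- group, with tangent Lie bialgebra `(𝔤, 𝔤_J)`, and `U(n)` is a Poisson Lie subgroup
    ((∀ X Y : Mat n, pairing n (J X) Y = - pairing n X (J Y)) ∧
      IsCoboundaryPoissonLieGroup (Imat n) (sklyanin n) ∧
      (∀ X Y : GroupLieAlgebra (Imat n) (Gl n), ⁅X, Y⁆ = commBracket (n := n) X Y) ∧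
      HasTangentLieBialgebra (G := Gl n) (Imat n) (sklyanin n) (𝔥 := Mat n) jBracket
        (pairing n) ∧
      IsPoissonLieSubgroup (Imat n) (sklyanin n) (K n)) ∧
    -- (b) the Hamiltonian equation of motion generated by `φ`, and the one generated by `H_k`
    ((∀ φ : Gl n → ℝ, Smooth (Imat n) φ → ∀ (γ : ℝ → Gl n) (t : ℝ),
        HamiltonEqAt (Smooth (Imat n)) (sklyanin n) φ γ t ↔
          HasDerivAt (fun s => (γ s : Mat n))
            (γ t * projK (grad' φ (γ t)) - projK (grad φ (γ t)) * γ t) t) ∧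
      (∀ k : ℕ, 1 ≤ k → Smooth (Imat n) (ham (n := n) k) ∧ ∀ (γ : ℝ → Gl n) (t : ℝ),
        HamiltonEqAt (Smooth (Imat n)) (sklyanin n) (ham k) γ t ↔
          HasDerivAt (fun s => (γ s : Mat n)) (flowField k (γ t : Mat n)) t)) ∧
    -- (c) the dual Poisson Lie group is `G` with the multiplication `g ∗ h = g₊ h g₋⁻¹`
    ((∀ g : Gl n, ∃! p : Gl n × Gl n, IsIwasawa g p) ∧
      ∃ _ : Group (DualGl n),
        (∀ g h : DualGl n, g * h = starMul (n := n) g h) ∧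
        (∀ X Y : GroupLieAlgebra (Imat n) (DualGl n), ⁅X, Y⁆ = jBracket (n := n) X Y) ∧
        ∃ b' : (DualGl n → ℝ) → (DualGl n → ℝ) → DualGl n → ℝ,
          AreDualPoissonLieGroups (G := Gl n) (G' := DualGl n) (Imat n) (Imat n) (sklyanin n) b'
            (pairing n)) ∧
    -- (d) the equations of motion on `G × G` generated by `H_k (g₁ g₂)`, and the monodromy
    (∀ k : ℕ, 1 ≤ k →
      Smooth ((Imat n).prod (Imat n)) (fun p : Gl n × Gl n => ham k (p.1 * p.2)) ∧
      ∀ (γ₁ γ₂ : ℝ → Gl n) (t : ℝ),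
      (HamiltonEqAt (Smooth ((Imat n).prod (Imat n))) (prodBracket (sklyanin n) (sklyanin n))
          (fun p => ham k (p.1 * p.2)) (fun s => (γ₁ s, γ₂ s)) t ↔
        HasDerivAt (fun s => (γ₁ s : Mat n))
          (γ₁ t * projK (Complex.I • (γ₂ t * γ₁ t : Mat n) ^ k) -
            projK (Complex.I • (γ₁ t * γ₂ t : Mat n) ^ k) * γ₁ t) t ∧
        HasDerivAt (fun s => (γ₂ s : Mat n))
          (γ₂ t * projK (Complex.I • (γ₁ t * γ₂ t : Mat n) ^ k) -
            projK (Complex.I • (γ₂ t * γ₁ t : Mat n) ^ k) * γ₂ t) t) ∧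
      (HamiltonEqAt (Smooth ((Imat n).prod (Imat n))) (prodBracket (sklyanin n) (sklyanin n))
          (fun p => ham k (p.1 * p.2)) (fun s => (γ₁ s, γ₂ s)) t →
        HasDerivAt (fun s => (γ₁ s * γ₂ s : Mat n)) (flowField k (γ₁ t * γ₂ t : Mat n)) t)) := by
  refine ⟨⟨pairing_J, isCoboundaryPoissonLieGroup_sklyanin n, groupLieAlgebra_gl_bracket,
    hasTangentLieBialgebra_sklyanin n, isPoissonLieSubgroup_K n⟩,
    ⟨fun φ hφ γ t => hamiltonEqAt_sklyanin_iff hφ γ t,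
      fun k hk => ⟨smooth_ham n k, fun γ t => hamiltonEqAt_ham_iff hk γ t⟩⟩,
    ⟨existsUnique_isIwasawa, dualGroup n, dual_mul_def, groupLieAlgebra_dual_bracket,
      dualBracket n, areDualPoissonLieGroups n⟩,
    fun k hk => ⟨smooth_ham_mul n k, fun γ₁ γ₂ t => ⟨hamiltonEqAt_ham_mul_iff hk γ₁ γ₂ t,
      fun h => ?_⟩⟩⟩
  rw [hamiltonEqAt_ham_mul_iff hk] at h
  exact hasDerivAt_monodromy h.1 h.2
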